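/- All theories are one-sorted theories of first-order predicate logic with identity in a finite signature. An RE theory is a theory axiomatised by a recursively enumerable set of sentences; an index of it is an index of the RE set of Gödel numbers of such an axiom set (together with the signature). A theory is \emph{essentially undecidable} if all its consistent extensions in the same language are undecidable. ``Interprets'' refers to piecewise, multidimensional (with dimensions varying over the pieces), relative, not necessarily identity-preserving interpretations with parameters. Let $\mathsf J$ be the theory in the language with one binary relation symbol $\mathsf E$ whose axioms say that $\mathsf E$ is an equivalence relation and, for each $n$, that there is at most one equivalence class with precisely $n$ elements and that there are at least $n$ equivalence classes with at least $n$ elements. Let $\mathsf A_n$ be the sentence ``there is an equivalence class with precisely $n+1$ elements''. For a set $\mathcal X\subseteq\mathbb N$, a $\mathsf J,\mathcal X$-theory is a theory axiomatised over $\mathsf J$ by boolean combinations of sentences $\mathsf A_s$ with $s\in\mathcal X$. \textbf{Theorem.} For every essentially undecidable RE theory $U$ there is a consistent, essentially undecidable RE theory $W$ that does not interpret $U$. More precisely, for every essentially undecidable RE theory $U$ there are a recursive set $\mathcal X\subseteq\mathbb N$ such that no consistent $\mathsf J,\mathcal X$-theory interprets $U$, and disjoint recursively inseparable RE sets $\mathcal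 Y,\mathcal Z\subseteq\mathcal X$, such that \[ W := \mathsf J+\{\mathsf A_n\mid n\in\mathcal Y\}+\{\neg\,\mathsf A_n\mid n\in\mathcal Z\} \] is a consistent, essentially undecidable RE theory that does not interpret $U$. Moreover, there are total computable functions which, given any index (with signature) of any essentially undecidable RE theory $U$, return an index of a decision procedure for such a set $\mathcal X$, RE indices of such sets $\mathcal Y$ and $\mathcal Z$, and an index of the corresponding theory $W$. -/

import Mathlib

/-! ## Finite signatures and Gödel numbering -/

namespace EssUndec

open FirstOrder FirstOrder.Language
open Nat.Partrec (Code)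

/-- A finite one-sorted signature: the list of the arities of its function symbols, followed by
the list of the arities of its relation symbols. Constants are function symbols of arity `0`. -/
abbrev Signature : Type := List ℕ × List ℕ

/-- The first-order language of a finite signature. -/
def Signature.lang (s : Signature) : FirstOrder.Language.{0, 0} where
  Functions n := {i : Fin s.1.length // s.1.get i = n}
  Relations n := {i : Fin s.2.length // s.2.get i = n}

/-- Gödel numbers of terms in the (de Bruijn indexed) variables `0, …, n - 1`. -/
def termCode {s : Signature} {n : ℕ} : s.lang.Term (Empty ⊕ Fin n) → ℕ
  | .var (.inl x) => x.elim
  | .var (.inr x) => Nat.pair 0 x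
  | .func f ts =>
    Nat.pair 1 (Nat.pair f.1 (Encodable.encode (List.ofFn fun i => termCode (ts i))))

/-- Gödel numbers of formulas in the (de Bruijn indexed) variables `0, …, n - 1`. -/
def formulaCode {s : Signature} : ∀ {n : ℕ}, s.lang.BoundedFormula Empty n → ℕ
  | _, .falsum => Nat.pair 0 0
  | _, .equal t₁ t₂ => Nat.pair 1 (Nat.pair (termCode t₁) (termCode t₂))
  | _, .rel R ts =>
    Nat.pair 2 (Nat.pair R.1 (Encodable.encode (List.ofFn fun i => termCode (ts i))))
  | _, .imp φ ψ => Nat.pair 3 (Nat.pair (formulaCode φ) (formulaCode ψ))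
  | _, .all φ => Nat.pair 4 (formulaCode φ)

theorem termCode_injective {s : Signature} {n : ℕ} :
    Function.Injective (termCode : s.lang.Term (Empty ⊕ Fin n) → ℕ) := by
  intro t
  induction t with
  | var x =>
    rcases x with x | x
    · exact x.elim
    · rintro ((y | y) | ⟨f, us⟩) h
      · exact y.elim
      · simp only [termCode, Nat.pair_eq_pair] at h
        rw [Fin.ext h.2]
      · simp [termCode, Nat.pair_eq_pair] at h
  | @func l f ts ih =>
    rintro ((y | y) | @⟨l', g, us⟩) h
    · exact y.elim
    · simp [termCode, Nat.pair_eq_pair] at h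
    · simp only [termCode, Nat.pair_eq_pair, true_and] at h
      obtain ⟨h1, h2⟩ := h
      obtain ⟨i, rfl⟩ := f
      obtain ⟨j, rfl⟩ := g
      obtain rfl : i = j := Fin.ext h1
      have h3 := List.ofFn_injective (Encodable.encode_injective h2)
      rw [show ts = us from funext fun k => ih k (congrFun h3 k)]

/-- Distinct formulas have distinct Gödel numbers. -/
theorem formulaCode_injective {s : Signature} {n : ℕ} :
    Function.Injective (formulaCode : s.lang.BoundedFormula Empty n → ℕ) := by
  intro φ
  induction φ with
  | falsum => intro ψ h; cases ψ <;> simp [formulaCode, Nat.pair_eq_pair] at h ⊢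
  | equal t u =>
    intro ψ h
    cases ψ <;> simp [formulaCode, Nat.pair_eq_pair] at h ⊢
    exact ⟨termCode_injective h.1, termCode_injective h.2⟩
  | rel R ts =>
    intro ψ h
    cases ψ <;> simp only [formulaCode, Nat.pair_eq_pair] at h <;> try omega
    rename_i R' us
    obtain ⟨-, h1, h2⟩ := h
    obtain ⟨i, rfl⟩ := R
    obtain ⟨j, rfl⟩ := R'
    obtain rfl : i = j := Fin.ext h1
    have h3 := List.ofFn_injective (Encodable.encode_injective h2)
    rw [show ts = us from funext fun k => termCode_injective (congrFun h3 k)]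
  | imp φ ψ ih1 ih2 =>
    intro χ h
    cases χ <;> simp [formulaCode, Nat.pair_eq_pair] at h ⊢
    exact ⟨ih1 h.1, ih2 h.2⟩
  | all φ ih =>
    intro χ h
    cases χ <;> simp [formulaCode, Nat.pair_eq_pair] at h ⊢
    exact ih h

/-! ## Recursion-theoretic notions -/

/-- `e` is an RE index of the set `A`: the `e`-th partial recursive function has domain `A`. -/
def IsREIndex (e : Code) (A : Set ℕ) : Prop :=
  ∀ m, (e.eval m).Dom ↔ m ∈ A

/-- `e` is an index of a decision procedure for `A`: the `e`-th partial recursive function is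
the characteristic function of `A`. -/
def IsDecisionIndex (e : Code) (A : Set ℕ) : Prop :=
  ∀ m, (m ∈ A → 1 ∈ e.eval m) ∧ (m ∉ A → 0 ∈ e.eval m)

/-- `Y` and `Z` are disjoint, and no recursive set includes `Y` and is disjoint from `Z`. -/
def RecursivelyInseparable (Y Z : Set ℕ) : Prop :=
  Disjoint Y Z ∧ ¬ ∃ D : Set ℕ, ComputablePred (fun m => m ∈ D) ∧ Y ⊆ D ∧ Disjoint D Z

/-! ## Theories

A theory is given by a set of axioms; its theorems are the sentences `φ` with `T ⊨ᵇ φ`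
(by Gödel's completeness theorem, the sentences provable from the axioms). -/

/-- `e` is an index of the RE theory `T`: an RE index of the set of Gödel numbers of axioms. -/
def IsTheoryIndex {s : Signature} (e : Code) (T : s.lang.Theory) : Prop :=
  IsREIndex e {m | ∃ φ : s.lang.Sentence, φ ∈ T ∧ formulaCode φ = m}

/-- The set of (Gödel numbers of) theorems of `T` is recursive. -/
def DecidableTheory {s : Signature} (T : s.lang.Theory) : Prop :=
  ComputablePred fun m : ℕ => ∃ φ : s.lang.Sentence, T ⊨ᵇ φ ∧ formulaCode φ = m

/-- All consistent extensions of `T` in the same language are undecidable. -/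
def EssentiallyUndecidable {s : Signature} (T : s.lang.Theory) : Prop :=
  ∀ V : s.lang.Theory, (∀ φ : s.lang.Sentence, T ⊨ᵇ φ → V ⊨ᵇ φ) → V.IsSatisfiable →
    ¬ DecidableTheory V

/-! ## Interpretations

Piecewise, multidimensional (with dimensions varying over the pieces), relative,
non-identity-preserving interpretations with parameters. -/

/-- A translation of the language `L₁` into the language `L₂`. In all formulas the variables
in `Fin params` stand for the parameters. -/
structure Translation (L₁ L₂ : FirstOrder.Language.{0, 0}) where
  /-- the number of pieces -/
  pieces : ℕ
  /-- the dimension of each piece -/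
  dim : Fin pieces → ℕ
  /-- the number of parameters -/
  params : ℕ
  /-- the formula that defines the range of the parameters -/
  paramDom : L₂.Formula (Fin params)
  /-- the domain of each piece -/
  dom : ∀ i, L₂.Formula (Fin params ⊕ Fin (dim i))
  /-- the translation of identity, for arguments in the pieces `ρ 0` and `ρ 1` -/
  eq : ∀ ρ : Fin 2 → Fin pieces, L₂.Formula (Fin params ⊕ Σ m, Fin (dim (ρ m)))
  /-- the translation of a relation symbol, for arguments in the pieces `ρ 0, …, ρ (n - 1)` -/
  rel : ∀ {n : ℕ}, L₁.Relations n → ∀ ρ : Fin n → Fin pieces,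
    L₂.Formula (Fin params ⊕ Σ m, Fin (dim (ρ m)))
  /-- the translation of the graph of a function symbol, for arguments in the pieces
  `ρ 0, …, ρ (n - 1)` and a value in the piece `j` -/
  func : ∀ {n : ℕ}, L₁.Functions n → ∀ (ρ : Fin n → Fin pieces) (j : Fin pieces),
    L₂.Formula (Fin params ⊕ ((Σ m, Fin (dim (ρ m))) ⊕ Fin (dim j)))

namespace Translation

variable {L₁ L₂ : FirstOrder.Language.{0, 0}} (τ : Translation L₁ L₂)

/-- A source variable is represented by a piece and a tuple of target variables in `X`. -/
abbrev Tuple (X : Type) : Type := Σ i : Fin τ.pieces, (Fin (τ.dim i) → X)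

/-- Renaming the target variables of a tuple. -/
def Tuple.map {τ : Translation L₁ L₂} {X Y : Type} (f : X → Y) (v : τ.Tuple X) : τ.Tuple Y :=
  ⟨v.1, f ∘ v.2⟩

/-- `∃ z⃗₀ ∈ δ … ∃ z⃗₍ₙ₋₁₎ ∈ δ, body`, where each `z⃗ₘ` ranges over all pieces: the disjunction over
all assignments `ρ` of pieces of the existential quantification over tuples in their domains. -/
noncomputable def existsTuples {X : Type} (p : Fin τ.params → X) (n : ℕ)
    (body : ∀ ρ : Fin n → Fin τ.pieces, L₂.Formula (X ⊕ Σ m, Fin (τ.dim (ρ m)))) :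
    L₂.Formula X :=
  Formula.iSup fun ρ : Fin n → Fin τ.pieces =>
    Formula.iExs (Σ m, Fin (τ.dim (ρ m)))
      (Formula.iInf (fun m : Fin n =>
          (τ.dom (ρ m)).relabel (Sum.elim (Sum.inl ∘ p) fun l => Sum.inr ⟨m, l⟩)) ⊓ body ρ)

/-- The formula expressing that the tuple `y` of the piece `j` is a value of the term `t`; `p`
names the parameters and `σ` the tuples that represent the variables of `t`. -/
noncomputable def value {n : ℕ} : L₁.Term (Empty ⊕ Fin n) → ∀ {X : Type},
    (Fin τ.params → X) → (Fin n → τ.Tuple X) → ∀ j : Fin τ.pieces, (Fin (τ.dim j) → X) →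
      L₂.Formula X
  | .var (.inl x), _, _, _, _, _ => x.elim
  | .var (.inr x), _, _, σ, j, y =>
    if h : (σ x).1 = j then
      Formula.iInf fun l : Fin (τ.dim j) =>
        Term.equal (Term.var (y l)) (Term.var ((σ x).2 (l.cast (by rw [h]))))
    else ⊥
  | .func (l := k) f ts, _, p, σ, j, y =>
    τ.existsTuples p k fun ρ =>
      Formula.iInf (fun m : Fin k =>
          value (ts m) (Sum.inl ∘ p) (fun x => (σ x).map Sum.inl) (ρ m)
            (fun l => Sum.inr ⟨m, l⟩)) ⊓
        (τ.func f ρ j).relabel (Sum.elim (Sum.inl ∘ p) (Sum.elim Sum.inr (Sum.inl ∘ y)))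

/-- The translation of the atomic formula obtained by applying an `n`-ary predicate to the terms
`ts`, where `P` translates the predicate: the terms are replaced by existentially quantified
values. -/
noncomputable def atomic {n k : ℕ} {X : Type} (p : Fin τ.params → X) (σ : Fin n → τ.Tuple X)
    (P : ∀ ρ : Fin k → Fin τ.pieces, L₂.Formula (Fin τ.params ⊕ Σ m, Fin (τ.dim (ρ m))))
    (ts : Fin k → L₁.Term (Empty ⊕ Fin n)) : L₂.Formula X :=
  τ.existsTuples p k fun ρ =>
    Formula.iInf (fun m : Fin k =>
        τ.value (ts m) (Sum.inl ∘ p) (fun x => (σ x).map Sum.inl) (ρ m)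
          (fun l => Sum.inr ⟨m, l⟩)) ⊓
      (P ρ).relabel (Sum.elim (Sum.inl ∘ p) Sum.inr)

/-- The translation `φ^τ` of a formula; `p` names the parameters and `σ` the tuples that represent
the variables of `φ`. Quantifiers are relativised to the domains of the pieces. -/
noncomputable def formula : ∀ {n : ℕ}, L₁.BoundedFormula Empty n → ∀ {X : Type},
    (Fin τ.params → X) → (Fin n → τ.Tuple X) → L₂.Formula X
  | _, .falsum, _, _, _ => ⊥
  | _, .equal t₁ t₂, _, p, σ => τ.atomic p σ τ.eq ![t₁, t₂]
  | _, .rel R ts, _, p, σ => τ.atomic p σ (τ.rel R) ts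
  | _, .imp φ ψ, _, p, σ => (formula φ p σ).imp (formula ψ p σ)
  | n, .all φ, _, p, σ =>
    Formula.iInf fun i : Fin τ.pieces =>
      Formula.iAlls (Fin (τ.dim i))
        (((τ.dom i).relabel (Sum.map p id)).imp
          (formula φ (Sum.inl ∘ p)
            (Fin.snoc (α := fun _ : Fin (n + 1) => τ.Tuple _)
              (fun x => (σ x).map Sum.inl) ⟨i, Sum.inr⟩)))

/-- The sentence `∃ p⃗, α(p⃗)`, where `α` is the parameter domain. -/
noncomputable def existsParams : L₂.Sentence :=
  Formula.iExs (Fin τ.params) (τ.paramDom.relabel Sum.inr)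

/-- The sentence `∀ p⃗, (α(p⃗) → φ^τ)`, where `α` is the parameter domain. -/
noncomputable def sentence (φ : L₁.Sentence) : L₂.Sentence :=
  Formula.iAlls (Fin τ.params)
    ((τ.paramDom.relabel Sum.inr).imp (τ.formula φ Sum.inr Fin.elim0))

end Translation

/-- `W` interprets `U`. -/
def Interprets {L₁ L₂ : FirstOrder.Language.{0, 0}} (W : L₂.Theory) (U : L₁.Theory) : Prop :=
  ∃ τ : Translation L₁ L₂, W ⊨ᵇ τ.existsParams ∧
    ∀ φ : L₁.Sentence, U ⊨ᵇ φ → W ⊨ᵇ τ.sentence φ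

/-! ## The theory `J` of an equivalence relation -/

/-- The signature with a single, binary, relation symbol. -/
def sigE : Signature := ([], [2])

/-- The binary relation symbol `E`. -/
def symE : sigE.lang.Relations 2 := ⟨(0 : Fin 1), rfl⟩

/-- The formula `x E y`. -/
def relE {m : ℕ} (x y : Fin m) : sigE.lang.BoundedFormula Empty m :=
  symE.boundedFormula₂ (Term.var (Sum.inr x)) (Term.var (Sum.inr y))

/-- The formula `x = y`. -/
def eqE {m : ℕ} (x y : Fin m) : sigE.lang.BoundedFormula Empty m :=
  Term.bdEqual (Term.var (Sum.inr x)) (Term.var (Sum.inr y))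

/-- The conjunction of a list of formulas. -/
def conj {m : ℕ} (l : List (sigE.lang.BoundedFormula Empty m)) :
    sigE.lang.BoundedFormula Empty m :=
  l.foldr (· ⊓ ·) ⊤

/-- Existential quantification over the last `n` variables. -/
def exLast {m : ℕ} : ∀ n : ℕ, sigE.lang.BoundedFormula Empty (m + n) →
    sigE.lang.BoundedFormula Empty m
  | 0, φ => φ
  | n + 1, φ => exLast n (BoundedFormula.ex φ)

/-- The class of `x` has at least `n` elements:
`∃ y₀ … y₍ₙ₋₁₎, ⋀ i, (x E yᵢ ∧ ⋀ j ≠ i, yᵢ ≠ yⱼ)`. -/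
def classGe {m : ℕ} (n : ℕ) (x : Fin m) : sigE.lang.BoundedFormula Empty m :=
  exLast n (conj ((List.finRange n).map fun i =>
    relE (Fin.castAdd n x) (Fin.natAdd m i) ⊓
      conj ((List.finRange n).map fun j =>
        if i = j then ⊤ else ∼(eqE (Fin.natAdd m i) (Fin.natAdd m j)))))

/-- The class of `x` has precisely `n` elements. -/
def classEq {m : ℕ} (n : ℕ) (x : Fin m) : sigE.lang.BoundedFormula Empty m :=
  classGe n x ⊓ ∼(classGe (n + 1) x)

/-- `E` is reflexive. -/
def reflE : sigE.lang.Sentence :=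
  BoundedFormula.all (n := 0) (relE 0 0)

/-- `E` is symmetric. -/
def symmE : sigE.lang.Sentence :=
  BoundedFormula.all (n := 0) (BoundedFormula.all (n := 1) ((relE 0 1).imp (relE 1 0)))

/-- `E` is transitive. -/
def transE : sigE.lang.Sentence :=
  BoundedFormula.all (n := 0) (BoundedFormula.all (n := 1) (BoundedFormula.all (n := 2)
    ((relE 0 1).imp ((relE 1 2).imp (relE 0 2)))))

/-- There is at most one class with precisely `n` elements. -/
def atMostOneClass (n : ℕ) : sigE.lang.Sentence :=
  BoundedFormula.all (n := 0) (BoundedFormula.all (n := 1)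
    ((classEq n 0).imp ((classEq n 1).imp (relE 0 1))))

/-- There are at least `n` classes with at least `n` elements. -/
def manyLargeClasses (n : ℕ) : sigE.lang.Sentence :=
  exLast (m := 0) n (conj ((List.finRange n).map fun i =>
    classGe n (Fin.natAdd 0 i) ⊓
      conj ((List.finRange n).map fun j =>
        if i = j then ⊤ else ∼(relE (Fin.natAdd 0 i) (Fin.natAdd 0 j)))))

/-- Janiczak's theory `J`. -/
def theoryJ : sigE.lang.Theory :=
  {reflE, symmE, transE} ∪ Set.range atMostOneClass ∪ Set.range manyLargeClasses

/-- The sentence `Aₙ`: there is a class with precisely `n + 1` elements. -/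
def sentA (n : ℕ) : sigE.lang.Sentence :=
  BoundedFormula.ex (n := 0) (classEq (n + 1) 0)

/-- The boolean combinations of the sentences `Aₙ` for `n ∈ X`. -/
inductive IsBoolComb (X : Set ℕ) : sigE.lang.Sentence → Prop
  | sentA (n : ℕ) (hn : n ∈ X) : IsBoolComb X (sentA n)
  | falsum : IsBoolComb X BoundedFormula.falsum
  | imp (φ ψ : sigE.lang.Sentence) (hφ : IsBoolComb X φ) (hψ : IsBoolComb X ψ) :
      IsBoolComb X (BoundedFormula.imp φ ψ)

/-- `T` is axiomatised over `J` by boolean combinations of the sentences `Aₙ` for `n ∈ X`. -/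
def IsJTheory (X : Set ℕ) (T : sigE.lang.Theory) : Prop :=
  ∃ Γ : Set sigE.lang.Sentence, (∀ φ ∈ Γ, IsBoolComb X φ) ∧ T = theoryJ ∪ Γ

end EssUndec

namespace EssUndec

open FirstOrder FirstOrder.Language
open Nat.Partrec (Code)

/-! ## Recursion theory -/

section Recursion

open Computable

variable {α : Type*} [Primcodable α]

/-! A consistent theory over `J` and `X` has a model `EqStr (infSet Q)` with `Q ⊆ X`, where `Q`
records which finite classes exist (`IsJTheory.exists_model`). So it suffices to find a decidable
`X` such that no `infSet Q` with `Q ⊆ X` carries an interpretation of `U`.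

Suppose that a translation interprets `U` there. By the back-and-forth game, a sentence of rank at
most `R` cannot distinguish `infSet Q` from the finite set `finSet P R` when `P` and `Q` agree below
`R` (`similar_infSet_finSet`, `Ranked.sentence_iff`). The rank of a translated sentence is bounded
by a constant times its Gödel number plus one (`Translation.exists_rank`). In a finite structure the
internal models can be listed explicitly, one for each choice of parameters, by a primitive
recursive function of `P` and `R` (`exists_presentation`). So an interpretation yields a
presentation: a primitive recursive code together with a constant. Its finite structures behave like
models of `U` towards every sentence whose Gödel number is small compared with the level `R`.

Now forget where a presentation came from. At a fixed finite pattern `P` none can behave like this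
at all levels: the sentences that hold at their threshold levels would form a consistent decidable
extension of `U` (`exists_isRefutation`). Hence there is a refutation; it involves finitely many
levels and is found by search.

The set `X` is built by waiting. Let `k` be its last element so far and let the `n`-th presentation
be next. Search for refutations of this presentation at all subsets of `{0, …, k}`, and let the
first `N > k` that bounds such refutations be the next element of `X`. Any `Q ⊆ X` has no element
strictly between `k` and `N`, hence agrees below `N` with one of these patterns, and the refutation
applies to `Q` (`exists_isRefutation_of_subset_sparse`). This contradicts `exists_not_isRefutation`.

Membership of `m` in `X` is decided by the first `m` steps, uniformly in the signature and the index
of `U`. The `n`-th element of `X` is a computable function of `n`, and it carries the inseparable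
pair of self-applied programs with values `0` and `1` into `X`. A decidable consistent extension of
`W` would separate the resulting sets by deciding the sentences `sentA n`. -/

theorem computablePred_and {p q : α → Prop} (hp : ComputablePred p) (hq : ComputablePred q) :
    ComputablePred fun a => p a ∧ q a := by
  obtain ⟨f, hf, rfl⟩ := ComputablePred.computable_iff.1 hp
  obtain ⟨g, hg, rfl⟩ := ComputablePred.computable_iff.1 hq
  exact ComputablePred.computable_iff.2
    ⟨fun a => f a && g a, Primrec.and.to_comp.comp hf hg, by simp⟩

theorem computablePred_or {p q : α → Prop} (hp : ComputablePred p) (hq : ComputablePred q) :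
    ComputablePred fun a => p a ∨ q a := by
  obtain ⟨f, hf, rfl⟩ := ComputablePred.computable_iff.1 hp
  obtain ⟨g, hg, rfl⟩ := ComputablePred.computable_iff.1 hq
  exact ComputablePred.computable_iff.2
    ⟨fun a => f a || g a, Primrec.or.to_comp.comp hf hg, by simp⟩

theorem computablePred_comp {β : Type*} [Primcodable β] {p : β → Prop} {f : α → β}
    (hp : ComputablePred p) (hf : Computable f) : ComputablePred fun a => p (f a) := by
  obtain ⟨g, hg, rfl⟩ := ComputablePred.computable_iff.1 hp
  exact ComputablePred.computable_iff.2 ⟨fun a => g (f a), hg.comp hf, rfl⟩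

theorem computablePred_eq {β : Type*} [Primcodable β] {f g : α → β} (hf : Computable f)
    (hg : Computable g) : ComputablePred fun a => f a = g a :=
  computablePred_comp (p := fun x : β × β => x.1 = x.2)
    (PrimrecPred.computablePred (Primrec.eq.comp Primrec.fst Primrec.snd)) (hf.pair hg)

/-- Decidable predicates are closed under bounded universal quantification. -/
theorem computablePred_forall_lt {p : α → ℕ → Prop} {f : α → ℕ}
    (hp : ComputablePred fun x : α × ℕ => p x.1 x.2) (hf : Computable f) :
    ComputablePred fun a => ∀ i < f a, p a i := by
  obtain ⟨g, hg, h⟩ := ComputablePred.computable_iff.1 hp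
  refine ComputablePred.computable_iff.2
    ⟨fun a => Nat.rec (motive := fun _ => Bool) true (fun i b => b && g (a, i)) (f a),
      Computable.nat_rec (h := fun a x => x.2 && g (a, x.1)) hf (Computable.const true) ?_, ?_⟩
  · exact Primrec.and.to_comp.comp (snd.comp snd) (hg.comp (fst.pair (fst.comp snd)))
  · funext a
    have h' : ∀ i, p a i ↔ g (a, i) = true := fun i => by
      have := congrFun h (a, i)
      simpa using this
    beta_reduce
    generalize f a = n
    induction n with
    | zero => simp
    | succ n ih => rw [Nat.forall_lt_succ_right, ih, h' n, Bool.and_eq_true]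

/-- Decidable predicates are closed under bounded existential quantification. -/
theorem computablePred_exists_lt {p : α → ℕ → Prop} {f : α → ℕ}
    (hp : ComputablePred fun x : α × ℕ => p x.1 x.2) (hf : Computable f) :
    ComputablePred fun a => ∃ i < f a, p a i :=
  (computablePred_forall_lt (p := fun a i => ¬ p a i) hp.not hf).not.of_eq fun a => by simp

/-! ### Codes without unbounded search -/

/-- The total value of a code, where unbounded search is replaced by the constant `0`. -/
def evalP : Code → ℕ → ℕ
  | .zero => fun _ => 0
  | .succ => Nat.succ
  | .left => fun n => n.unpair.1
  | .right => fun n => n.unpair.2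
  | .pair cf cg => fun n => Nat.pair (evalP cf n) (evalP cg n)
  | .comp cf cg => fun n => evalP cf (evalP cg n)
  | .prec cf cg => Nat.unpaired fun a n =>
      n.rec (evalP cf a) fun y i => evalP cg (Nat.pair a (Nat.pair y i))
  | .rfind' _ => fun _ => 0

/-- Replace unbounded search by the constant `0` in a code. -/
def primPart (c : Code) : Code :=
  Nat.Partrec.Code.recOn (motive := fun _ => Code) c .zero .succ .left .right
    (fun _ _ f g => .pair f g) (fun _ _ f g => .comp f g)
    (fun _ _ f g => .prec f g) (fun _ _ => .zero)

theorem primPart_primrec : Primrec primPart :=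
  Nat.Partrec.Code.primrec_recOn (α := Code) (σ := Code) Primrec.id (Primrec.const _)
    (Primrec.const _) (Primrec.const _) (Primrec.const _)
    (pr := fun _ _ _ f g => .pair f g) (co := fun _ _ _ f g => .comp f g)
    (pc := fun _ _ _ f g => .prec f g) (rf := fun _ _ _ => .zero)
    (Nat.Partrec.Code.primrec₂_pair.comp
      (Primrec.fst.comp (Primrec.snd.comp (Primrec.snd.comp Primrec.snd)))
      (Primrec.snd.comp (Primrec.snd.comp (Primrec.snd.comp Primrec.snd))))
    (Nat.Partrec.Code.primrec₂_comp.comp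
      (Primrec.fst.comp (Primrec.snd.comp (Primrec.snd.comp Primrec.snd)))
      (Primrec.snd.comp (Primrec.snd.comp (Primrec.snd.comp Primrec.snd))))
    (Nat.Partrec.Code.primrec₂_prec.comp
      (Primrec.fst.comp (Primrec.snd.comp (Primrec.snd.comp Primrec.snd)))
      (Primrec.snd.comp (Primrec.snd.comp (Primrec.snd.comp Primrec.snd))))
    (Primrec.const _)

theorem eval_primPart (c : Code) : ∀ n, (primPart c).eval n = Part.some (evalP c n) := by
  induction c with
  | pair f g hf hg =>
    intro n
    change (Code.pair (primPart f) (primPart g)).eval n = _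
    simp [Code.eval, hf, hg, Seq.seq, evalP]
  | comp f g hf hg =>
    intro n
    change (Code.comp (primPart f) (primPart g)).eval n = _
    simp only [Code.eval, hg]
    exact (Part.bind_some _ _).trans (hf _)
  | prec f g hf hg =>
    intro n
    change (Code.prec (primPart f) (primPart g)).eval n = _
    rw [← Nat.pair_unpair n]
    generalize n.unpair.1 = a
    generalize n.unpair.2 = k
    induction k with
    | zero => simp [hf, evalP]
    | succ k ih => rw [Nat.Partrec.Code.eval_prec_succ, ih]; simp [hg, evalP]
  | rfind' f hf => intro n; rfl
  | _ => intro n; rfl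

/-- The universal function is applied to `primPart c`, which halts everywhere. Totality uniformly in
the code is what makes the refutation relation below decidable and not merely semi-decidable. -/
theorem evalP_computable : Computable₂ evalP := by
  refine Partrec.of_eq_tot
    (Nat.Partrec.Code.eval_part.comp (primPart_primrec.to_comp.comp fst) snd) ?_
  rintro ⟨c, n⟩
  simp [eval_primPart]

/-- Every primitive recursive function has a code. -/
theorem exists_evalP {f : ℕ → ℕ} (hf : Nat.Primrec f) : ∃ c, evalP c = f := by
  induction hf with
  | zero => exact ⟨.zero, rfl⟩
  | succ => exact ⟨.succ, rfl⟩
  | left => exact ⟨.left, rfl⟩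
  | right => exact ⟨.right, rfl⟩
  | pair _ _ hf hg =>
    obtain ⟨c, rfl⟩ := hf; obtain ⟨d, rfl⟩ := hg
    exact ⟨.pair c d, rfl⟩
  | comp _ _ hf hg =>
    obtain ⟨c, rfl⟩ := hf; obtain ⟨d, rfl⟩ := hg
    exact ⟨.comp c d, rfl⟩
  | prec _ _ hf hg =>
    obtain ⟨c, rfl⟩ := hf; obtain ⟨d, rfl⟩ := hg
    exact ⟨.prec c d, rfl⟩

/-! ### A recursively inseparable pair -/

/-- The set of programs that return `v` when they are applied to themselves. -/
def selfValue (v : ℕ) : Set ℕ :=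
  {n | v ∈ (Denumerable.ofNat Code n).eval n}

/-- Diagonalisation: from a decidable separator one gets a program that answers `1` on it and `0`
off it. Applied to its own code, this program lands on the wrong side. -/
theorem recursivelyInseparable_selfValue : RecursivelyInseparable (selfValue 0) (selfValue 1) := by
  refine ⟨Set.disjoint_left.2 fun n h0 h1 => ?_, ?_⟩
  · exact absurd (Part.mem_unique h0 h1) (by norm_num)
  · rintro ⟨D, hD, h0, h1⟩
    obtain ⟨g, hg, h⟩ := ComputablePred.computable_iff.1 hD
    have hg' : Computable fun n => cond (g n) 1 0 :=
      Computable.cond hg (Computable.const 1) (Computable.const 0)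
    obtain ⟨c, hc⟩ := Nat.Partrec.Code.exists_code.1 (Partrec.nat_iff.1 hg'.partrec)
    have hm : ∀ n, n ∈ D ↔ g n = true := fun n => by
      have := congrFun h n
      simpa using this
    have hv : (Denumerable.ofNat Code (Encodable.encode c)).eval (Encodable.encode c)
        = Part.some (cond (g (Encodable.encode c)) 1 0) := by
      simp [hc]
    cases hgc : g (Encodable.encode c) with
    | false =>
      have : Encodable.encode c ∈ selfValue 0 := by
        change 0 ∈ (Denumerable.ofNat Code (Encodable.encode c)).eval (Encodable.encode c)
        rw [hv, hgc]; simp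
      have := (hm _).1 (h0 this)
      simp [hgc] at this
    | true =>
      have : Encodable.encode c ∈ selfValue 1 := by
        change 1 ∈ (Denumerable.ofNat Code (Encodable.encode c)).eval (Encodable.encode c)
        rw [hv, hgc]; simp
      exact Set.disjoint_left.1 h1 ((hm _).2 hgc) this

/-! ### Computable functions that return indices -/

/-- Parametrisation: a partial recursive function of two arguments has a computable function that
returns codes of its sections. -/
theorem exists_index_function {f : α → ℕ →. ℕ} (hf : Partrec₂ f) :
    ∃ x : α → Code, Computable x ∧ ∀ a, (x a).eval = f a := by
  have h : Partrec fun n : ℕ => ((Encodable.decode (α := α) n.unpair.1 : Option α) : Part α).bind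
      fun a => f a n.unpair.2 :=
    Partrec.bind (Computable.ofOption (Computable.decode.comp (fst.comp Computable.unpair)))
      (hf.comp snd (snd.comp (Computable.unpair.comp fst)))
  obtain ⟨c, hc⟩ := Nat.Partrec.Code.exists_code.1 (Partrec.nat_iff.1 h)
  refine ⟨fun a => c.curry (Encodable.encode a),
    Nat.Partrec.Code.primrec₂_curry.to_comp.comp (Computable.const c) Computable.encode, ?_⟩
  intro a
  funext n
  rw [Nat.Partrec.Code.eval_curry, hc]
  simp

/-- Uniformly decidable predicates have a computable function that returns decision indices. -/
theorem exists_decision_index {p : α → ℕ → Prop}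
    (hp : ComputablePred fun x : α × ℕ => p x.1 x.2) :
    ∃ x : α → Code, Computable x ∧ ∀ a, IsDecisionIndex (x a) {m | p a m} := by
  obtain ⟨g, hg, h⟩ := ComputablePred.computable_iff.1 hp
  have hg' : Computable₂ fun (a : α) (n : ℕ) => cond (g (a, n)) 1 0 :=
    Computable.cond hg (Computable.const 1) (Computable.const 0)
  obtain ⟨x, hx, hx'⟩ := exists_index_function hg'.partrec₂
  have hm : ∀ a n, p a n ↔ g (a, n) = true := fun a n => by
    have := congrFun h (a, n)
    simpa using this
  refine ⟨x, hx, fun a m => ?_⟩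
  rw [hx' a]
  constructor
  · intro h
    simp [(hm a m).1 h]
  · intro h
    have : g (a, m) = false := by
      simpa [hm] using h
    simp [this]

/-- Uniformly recursively enumerable sets, given as projections of decidable predicates, have a
computable function that returns RE indices. -/
theorem exists_re_index {p : α → ℕ → ℕ → Prop}
    (hp : ComputablePred fun x : (α × ℕ) × ℕ => p x.1.1 x.1.2 x.2) :
    ∃ x : α → Code, Computable x ∧ ∀ a, IsREIndex (x a) {m | ∃ t, p a m t} := by
  obtain ⟨g, hg, h⟩ := ComputablePred.computable_iff.1 hp
  have hg' : Partrec₂ fun (a : α) (n : ℕ) => Nat.rfind fun t => Part.some (g ((a, n), t)) :=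
    Partrec.rfind (p := fun (a : α × ℕ) t => Part.some (g (a, t))) hg.partrec
  obtain ⟨x, hx, hx'⟩ := exists_index_function hg'
  have hm : ∀ a n t, p a n t ↔ g ((a, n), t) = true := fun a n t => by
    have := congrFun h ((a, n), t)
    simpa using this
  refine ⟨x, hx, fun a m => ?_⟩
  rw [hx' a]
  refine Nat.rfind_dom'.trans ?_
  constructor
  · rintro ⟨t, ht, -⟩
    exact ⟨t, (hm a m t).2 (by simpa using ht)⟩
  · rintro ⟨t, ht⟩
    exact ⟨t, by simp [(hm a m t).1 ht], fun _ => trivial⟩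

end Recursion

/-! ## Finite structures and evaluation of Gödel numbers -/

/-- The list of natural numbers coded by `n`. -/
def unlist (n : ℕ) : List ℕ := Denumerable.ofNat (List ℕ) n

theorem unlist_encode (l : List ℕ) : unlist (Encodable.encode l) = l :=
  Denumerable.ofNat_encode l

theorem encode_unlist (n : ℕ) : Encodable.encode (unlist n) = n :=
  Denumerable.encode_ofNat n

theorem unlist_primrec : Primrec unlist := Primrec.ofNat (List ℕ)

/-- This inequality lets functions on Gödel numbers call themselves at the arguments of a term. It
gives termination, and also the decrease that the course-of-values principle `nat_omega_rec'`
requires. -/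
theorem lt_encode_of_mem {l : List ℕ} {x : ℕ} (h : x ∈ l) : x < Encodable.encode l := by
  induction l with
  | nil => simp at h
  | cons a l ih =>
    rw [Encodable.encode_list_cons]
    rcases List.mem_cons.1 h with rfl | h
    · exact Nat.lt_succ_of_le (Nat.left_le_pair _ _)
    · exact Nat.lt_succ_of_lt ((ih h).trans_le (Nat.right_le_pair _ _))

theorem lt_of_mem_unlist {n x : ℕ} (h : x ∈ unlist n) : x < n := by
  have := lt_encode_of_mem h
  rwa [encode_unlist] at this

theorem unpair_snd_lt {n : ℕ} (h : n.unpair.1 ≠ 0) : n.unpair.2 < n := by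
  have := Nat.add_le_pair n.unpair.1 n.unpair.2
  rw [Nat.pair_unpair] at this
  omega

/-- A finite structure, given by a first element, the list of the other elements, the list of the
true relational atoms (symbol, arguments) and the list of the true functional atoms
(symbol, value followed by the arguments). -/
abbrev FinStr : Type := ℕ × List ℕ × List (ℕ × List ℕ) × List (ℕ × List ℕ)

namespace FinStr

/-- The list of the elements. -/
def dom (D : FinStr) : List ℕ := D.1 :: D.2.1

/-- The value of a function. -/
def fval (D : FinStr) (f : ℕ) (args : List ℕ) : ℕ :=
  (D.dom.filter (fun y => (f, y :: args) ∈ D.2.2.2) ++ [D.1]).headI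

/-- Falling back on `D.1` when no value is recorded keeps functions total, so every `FinStr` is a
structure for every signature. -/
theorem fval_mem (D : FinStr) (f : ℕ) (args : List ℕ) : D.fval f args ∈ D.dom := by
  unfold fval
  cases h : D.dom.filter (fun y => (f, y :: args) ∈ D.2.2.2) with
  | nil => simp [dom]
  | cons a l =>
    have : a ∈ D.dom.filter (fun y => (f, y :: args) ∈ D.2.2.2) := by simp [h]
    exact (List.mem_filter.1 this).1

/-- The value of the term with Gödel number `t` at the assignment `a`. -/
def tval (D : FinStr) (a : List ℕ) (t : ℕ) : ℕ :=
  if _h : t.unpair.1 = 0 then a.getD t.unpair.2 0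
  else D.fval t.unpair.2.unpair.1
    ((unlist t.unpair.2.unpair.2).attach.map fun x => tval D a x.1)
termination_by t
decreasing_by
  exact ((lt_of_mem_unlist x.2).trans_le (Nat.unpair_right_le _)).trans (unpair_snd_lt _h)

theorem tval_eq (D : FinStr) (a : List ℕ) (t : ℕ) :
    D.tval a t = if t.unpair.1 = 0 then a.getD t.unpair.2 0
      else D.fval t.unpair.2.unpair.1 ((unlist t.unpair.2.unpair.2).map (D.tval a)) := by
  rw [tval]
  split_ifs <;> simp

/-- The truth value of the formula with Gödel number `m` at the assignment `a`. -/
def sat (D : FinStr) (m : ℕ) (a : List ℕ) : Bool :=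
  if _h : m.unpair.1 = 0 then false
  else if m.unpair.1 = 1 then
    D.tval a m.unpair.2.unpair.1 == D.tval a m.unpair.2.unpair.2
  else if m.unpair.1 = 2 then
    decide ((m.unpair.2.unpair.1, (unlist m.unpair.2.unpair.2).map (D.tval a)) ∈ D.2.2.1)
  else if m.unpair.1 = 3 then
    !(sat D m.unpair.2.unpair.1 a) || sat D m.unpair.2.unpair.2 a
  else D.dom.all fun x => sat D m.unpair.2 (a ++ [x])
termination_by m
decreasing_by
  · exact (Nat.unpair_left_le _).trans_lt (unpair_snd_lt _h)
  · exact (Nat.unpair_right_le _).trans_lt (unpair_snd_lt _h)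
  · exact unpair_snd_lt _h

/-! ### Primitive recursiveness of the evaluation -/

section
open Primrec

theorem dom_primrec : Primrec dom := list_cons.comp fst (fst.comp snd)

theorem mem_primrecPred {α β : Type*} [Primcodable α] [Primcodable β] {f : α → β} {g : α → List β}
    (hf : Primrec f) (hg : Primrec g) : PrimrecPred fun a => f a ∈ g a :=
  ((PrimrecRel.exists_mem_list (Primrec.eq (α := β))).comp hg hf).of_eq fun a => by simp

theorem fval_primrec : Primrec fun x : FinStr × ℕ × List ℕ => x.1.fval x.2.1 x.2.2 := by
  have h : PrimrecRel fun (y : ℕ) (x : FinStr × ℕ × List ℕ) =>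
      (x.2.1, y :: x.2.2) ∈ x.1.2.2.2 :=
    mem_primrecPred (α := ℕ × (FinStr × ℕ × List ℕ)) (f := fun z => (z.2.2.1, z.1 :: z.2.2.2))
      (g := fun z => z.2.1.2.2.2)
      ((fst.comp (snd.comp snd)).pair (list_cons.comp fst (snd.comp (snd.comp snd))))
      (snd.comp (snd.comp (snd.comp (fst.comp snd))))
  have h3 := h.listFilter.comp (dom_primrec.comp (fst (α := FinStr) (β := ℕ × List ℕ))) Primrec.id
  exact (list_headI.comp (list_append.comp h3
    (list_cons.comp (fst.comp fst) (Primrec.const [])))).of_eq fun x => rfl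

theorem tval_primrec : Primrec fun x : (FinStr × List ℕ) × ℕ => x.1.1.tval x.1.2 x.2 := by
  have ht : PrimrecPred fun x : (FinStr × List ℕ) × ℕ => x.2.unpair.1 = 0 :=
    Primrec.eq.comp (fst.comp (unpair.comp snd)) (Primrec.const 0)
  have hq : Primrec fun x : (FinStr × List ℕ) × ℕ => x.2.unpair.2 := snd.comp (unpair.comp snd)
  have hq1 : Primrec fun x : (FinStr × List ℕ) × ℕ => x.2.unpair.2.unpair.1 :=
    fst.comp (unpair.comp hq)
  have hq2 : Primrec fun x : (FinStr × List ℕ) × ℕ => x.2.unpair.2.unpair.2 :=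
    snd.comp (unpair.comp hq)
  have hl0 : Primrec fun x : (FinStr × List ℕ) × ℕ =>
      (unlist x.2.unpair.2.unpair.2).map fun t => (x.1, t) :=
    list_map (unlist_primrec.comp hq2) (Primrec₂.pair.comp (fst.comp fst) snd)
  -- Course-of-values recursion: `hl` lists the inputs of the recursive calls, and `hg` combines the
  -- list of their results.
  have hl : Primrec fun x : (FinStr × List ℕ) × ℕ => if x.2.unpair.1 = 0 then [] else
      (unlist x.2.unpair.2.unpair.2).map fun t => (x.1, t) := ite ht (const _) hl0
  have hg1 : Primrec fun y : ((FinStr × List ℕ) × ℕ) × List ℕ =>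
      y.1.1.2.getD y.1.2.unpair.2 0 :=
    (list_getD 0).comp (snd.comp (fst.comp fst)) (hq.comp fst)
  have hg2 : Primrec fun y : ((FinStr × List ℕ) × ℕ) × List ℕ =>
      y.1.1.1.fval y.1.2.unpair.2.unpair.1 y.2 :=
    fval_primrec.comp (g := fun y : ((FinStr × List ℕ) × ℕ) × List ℕ =>
      (y.1.1.1, (y.1.2.unpair.2.unpair.1, y.2)))
      ((fst.comp (fst.comp fst)).pair ((hq1.comp fst).pair snd))
  have hg : Primrec₂ fun (x : (FinStr × List ℕ) × ℕ) (v : List ℕ) =>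
      some (if x.2.unpair.1 = 0 then x.1.2.getD x.2.unpair.2 0
        else x.1.1.fval x.2.unpair.2.unpair.1 v) :=
    option_some.comp (ite (ht.comp fst) hg1 hg2)
  refine nat_omega_rec' _ snd hl hg ?_ ?_
  · rintro ⟨⟨D, a⟩, t⟩ b hb
    dsimp only at hb ⊢
    split_ifs at hb with h
    · simp at hb
    · obtain ⟨x, hx, rfl⟩ := List.mem_map.1 hb
      exact ((lt_of_mem_unlist hx).trans_le (Nat.unpair_right_le _)).trans (unpair_snd_lt h)
  · rintro ⟨⟨D, a⟩, t⟩
    dsimp only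
    rw [tval_eq D a t]
    split_ifs <;> simp [Function.comp_def]

theorem list_all_primrec : Primrec fun l : List Bool => l.all id := by
  have : Primrec fun l : List Bool => l.foldr (fun b c => b && c) true :=
    list_foldr (h := fun _ x => x.1 && x.2) Primrec.id (const true)
      (Primrec.and.comp (fst.comp snd) (snd.comp snd))
  refine this.of_eq fun l => ?_
  induction l <;> simp_all

/-- The assignment grows under a quantifier, so the recursion runs over pairs of an assignment and a
code and is measured by the code alone. A quantifier calls itself once for each element of the
domain, which is a finite list. -/
theorem sat_primrec : Primrec fun x : (FinStr × List ℕ) × ℕ => x.1.1.sat x.2 x.1.2 := by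
  have htag : ∀ k, PrimrecPred fun x : (FinStr × List ℕ) × ℕ => x.2.unpair.1 = k := fun k =>
    Primrec.eq.comp (fst.comp (unpair.comp snd)) (Primrec.const k)
  have hq : Primrec fun x : (FinStr × List ℕ) × ℕ => x.2.unpair.2 := snd.comp (unpair.comp snd)
  have hq1 : Primrec fun x : (FinStr × List ℕ) × ℕ => x.2.unpair.2.unpair.1 :=
    fst.comp (unpair.comp hq)
  have hq2 : Primrec fun x : (FinStr × List ℕ) × ℕ => x.2.unpair.2.unpair.2 :=
    snd.comp (unpair.comp hq)
  have hmap : Primrec fun x : (FinStr × List ℕ) × ℕ =>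
      (unlist x.2.unpair.2.unpair.2).map (x.1.1.tval x.1.2) :=
    list_map (unlist_primrec.comp hq2)
      (tval_primrec.comp (g := fun y : ((FinStr × List ℕ) × ℕ) × ℕ => (y.1.1, y.2))
        (Primrec₂.pair.comp (fst.comp fst) snd))
  have hrel : PrimrecPred fun x : (FinStr × List ℕ) × ℕ =>
      (x.2.unpair.2.unpair.1, (unlist x.2.unpair.2.unpair.2).map (x.1.1.tval x.1.2))
        ∈ x.1.1.2.2.1 :=
    mem_primrecPred (hq1.pair hmap) (fst.comp (snd.comp (snd.comp (fst.comp fst))))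
  have heq : Primrec fun x : (FinStr × List ℕ) × ℕ =>
      x.1.1.tval x.1.2 x.2.unpair.2.unpair.1 == x.1.1.tval x.1.2 x.2.unpair.2.unpair.2 :=
    Primrec.beq.comp
      (tval_primrec.comp (g := fun x : (FinStr × List ℕ) × ℕ => (x.1, x.2.unpair.2.unpair.1))
        (fst.pair hq1))
      (tval_primrec.comp (g := fun x : (FinStr × List ℕ) × ℕ => (x.1, x.2.unpair.2.unpair.2))
        (fst.pair hq2))
  have hl1 : Primrec fun x : (FinStr × List ℕ) × ℕ =>
      [(x.1, x.2.unpair.2.unpair.1), (x.1, x.2.unpair.2.unpair.2)] :=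
    list_cons.comp (fst.pair hq1) (list_cons.comp (fst.pair hq2) (const []))
  have hl2 : Primrec fun x : (FinStr × List ℕ) × ℕ =>
      x.1.1.dom.map fun y => ((x.1.1, x.1.2 ++ [y]), x.2.unpair.2) := by
    refine list_map (dom_primrec.comp (fst.comp fst)) ?_
    have : Primrec fun y : ((FinStr × List ℕ) × ℕ) × ℕ =>
        ((y.1.1.1, y.1.1.2 ++ [y.2]), y.1.2.unpair.2) :=
      ((fst.comp (fst.comp fst)).pair (list_append.comp (snd.comp (fst.comp fst))
        (list_cons.comp snd (const [])))).pair (hq.comp fst)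
    exact this
  have hl : Primrec fun x : (FinStr × List ℕ) × ℕ =>
      if x.2.unpair.1 = 0 then [] else if x.2.unpair.1 = 1 then []
      else if x.2.unpair.1 = 2 then []
      else if x.2.unpair.1 = 3 then [(x.1, x.2.unpair.2.unpair.1), (x.1, x.2.unpair.2.unpair.2)]
      else x.1.1.dom.map fun y => ((x.1.1, x.1.2 ++ [y]), x.2.unpair.2) :=
    ite (htag 0) (const _) (ite (htag 1) (const _) (ite (htag 2) (const _)
      (ite (htag 3) hl1 hl2)))
  have himp : Primrec fun y : ((FinStr × List ℕ) × ℕ) × List Bool =>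
      !(y.2.getD 0 false) || y.2.getD 1 false :=
    Primrec.or.comp (Primrec.not.comp ((list_getD false).comp snd (const 0)))
      ((list_getD false).comp snd (const 1))
  have hg : Primrec₂ fun (x : (FinStr × List ℕ) × ℕ) (v : List Bool) =>
      some (if x.2.unpair.1 = 0 then false else if x.2.unpair.1 = 1 then
        x.1.1.tval x.1.2 x.2.unpair.2.unpair.1 == x.1.1.tval x.1.2 x.2.unpair.2.unpair.2
      else if x.2.unpair.1 = 2 then
        decide ((x.2.unpair.2.unpair.1, (unlist x.2.unpair.2.unpair.2).map (x.1.1.tval x.1.2))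
          ∈ x.1.1.2.2.1)
      else if x.2.unpair.1 = 3 then
        !(v.getD 0 false) || v.getD 1 false
      else v.all id) :=
    option_some.comp (ite ((htag 0).comp fst) (const _) (ite ((htag 1).comp fst) (heq.comp fst)
      (ite ((htag 2).comp fst) (hrel.decide.comp fst) (ite ((htag 3).comp fst) himp
        (list_all_primrec.comp snd)))))
  refine nat_omega_rec' _ snd hl hg ?_ ?_
  · rintro ⟨⟨D, a⟩, m⟩ b hb
    dsimp only at hb ⊢
    split_ifs at hb with h0 h1 h2 h3
    · simp at hb
    · simp at hb
    · simp at hb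
    · simp only [List.mem_cons, List.not_mem_nil, or_false] at hb
      rcases hb with rfl | rfl
      · exact (Nat.unpair_left_le _).trans_lt (unpair_snd_lt h0)
      · exact (Nat.unpair_right_le _).trans_lt (unpair_snd_lt h0)
    · obtain ⟨x, hx, rfl⟩ := List.mem_map.1 hb
      exact unpair_snd_lt h0
  · rintro ⟨⟨D, a⟩, m⟩
    dsimp only
    rw [sat.eq_def D m a]
    split_ifs <;> simp [Function.comp_def]

end

/-! ### The evaluation is correct -/

/-- The universe of a finite structure. -/
def Carrier (D : FinStr) : Type := {x : ℕ // x ∈ D.dom}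

instance (D : FinStr) : Nonempty D.Carrier := ⟨⟨D.1, by simp [dom]⟩⟩

/-- The interpretation of the symbols of a signature in a finite structure. -/
instance (D : FinStr) (s : Signature) : s.lang.Structure D.Carrier where
  funMap f v := ⟨D.fval f.1 (List.ofFn fun i => (v i).1), D.fval_mem _ _⟩
  RelMap R v := ((R.1 : ℕ), List.ofFn fun i => (v i).1) ∈ D.2.2.1

theorem tval_termCode {s : Signature} (D : FinStr) {n : ℕ} (xs : Fin n → D.Carrier)
    (t : s.lang.Term (Empty ⊕ Fin n)) :
    D.tval (List.ofFn fun i => (xs i).1) (termCode t)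
      = (t.realize (Sum.elim (default : Empty → D.Carrier) xs)).1 := by
  induction t with
  | var x =>
    rcases x with x | x
    · exact x.elim
    · rw [tval_eq]
      simp [termCode]
  | func f ts ih =>
    rw [tval_eq]
    simp only [termCode, Nat.unpair_pair, one_ne_zero, if_false, unlist_encode, List.map_ofFn]
    change _ = D.fval f.1 _
    congr 2
    funext i
    exact ih i

theorem sat_formulaCode {s : Signature} (D : FinStr) {n : ℕ}
    (φ : s.lang.BoundedFormula Empty n) : ∀ xs : Fin n → D.Carrier,
    D.sat (formulaCode φ) (List.ofFn fun i => (xs i).1) = true ↔ φ.Realize default xs := by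
  induction φ with
  | falsum => intro xs; rw [sat]; simp [formulaCode, BoundedFormula.Realize]
  | equal t u =>
    intro xs
    rw [sat]
    simp only [formulaCode, Nat.unpair_pair, tval_termCode]
    simp only [one_ne_zero, ↓reduceDIte, ↓reduceIte, beq_iff_eq, BoundedFormula.Realize]
    exact Subtype.ext_iff.symm
  | rel R ts =>
    intro xs
    rw [sat]
    simp only [formulaCode, Nat.unpair_pair, unlist_encode, List.map_ofFn]
    simp only [OfNat.ofNat_ne_zero, ↓reduceDIte, OfNat.ofNat_ne_one, ↓reduceIte, decide_eq_true_eq]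
    simp only [Function.comp_def, tval_termCode]
    rfl
  | imp φ ψ h1 h2 =>
    intro xs
    rw [sat]
    simp only [formulaCode, Nat.unpair_pair]
    simp [BoundedFormula.Realize, ← h1, ← h2, imp_iff_not_or]
  | all φ ih =>
    intro xs
    rw [sat]
    simp only [formulaCode, Nat.unpair_pair]
    simp only [OfNat.ofNat_ne_zero, ↓reduceDIte, OfNat.ofNat_ne_one, ↓reduceIte,
      Nat.reduceEqDiff, List.all_eq_true, BoundedFormula.Realize, ← ih]
    -- In de Bruijn levels the variable bound last has the highest index, so `sat` appends its value
    -- at the end, as `Fin.snoc` does.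
    have key : ∀ x : D.Carrier, (List.ofFn fun i => (xs i).1) ++ [x.1]
        = List.ofFn fun i => ((Fin.snoc xs x : Fin _ → D.Carrier) i).1 := fun x => by
      rw [List.ofFn_succ']
      simp
    constructor
    · intro h x
      rw [← key]
      exact h x.1 x.2
    · intro h x hx
      exact (congrArg (fun l => D.sat (formulaCode φ) l) (key ⟨x, hx⟩)).trans (h ⟨x, hx⟩)

theorem sat_sentence {s : Signature} (D : FinStr) (φ : s.lang.Sentence) :
    D.sat (formulaCode φ) [] = true ↔ D.Carrier ⊨ φ := by
  have := D.sat_formulaCode φ default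
  simpa [Sentence.Realize, Formula.Realize] using this

end FinStr

/-! ## Gödel numbers of formulas are decidable -/

/-- `t` is the Gödel number of a term with variables below `n`, where `ar` lists the arities of the
function symbols. -/
def wfTerm (ar : List ℕ) (n t : ℕ) : Bool :=
  if _h : t.unpair.1 = 0 then decide (t.unpair.2 < n)
  else decide (t.unpair.1 = 1) &&
    (decide (ar[t.unpair.2.unpair.1]? = some (unlist t.unpair.2.unpair.2).length) &&
      (unlist t.unpair.2.unpair.2).attach.all fun x => wfTerm ar n x.1)
termination_by t
decreasing_by
  exact ((lt_of_mem_unlist x.2).trans_le (Nat.unpair_right_le _)).trans (unpair_snd_lt _h)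

theorem wfTerm_eq (ar : List ℕ) (n t : ℕ) :
    wfTerm ar n t = if t.unpair.1 = 0 then decide (t.unpair.2 < n)
      else decide (t.unpair.1 = 1) &&
        (decide (ar[t.unpair.2.unpair.1]? = some (unlist t.unpair.2.unpair.2).length) &&
          ((unlist t.unpair.2.unpair.2).map (wfTerm ar n)).all id) := by
  rw [wfTerm]
  split_ifs
  · rfl
  · simp

/-- `m` is the Gödel number of a formula of the signature `s` with variables below `n`. -/
def wfFormula (s : Signature) (n m : ℕ) : Bool :=
  if _h : m.unpair.1 = 0 then decide (m.unpair.2 = 0)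
  else if m.unpair.1 = 1 then
    wfTerm s.1 n m.unpair.2.unpair.1 && wfTerm s.1 n m.unpair.2.unpair.2
  else if m.unpair.1 = 2 then
    decide (s.2[m.unpair.2.unpair.1]? = some (unlist m.unpair.2.unpair.2).length) &&
      ((unlist m.unpair.2.unpair.2).map (wfTerm s.1 n)).all id
  else if m.unpair.1 = 3 then
    wfFormula s n m.unpair.2.unpair.1 && wfFormula s n m.unpair.2.unpair.2
  else decide (m.unpair.1 = 4) && wfFormula s (n + 1) m.unpair.2
termination_by m
decreasing_by
  · exact (Nat.unpair_left_le _).trans_lt (unpair_snd_lt _h)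
  · exact (Nat.unpair_right_le _).trans_lt (unpair_snd_lt _h)
  · exact unpair_snd_lt _h

section
open Primrec

theorem arity_primrecPred {α : Type*} [Primcodable α] {ar l : α → List ℕ} {i : α → ℕ}
    (har : Primrec ar) (hl : Primrec l) (hi : Primrec i) :
    PrimrecPred fun a => (ar a)[i a]? = some (l a).length :=
  Primrec.eq.comp (list_getElem?.comp har hi) (option_some.comp (list_length.comp hl))

theorem wfTerm_primrec : Primrec fun x : (List ℕ × ℕ) × ℕ => wfTerm x.1.1 x.1.2 x.2 := by
  have htag : ∀ k, PrimrecPred fun x : (List ℕ × ℕ) × ℕ => x.2.unpair.1 = k := fun k =>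
    Primrec.eq.comp (fst.comp (unpair.comp snd)) (Primrec.const k)
  have hq : Primrec fun x : (List ℕ × ℕ) × ℕ => x.2.unpair.2 := snd.comp (unpair.comp snd)
  have hq1 : Primrec fun x : (List ℕ × ℕ) × ℕ => x.2.unpair.2.unpair.1 :=
    fst.comp (unpair.comp hq)
  have hq2 : Primrec fun x : (List ℕ × ℕ) × ℕ => unlist x.2.unpair.2.unpair.2 :=
    unlist_primrec.comp (snd.comp (unpair.comp hq))
  have hl0 : Primrec fun x : (List ℕ × ℕ) × ℕ =>
      (unlist x.2.unpair.2.unpair.2).map fun t => (x.1, t) :=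
    list_map hq2 (Primrec₂.pair.comp (fst.comp fst) snd)
  have hl : Primrec fun x : (List ℕ × ℕ) × ℕ => if x.2.unpair.1 = 0 then [] else
      (unlist x.2.unpair.2.unpair.2).map fun t => (x.1, t) := ite (htag 0) (const _) hl0
  have hvar : Primrec fun x : (List ℕ × ℕ) × ℕ => decide (x.2.unpair.2 < x.1.2) :=
    (Primrec.nat_lt.comp hq (snd.comp fst)).decide
  have har : Primrec fun x : (List ℕ × ℕ) × ℕ => decide (x.1.1[x.2.unpair.2.unpair.1]?
      = some (unlist x.2.unpair.2.unpair.2).length) :=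
    (arity_primrecPred (fst.comp fst) hq2 hq1).decide
  have hg : Primrec₂ fun (x : (List ℕ × ℕ) × ℕ) (v : List Bool) =>
      some (if x.2.unpair.1 = 0 then decide (x.2.unpair.2 < x.1.2)
        else decide (x.2.unpair.1 = 1) && (decide (x.1.1[x.2.unpair.2.unpair.1]?
      = some (unlist x.2.unpair.2.unpair.2).length) && v.all id)) :=
    option_some.comp (ite ((htag 0).comp fst) (hvar.comp fst)
      (Primrec.and.comp ((htag 1).decide.comp fst)
        (Primrec.and.comp (har.comp fst) (FinStr.list_all_primrec.comp snd))))
  refine nat_omega_rec' _ snd hl hg ?_ ?_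
  · rintro ⟨⟨D, a⟩, t⟩ b hb
    dsimp only at hb ⊢
    split_ifs at hb with h
    · simp at hb
    · obtain ⟨x, hx, rfl⟩ := List.mem_map.1 hb
      exact ((lt_of_mem_unlist hx).trans_le (Nat.unpair_right_le _)).trans (unpair_snd_lt h)
  · rintro ⟨⟨D, a⟩, t⟩
    dsimp only
    rw [wfTerm_eq D a t]
    split_ifs <;> simp [Function.comp_def]

theorem wfFormula_primrec :
    Primrec fun x : (Signature × ℕ) × ℕ => wfFormula x.1.1 x.1.2 x.2 := by
  have htag : ∀ k, PrimrecPred fun x : (Signature × ℕ) × ℕ => x.2.unpair.1 = k := fun k =>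
    Primrec.eq.comp (fst.comp (unpair.comp snd)) (Primrec.const k)
  have hq : Primrec fun x : (Signature × ℕ) × ℕ => x.2.unpair.2 := snd.comp (unpair.comp snd)
  have hq1 : Primrec fun x : (Signature × ℕ) × ℕ => x.2.unpair.2.unpair.1 :=
    fst.comp (unpair.comp hq)
  have hq2 : Primrec fun x : (Signature × ℕ) × ℕ => x.2.unpair.2.unpair.2 :=
    snd.comp (unpair.comp hq)
  have hq2' : Primrec fun x : (Signature × ℕ) × ℕ => unlist x.2.unpair.2.unpair.2 :=
    unlist_primrec.comp hq2
  have hT : ∀ {f : (Signature × ℕ) × ℕ → ℕ}, Primrec f →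
      Primrec fun x : (Signature × ℕ) × ℕ => wfTerm x.1.1.1 x.1.2 (f x) := fun {f} hf =>
    wfTerm_primrec.comp (g := fun x => ((x.1.1.1, x.1.2), f x))
      (((fst.comp (fst.comp fst)).pair (snd.comp fst)).pair hf)
  have hts : Primrec fun x : (Signature × ℕ) × ℕ =>
      (unlist x.2.unpair.2.unpair.2).map (wfTerm x.1.1.1 x.1.2) := by
    refine list_map hq2' ?_
    exact wfTerm_primrec.comp (g := fun y : ((Signature × ℕ) × ℕ) × ℕ =>
      ((y.1.1.1.1, y.1.1.2), y.2)) (((fst.comp (fst.comp (fst.comp fst))).pair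
        (snd.comp (fst.comp fst))).pair snd)
  have hrel : Primrec fun x : (Signature × ℕ) × ℕ =>
      decide (x.1.1.2[x.2.unpair.2.unpair.1]? = some (unlist x.2.unpair.2.unpair.2).length) &&
      ((unlist x.2.unpair.2.unpair.2).map (wfTerm x.1.1.1 x.1.2)).all id :=
    Primrec.and.comp (arity_primrecPred (snd.comp (fst.comp fst)) hq2' hq1).decide
      (FinStr.list_all_primrec.comp hts)
  have heq : Primrec fun x : (Signature × ℕ) × ℕ =>
      wfTerm x.1.1.1 x.1.2 x.2.unpair.2.unpair.1 && wfTerm x.1.1.1 x.1.2 x.2.unpair.2.unpair.2 :=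
    Primrec.and.comp (hT hq1) (hT hq2)
  have hl1 : Primrec fun x : (Signature × ℕ) × ℕ =>
      [(x.1, x.2.unpair.2.unpair.1), (x.1, x.2.unpair.2.unpair.2)] :=
    list_cons.comp (fst.pair hq1) (list_cons.comp (fst.pair hq2) (const []))
  have hl2 : Primrec fun x : (Signature × ℕ) × ℕ => [((x.1.1, x.1.2 + 1), x.2.unpair.2)] :=
    list_cons.comp (((fst.comp fst).pair (succ.comp (snd.comp fst))).pair hq) (const [])
  have hl : Primrec fun x : (Signature × ℕ) × ℕ =>
      if x.2.unpair.1 = 0 then [] else if x.2.unpair.1 = 1 then []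
      else if x.2.unpair.1 = 2 then []
      else if x.2.unpair.1 = 3 then [(x.1, x.2.unpair.2.unpair.1), (x.1, x.2.unpair.2.unpair.2)]
      else [((x.1.1, x.1.2 + 1), x.2.unpair.2)] :=
    ite (htag 0) (const _) (ite (htag 1) (const _) (ite (htag 2) (const _)
      (ite (htag 3) hl1 hl2)))
  have himp : Primrec fun y : ((Signature × ℕ) × ℕ) × List Bool =>
      y.2.getD 0 false && y.2.getD 1 false :=
    Primrec.and.comp ((list_getD false).comp snd (const 0))
      ((list_getD false).comp snd (const 1))
  have hg : Primrec₂ fun (x : (Signature × ℕ) × ℕ) (v : List Bool) =>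
      some (if x.2.unpair.1 = 0 then decide (x.2.unpair.2 = 0) else if x.2.unpair.1 = 1 then
        wfTerm x.1.1.1 x.1.2 x.2.unpair.2.unpair.1 && wfTerm x.1.1.1 x.1.2 x.2.unpair.2.unpair.2
      else if x.2.unpair.1 = 2 then
        decide (x.1.1.2[x.2.unpair.2.unpair.1]? = some (unlist x.2.unpair.2.unpair.2).length) &&
        ((unlist x.2.unpair.2.unpair.2).map (wfTerm x.1.1.1 x.1.2)).all id
      else if x.2.unpair.1 = 3 then v.getD 0 false && v.getD 1 false
      else decide (x.2.unpair.1 = 4) && v.getD 0 false) :=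
    option_some.comp (ite ((htag 0).comp fst) ((Primrec.eq.comp hq (const 0)).decide.comp fst)
      (ite ((htag 1).comp fst) (heq.comp fst)
      (ite ((htag 2).comp fst) (hrel.comp fst) (ite ((htag 3).comp fst) himp
        (Primrec.and.comp ((htag 4).decide.comp fst)
          ((list_getD false).comp snd (const 0)))))))
  refine nat_omega_rec' _ snd hl hg ?_ ?_
  · rintro ⟨⟨D, a⟩, m⟩ b hb
    dsimp only at hb ⊢
    split_ifs at hb with h0 h1 h2 h3
    · simp at hb
    · simp at hb
    · simp at hb
    · simp only [List.mem_cons, List.not_mem_nil, or_false] at hb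
      rcases hb with rfl | rfl
      · exact (Nat.unpair_left_le _).trans_lt (unpair_snd_lt h0)
      · exact (Nat.unpair_right_le _).trans_lt (unpair_snd_lt h0)
    · simp only [List.mem_cons, List.not_mem_nil, or_false] at hb
      subst hb
      exact unpair_snd_lt h0
  · rintro ⟨⟨D, a⟩, m⟩
    dsimp only
    rw [wfFormula.eq_def D a m]
    split_ifs <;> simp

end

theorem exists_termCode_list {s : Signature} {n : ℕ} {l : List ℕ}
    (h : ∀ t ∈ l, ∃ u : s.lang.Term (Empty ⊕ Fin n), termCode u = t) :
    ∃ us : Fin l.length → s.lang.Term (Empty ⊕ Fin n),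
      List.ofFn (fun i => termCode (us i)) = l := by
  choose us hus using fun i : Fin l.length => h (l.get i) (List.get_mem _ _)
  exact ⟨us, by simp only [hus, List.ofFn_get]⟩

theorem wfTerm_iff {s : Signature} {n t : ℕ} :
    wfTerm s.1 n t = true ↔ ∃ u : s.lang.Term (Empty ⊕ Fin n), termCode u = t := by
  constructor
  · induction t using Nat.strong_induction_on with
    | _ t ih =>
      intro h
      rw [wfTerm_eq] at h
      have ht := Nat.pair_unpair t
      split_ifs at h with h0
      · refine ⟨.var (.inr ⟨t.unpair.2, by simpa using h⟩), ?_⟩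
        simp only [termCode]
        rw [← h0, ht]
      · simp only [Bool.and_eq_true, decide_eq_true_eq, List.all_eq_true, List.mem_map, id,
          forall_exists_index, and_imp, forall_apply_eq_imp_iff₂] at h
        obtain ⟨h1, h2, h3⟩ := h
        obtain ⟨us, hus⟩ := exists_termCode_list (s := s) (n := n) fun x hx =>
          ih x (((lt_of_mem_unlist hx).trans_le (Nat.unpair_right_le _)).trans (unpair_snd_lt h0))
            (h3 x hx)
        obtain ⟨hi, hi'⟩ := List.getElem?_eq_some_iff.1 h2
        refine ⟨.func (l := (unlist t.unpair.2.unpair.2).length)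
          ⟨⟨t.unpair.2.unpair.1, hi⟩, hi'⟩ us, ?_⟩
        simp only [termCode]
        rw [hus, encode_unlist, Nat.pair_unpair, ← h1, ht]
  · rintro ⟨u, rfl⟩
    induction u with
    | var x =>
      rcases x with x | x
      · exact x.elim
      · rw [wfTerm_eq]; simp [termCode]
    | @func l f ts ih =>
      rw [wfTerm_eq]
      obtain ⟨i, rfl⟩ := f
      simp only [termCode, Nat.unpair_pair, one_ne_zero, if_false, unlist_encode]
      simp [ih, Function.comp_def]

/-- Refutations may use a disagreement between levels only on the code of a genuine sentence: for
other numbers there is no rank bound, and a disagreement would mean nothing. -/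
theorem wfFormula_iff {s : Signature} {n m : ℕ} :
    wfFormula s n m = true ↔ ∃ φ : s.lang.BoundedFormula Empty n, formulaCode φ = m := by
  constructor
  · induction m using Nat.strong_induction_on generalizing n with
    | _ m ih =>
      intro h
      rw [wfFormula] at h
      have hm := Nat.pair_unpair m
      have hm2 := Nat.pair_unpair m.unpair.2
      split_ifs at h with h0 h1 h2 h3
      · simp only [decide_eq_true_eq] at h
        refine ⟨.falsum, ?_⟩
        simp only [formulaCode]
        rw [← hm, h0, h]
      · simp only [Bool.and_eq_true, wfTerm_iff] at h
        obtain ⟨⟨t, ht⟩, u, hu⟩ := h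
        refine ⟨.equal t u, ?_⟩
        simp only [formulaCode]
        rw [ht, hu, hm2, ← h1, hm]
      · simp only [Bool.and_eq_true, decide_eq_true_eq, List.all_eq_true, List.mem_map, id,
          forall_exists_index, and_imp, forall_apply_eq_imp_iff₂, wfTerm_iff] at h
        obtain ⟨us, hus⟩ := exists_termCode_list h.2
        obtain ⟨hi, hi'⟩ := List.getElem?_eq_some_iff.1 h.1
        refine ⟨.rel (l := (unlist m.unpair.2.unpair.2).length)
          ⟨⟨m.unpair.2.unpair.1, hi⟩, hi'⟩ us, ?_⟩
        simp only [formulaCode]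
        rw [hus, encode_unlist, hm2, ← h2, hm]
      · simp only [Bool.and_eq_true] at h
        obtain ⟨φ, hφ⟩ := ih _ ((Nat.unpair_left_le _).trans_lt (unpair_snd_lt h0)) h.1
        obtain ⟨ψ, hψ⟩ := ih _ ((Nat.unpair_right_le _).trans_lt (unpair_snd_lt h0)) h.2
        refine ⟨.imp φ ψ, ?_⟩
        simp only [formulaCode]
        rw [hφ, hψ, hm2, ← h3, hm]
      · simp only [Bool.and_eq_true, decide_eq_true_eq] at h
        obtain ⟨φ, hφ⟩ := ih _ (unpair_snd_lt h0) h.2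
        refine ⟨.all φ, ?_⟩
        simp only [formulaCode]
        rw [hφ, ← h.1, hm]
  · rintro ⟨φ, rfl⟩
    have hT : ∀ {k : ℕ} (t : s.lang.Term (Empty ⊕ Fin k)), wfTerm s.1 k (termCode t) = true :=
      fun t => wfTerm_iff.2 ⟨t, rfl⟩
    induction φ with
    | falsum => rw [wfFormula]; simp [formulaCode]
    | equal t u => rw [wfFormula]; simp [formulaCode, hT]
    | rel R ts =>
      rw [wfFormula]
      obtain ⟨i, rfl⟩ := R
      simp [formulaCode, unlist_encode, hT]
    | imp φ ψ h1 h2 => rw [wfFormula]; simp [formulaCode, h1, h2]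
    | all φ ih => rw [wfFormula]; simp [formulaCode, ih]

/-! ## Refuting interpretations -/

/-- The finite structures that the code `c` presents at the pattern `P` and the level `R`. -/
def presented (c : Code) (P : List ℕ) (R : ℕ) : List FinStr :=
  ((Encodable.decode (evalP c (Encodable.encode (P, R))) : Option (List FinStr))).getD []

/-- The formula with Gödel number `m` holds in all structures presented at the level `R`. -/
def HoldsAt (c : Code) (P : List ℕ) (R m : ℕ) : Prop :=
  ∀ D ∈ presented c P R, D.sat m [] = true

/-- The presentation `q.1`, with rank bound `q.2`, does not present models of the theory
of index `e`: some level is empty, two levels disagree on a sentence whose rank they exceed, or an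
axiom fails. -/
def IsRefutation (s : Signature) (e : Code) (q : Code × ℕ) (P : List ℕ) (t m R R' : ℕ) : Prop :=
  (q.2 ≤ R ∧ presented q.1 P R = []) ∨
  (wfFormula s 0 m = true ∧ (q.2 * (m + 1) ≤ R ∧ q.2 * (m + 1) ≤ R') ∧
    HoldsAt q.1 P R m ∧ ¬ HoldsAt q.1 P R' m) ∨
  ((Code.evaln t e m).isSome = true ∧ q.2 * (m + 1) ≤ R ∧ ¬ HoldsAt q.1 P R m)

section Computability
open Computable

theorem presented_computable :
    Computable fun x : (Code × List ℕ) × ℕ => presented x.1.1 x.1.2 x.2 :=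
  Computable.option_getD (Computable.decode.comp (evalP_computable.comp (fst.comp fst)
    (Computable.encode.comp ((snd.comp fst).pair snd)))) (Computable.const [])

theorem holdsAt_computablePred {α : Type*} [Primcodable α] {c : α → Code} {P : α → List ℕ}
    {R m : α → ℕ} (hc : Computable c) (hP : Computable P) (hR : Computable R)
    (hm : Computable m) : ComputablePred fun a => HoldsAt (c a) (P a) (R a) (m a) := by
  have h1 : PrimrecRel fun (D : FinStr) (m : ℕ) => D.sat m [] = true :=
    Primrec.eq.comp (FinStr.sat_primrec.comp (g := fun x : FinStr × ℕ => ((x.1, []), x.2))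
      ((Primrec.fst.pair (Primrec.const [])).pair Primrec.snd)) (Primrec.const true)
  have h2 : ComputablePred fun x : List FinStr × ℕ => ∀ D ∈ x.1, D.sat x.2 [] = true :=
    PrimrecPred.computablePred h1.forall_mem_list
  exact computablePred_comp h2
    ((presented_computable.comp (g := fun a => ((c a, P a), R a)) ((hc.pair hP).pair hR)).pair hm)

theorem le_computablePred {α : Type*} [Primcodable α] {f g : α → ℕ} (hf : Computable f)
    (hg : Computable g) : ComputablePred fun a => f a ≤ g a :=
  computablePred_comp (p := fun x : ℕ × ℕ => x.1 ≤ x.2)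
    (PrimrecPred.computablePred (Primrec.nat_le.comp Primrec.fst Primrec.snd)) (hf.pair hg)

theorem isRefutation_computablePred {α : Type*} [Primcodable α] {s : α → Signature}
    {e : α → Code} {q : α → Code × ℕ} {P : α → List ℕ} {t m R R' : α → ℕ} (hs : Computable s)
    (he : Computable e) (hq : Computable q) (hP : Computable P) (ht : Computable t)
    (hm : Computable m) (hR : Computable R) (hR' : Computable R') :
    ComputablePred fun a => IsRefutation (s a) (e a) (q a) (P a) (t a) (m a) (R a) (R' a) := by
  have hb : Computable fun a => (q a).2 * (m a + 1) :=
    Primrec.nat_mul.to_comp.comp (snd.comp hq) (succ.comp hm)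
  have hp : Computable fun a => presented (q a).1 (P a) (R a) :=
    presented_computable.comp (g := fun a => (((q a).1, P a), R a))
      (((fst.comp hq).pair hP).pair hR)
  have hw : ComputablePred fun a => wfFormula (s a) 0 (m a) = true :=
    computablePred_eq (wfFormula_primrec.to_comp.comp (g := fun a => ((s a, 0), m a))
      ((hs.pair (Computable.const 0)).pair hm)) (Computable.const true)
  have hev : ComputablePred fun a => (Code.evaln (t a) (e a) (m a)).isSome = true :=
    computablePred_eq (Primrec.option_isSome.to_comp.comp
      (Nat.Partrec.Code.primrec_evaln.to_comp.comp (g := fun a => ((t a, e a), m a))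
        ((ht.pair he).pair hm))) (Computable.const true)
  have hh := holdsAt_computablePred (fst.comp hq) hP hR hm
  have hh' := holdsAt_computablePred (fst.comp hq) hP hR' hm
  exact computablePred_or (computablePred_and (le_computablePred (snd.comp hq) hR)
    (computablePred_eq hp (Computable.const [])))
    (computablePred_or (computablePred_and hw (computablePred_and
      (computablePred_and (le_computablePred hb hR) (le_computablePred hb hR'))
        (computablePred_and hh hh'.not)))
      (computablePred_and hev (computablePred_and (le_computablePred hb hR) hh.not)))

end Computability

theorem holdsAt_formulaCode {s : Signature} {c : Code} {P : List ℕ} {R : ℕ}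
    {φ : s.lang.Sentence} :
    HoldsAt c P R (formulaCode φ) ↔ ∀ D ∈ presented c P R, D.Carrier ⊨ φ := by
  simp only [HoldsAt, FinStr.sat_sentence]

/-- No presentation withstands refutation by an essentially undecidable theory: otherwise, the
sentences that hold at all sufficiently high levels form a consistent decidable extension. -/
theorem exists_isRefutation {s : Signature} {U : s.lang.Theory} {e : Code}
    (he : IsTheoryIndex e U) (hU : EssentiallyUndecidable U) (q : Code × ℕ) (P : List ℕ) :
    ∃ t m R R', IsRefutation s e q P t m R R' := by
  by_contra hcon
  push Not at hcon
  have h1 : ∀ R, q.2 ≤ R → presented q.1 P R ≠ [] := fun R hR h =>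
    hcon 0 0 R 0 (Or.inl ⟨hR, h⟩)
  have h2 : ∀ (φ : s.lang.Sentence) (R R' : ℕ), q.2 * (formulaCode φ + 1) ≤ R →
      q.2 * (formulaCode φ + 1) ≤ R' → HoldsAt q.1 P R (formulaCode φ) →
      HoldsAt q.1 P R' (formulaCode φ) := fun φ R R' hR hR' h => by
    by_contra h'
    exact hcon 0 _ R R' (Or.inr (Or.inl ⟨wfFormula_iff.2 ⟨φ, rfl⟩, ⟨hR, hR'⟩, h, h'⟩))
  have h3 : ∀ φ ∈ U, HoldsAt q.1 P (q.2 * (formulaCode φ + 1)) (formulaCode φ) := fun φ hφ => by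
    by_contra h'
    obtain ⟨v, hv⟩ := Part.dom_iff_mem.1 ((he (formulaCode φ)).2 ⟨φ, hφ, rfl⟩)
    obtain ⟨t, ht⟩ := Nat.Partrec.Code.evaln_complete.1 hv
    exact hcon t _ _ 0 (Or.inr (Or.inr ⟨by rw [Option.mem_def.1 ht]; rfl, le_rfl, h'⟩))
  -- Each sentence is tested at its own threshold level. By `h2` the outcome is the same at every
  -- higher level.
  let V : s.lang.Theory := {φ | HoldsAt q.1 P (q.2 * (formulaCode φ + 1)) (formulaCode φ)}
  have hfin : ∀ T₀ : Finset s.lang.Sentence, (T₀ : s.lang.Theory) ⊆ V → ∃ R₀, ∀ R, R₀ ≤ R →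
      presented q.1 P R ≠ [] ∧
        ∀ D ∈ presented q.1 P R, D.Carrier ⊨ (T₀ : s.lang.Theory) := by
    intro T₀ hT₀
    -- This level exceeds the thresholds of all sentences of `T₀`, and also `q.2`, so that the list
    -- of structures there is not empty.
    refine ⟨q.2 + ∑ φ ∈ T₀, q.2 * (formulaCode φ + 1), fun R hR => ⟨h1 R (by omega), ?_⟩⟩
    intro D hD
    refine (Theory.model_iff _).2 fun φ hφ => ?_
    have hle : q.2 * (formulaCode φ + 1) ≤ ∑ φ ∈ T₀, q.2 * (formulaCode φ + 1) :=
      Finset.single_le_sum (f := fun φ : s.lang.Sentence => q.2 * (formulaCode φ + 1))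
        (fun _ _ => Nat.zero_le _) hφ
    exact holdsAt_formulaCode.1 (h2 φ _ R le_rfl (by omega) (hT₀ hφ)) D hD
  have hsat : V.IsSatisfiable := by
    refine Theory.isSatisfiable_iff_isFinitelySatisfiable.2 fun T₀ hT₀ => ?_
    obtain ⟨R, hR⟩ := hfin T₀ hT₀
    obtain ⟨hne, hD⟩ := hR R le_rfl
    obtain ⟨D, hmem⟩ := List.exists_mem_of_ne_nil _ hne
    have := hD D hmem
    exact Theory.Model.isSatisfiable D.Carrier
  have hcl : ∀ φ : s.lang.Sentence, V ⊨ᵇ φ ↔ φ ∈ V := by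
    refine fun φ => ⟨fun h => ?_, Theory.models_sentence_of_mem⟩
    obtain ⟨T₀, hT₀, h⟩ := Theory.models_iff_finset_models.1 h
    obtain ⟨R, hR⟩ := hfin T₀ hT₀
    -- A consequence of finitely many members of `V` holds at a level above all their thresholds and
    -- its own. Stability brings it down to its own threshold.
    refine h2 φ (R + q.2 * (formulaCode φ + 1)) _ (by omega) le_rfl
      (holdsAt_formulaCode.2 fun D hD => ?_)
    have := (hR (R + q.2 * (formulaCode φ + 1)) (by omega)).2 D hD
    exact h.realize_sentence D.Carrier
  refine hU V (fun φ h => Theory.models_of_models_theory (α := Empty)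
    (fun ψ hψ => (hcl ψ).2 (h3 ψ hψ)) h) hsat ?_
  -- Deductive closure makes theoremhood in `V` a single test at one computable level.
  have hdec : ComputablePred fun m : ℕ =>
      wfFormula s 0 m = true ∧ HoldsAt q.1 P (q.2 * (m + 1)) m :=
    computablePred_and
      (computablePred_eq (wfFormula_primrec.to_comp.comp (g := fun m => ((s, 0), m))
        ((Computable.const (s, 0)).pair Computable.id)) (Computable.const true))
      (holdsAt_computablePred (Computable.const _) (Computable.const _)
        (Primrec.nat_mul.to_comp.comp (Computable.const _) Computable.succ) Computable.id)
  refine hdec.of_eq fun m => ?_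
  simp only [hcl]
  constructor
  · rintro ⟨hw, h⟩
    obtain ⟨φ, rfl⟩ := wfFormula_iff.1 hw
    exact ⟨φ, h, rfl⟩
  · rintro ⟨φ, h, rfl⟩
    exact ⟨wfFormula_iff.2 ⟨φ, rfl⟩, h⟩

/-! ## The sparse set -/

/-- Lists of the elements of all sets of numbers below `k`. -/
def subsetLists : ℕ → List (List ℕ)
  | 0 => [ [] ]
  | k + 1 => subsetLists k ++ (subsetLists k).map (k :: ·)

theorem subsetLists_primrec : Primrec subsetLists := by
  have h : Primrec fun n : ℕ => (Nat.rec [ [] ] (fun k l => l ++ l.map (k :: ·)) n : List (List ℕ)) :=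
    Primrec.nat_rec₁ _ (Primrec.list_append.comp Primrec.snd
      (Primrec.list_map Primrec.snd
        (Primrec.list_cons.comp (Primrec.fst.comp Primrec.fst) Primrec.snd)))
  refine h.of_eq fun n => ?_
  induction n with
  | zero => rfl
  | succ n ih => simp only [subsetLists, ← ih]

theorem exists_mem_subsetLists (A : Set ℕ) (k : ℕ) :
    ∃ P ∈ subsetLists k, ∀ i, i ∈ P ↔ i < k ∧ i ∈ A := by
  induction k with
  | zero => exact ⟨[], by simp [subsetLists], by simp⟩
  | succ k ih =>
    obtain ⟨P, hP, h⟩ := ih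
    by_cases hk : k ∈ A
    · refine ⟨k :: P, by simp [subsetLists, hP], fun i => ?_⟩
      rw [List.mem_cons, h]
      grind
    · refine ⟨P, by simp [subsetLists, hP], fun i => ?_⟩
      rw [h]
      grind

/-- For every pattern up to `k`, a refutation of the `n`-th presentation is found below `N`. -/
def AllRefuted (a : Signature × Code) (n k N : ℕ) : Prop :=
  ∀ i < (subsetLists (k + 1)).length, ∃ w < N,
    IsRefutation a.1 a.2 (Denumerable.ofNat (Code × ℕ) n) ((subsetLists (k + 1)).getD i [])
      w.unpair.1.unpair.1 w.unpair.1.unpair.2 w.unpair.2.unpair.1 w.unpair.2.unpair.2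

theorem AllRefuted.mono {a : Signature × Code} {n k N N' : ℕ} (h : AllRefuted a n k N)
    (hN : N ≤ N') : AllRefuted a n k N' := fun i hi =>
  let ⟨w, hw, h⟩ := h i hi
  ⟨w, hw.trans_le hN, h⟩

section Computability
open Computable

theorem allRefuted_computablePred {α : Type*} [Primcodable α] {a : α → Signature × Code}
    {n k N : α → ℕ} (ha : Computable a) (hn : Computable n) (hk : Computable k)
    (hN : Computable N) : ComputablePred fun x => AllRefuted (a x) (n x) (k x) (N x) := by
  have hl : Computable fun x => subsetLists (k x + 1) :=
    subsetLists_primrec.to_comp.comp (succ.comp hk)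
  refine computablePred_forall_lt ?_ (list_length.comp hl)
  refine computablePred_exists_lt (α := α × ℕ) (f := fun x => N x.1)
    (p := fun x w => IsRefutation (a x.1).1 (a x.1).2 (Denumerable.ofNat (Code × ℕ) (n x.1))
      ((subsetLists (k x.1 + 1)).getD x.2 [])
      w.unpair.1.unpair.1 w.unpair.1.unpair.2 w.unpair.2.unpair.1 w.unpair.2.unpair.2)
    ?_ (hN.comp fst)
  have hw1 : Computable fun x : (α × ℕ) × ℕ => x.2.unpair.1 := fst.comp (unpair.comp snd)
  have hw2 : Computable fun x : (α × ℕ) × ℕ => x.2.unpair.2 := snd.comp (unpair.comp snd)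
  exact isRefutation_computablePred (fst.comp (ha.comp (fst.comp fst)))
    (snd.comp (ha.comp (fst.comp fst)))
    ((Computable.ofNat (Code × ℕ)).comp (hn.comp (fst.comp fst)))
    ((Primrec.list_getD []).to_comp.comp (hl.comp (fst.comp fst)) (snd.comp fst))
    (fst.comp (unpair.comp hw1)) (snd.comp (unpair.comp hw1))
    (fst.comp (unpair.comp hw2)) (snd.comp (unpair.comp hw2))

end Computability

open Classical in
/-- The stage reached at `m`: the number of presentations refuted so far, and the last element of
the sparse set. -/
noncomputable def stage (a : Signature × Code) : ℕ → ℕ × ℕ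
  | 0 => (0, 0)
  | m + 1 => if AllRefuted a (stage a m).1 (stage a m).2 (m + 1) then ((stage a m).1 + 1, m + 1)
      else stage a m

/-- The sparse set. -/
def sparse (a : Signature × Code) : Set ℕ := {m | (stage a m).2 = m}

theorem stage_computable : Computable fun x : (Signature × Code) × ℕ => stage x.1 x.2 := by
  classical
  open Computable in
  let p : ((Signature × Code) × ℕ) × ℕ × (ℕ × ℕ) → Prop := fun y =>
    AllRefuted y.1.1 y.2.2.1 y.2.2.2 (y.2.1 + 1)
  have hp : ComputablePred p := allRefuted_computablePred (fst.comp fst)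
    (fst.comp (snd.comp snd)) (snd.comp (snd.comp snd)) (succ.comp (fst.comp snd))
  have h := Computable.nat_rec (f := fun x : (Signature × Code) × ℕ => x.2)
    (g := fun _ => ((0, 0) : ℕ × ℕ))
    (h := fun x y => cond (decide (p (x, y))) (y.2.1 + 1, y.1 + 1) y.2)
    snd (Computable.const _)
    (Computable.cond hp.decide
      ((succ.comp (fst.comp (snd.comp snd))).pair (succ.comp (fst.comp snd)))
      (snd.comp snd))
  refine h.of_eq fun x => ?_
  obtain ⟨a, m⟩ := x
  induction m with
  | zero => rfl
  | succ m ih =>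
    simp only [stage] at ih ⊢
    rw [ih]
    simp only [p, Bool.cond_decide]

theorem stage_eq_of_not_allRefuted {a : Signature × Code} {n k m : ℕ} (h : stage a k = (n, k))
    (hkm : k ≤ m) (hm : ∀ N, k < N → N ≤ m → ¬ AllRefuted a n k N) : stage a m = (n, k) := by
  induction m, hkm using Nat.le_induction with
  | base => exact h
  | succ m hkm ih =>
    rw [stage, ih fun N h1 h2 => hm N h1 (h2.trans (Nat.le_succ m)),
      if_neg (hm (m + 1) (by omega) le_rfl)]

/-- Between two consecutive elements of the sparse set, the next presentation is refuted. -/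
theorem exists_next {a : Signature × Code} {n k : ℕ} (h : stage a k = (n, k))
    (hex : ∃ N, AllRefuted a n k N) :
    ∃ N, k < N ∧ AllRefuted a n k N ∧ stage a N = (n + 1, N) ∧
      ∀ m, k < m → m < N → m ∉ sparse a := by
  classical
  have hex' : ∃ N, k < N ∧ AllRefuted a n k N := by
    obtain ⟨N, hN⟩ := hex
    -- `AllRefuted` is monotone in the bound, so the bound may be taken beyond `k`.
    exact ⟨N + k + 1, by omega, hN.mono (by omega)⟩
  obtain ⟨hk, hN⟩ := Nat.find_spec hex'
  have hst : ∀ m, k ≤ m → m < Nat.find hex' → stage a m = (n, k) := fun m h1 h2 =>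
    stage_eq_of_not_allRefuted h h1 fun N h3 h4 h5 =>
      Nat.find_min hex' (h4.trans_lt h2) ⟨h3, h5⟩
  refine ⟨Nat.find hex', hk, hN, ?_, fun m h1 h2 h3 => ?_⟩
  · obtain ⟨j, hj⟩ : ∃ j, Nat.find hex' = j + 1 := ⟨Nat.find hex' - 1, by omega⟩
    have := hst j (by omega) (by omega)
    rw [hj, stage, this, if_pos (by rw [← hj]; exact hN)]
  · rw [sparse, Set.mem_ofPred_eq, hst m h1.le h2] at h3
    exact h1.ne h3

/-- There are finitely many patterns and each has a refutation, so a common bound exists. Essential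
undecidability enters the construction of the sparse set only here. -/
theorem exists_allRefuted {s : Signature} {U : s.lang.Theory} {e : Code}
    (he : IsTheoryIndex e U) (hU : EssentiallyUndecidable U) (n k : ℕ) :
    ∃ N, AllRefuted (s, e) n k N := by
  have h : ∀ i : ℕ, ∃ w, IsRefutation s e (Denumerable.ofNat (Code × ℕ) n)
      ((subsetLists (k + 1)).getD i []) (Nat.unpair (Nat.unpair w).1).1
      (Nat.unpair (Nat.unpair w).1).2 (Nat.unpair (Nat.unpair w).2).1
      (Nat.unpair (Nat.unpair w).2).2 := fun i => by
    obtain ⟨t, m, R, R', h⟩ := exists_isRefutation he hU (Denumerable.ofNat (Code × ℕ) n)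
      ((subsetLists (k + 1)).getD i [])
    exact ⟨Nat.pair (Nat.pair t m) (Nat.pair R R'), by simpa using h⟩
  choose w hw using h
  -- The sum of the successors of the witnesses is strictly larger than each of them.
  refine ⟨∑ i ∈ Finset.range (subsetLists (k + 1)).length, (w i + 1), fun i hi => ⟨w i, ?_, hw i⟩⟩
  exact Finset.single_le_sum (f := fun i => w i + 1) (fun _ _ => Nat.zero_le _)
    (Finset.mem_range.2 hi)

theorem exists_stage {s : Signature} {U : s.lang.Theory} {e : Code}
    (he : IsTheoryIndex e U) (hU : EssentiallyUndecidable U) (n : ℕ) :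
    ∃ k, stage (s, e) k = (n, k) := by
  induction n with
  | zero => exact ⟨0, rfl⟩
  | succ n ih =>
    obtain ⟨k, hk⟩ := ih
    obtain ⟨N, -, -, h, -⟩ := exists_next hk (exists_allRefuted he hU n k)
    exact ⟨N, h⟩

/-- Every presentation is refuted, for every subset `A` of the sparse set, at a finite pattern that
agrees with `A` below the levels involved. -/
theorem exists_isRefutation_of_subset_sparse {s : Signature} {U : s.lang.Theory} {e : Code}
    (he : IsTheoryIndex e U) (hU : EssentiallyUndecidable U) {A : Set ℕ}
    (hA : A ⊆ sparse (s, e)) (q : Code × ℕ) :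
    ∃ (P : List ℕ) (t m R R' : ℕ), IsRefutation s e q P t m R R' ∧
      ∀ i, i < R ∨ i < R' → (i ∈ P ↔ i ∈ A) := by
  -- The presentation `q` is the one treated at the stage whose number is the code of `q`.
  obtain ⟨k, hk⟩ := exists_stage he hU (Encodable.encode q)
  obtain ⟨N, -, hN, -, hs⟩ := exists_next hk (exists_allRefuted he hU _ k)
  obtain ⟨P, hP, hPA⟩ := exists_mem_subsetLists A (k + 1)
  obtain ⟨i, hi, hiP⟩ := List.getElem_of_mem hP
  obtain ⟨w, hw, h⟩ := hN i hi
  rw [Denumerable.ofNat_encode, List.getD_eq_getElem _ _ hi, hiP] at h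
  refine ⟨P, _, _, _, _, h, fun j hj => ?_⟩
  -- The levels are components of the witness `w`, hence at most `w` and below `N`.
  have h2 := Nat.unpair_right_le w
  have h3 := Nat.unpair_left_le w.unpair.2
  have h4 := Nat.unpair_right_le w.unpair.2
  rw [hPA]
  refine ⟨And.right, fun hjA => ⟨?_, hjA⟩⟩
  -- An element of `A` beyond `k` and below `N` would lie in a gap of the sparse set.
  by_contra hjk
  exact hs j (by omega) (by omega) (hA hjA)

/-! ## Equivalence structures on sets of natural numbers -/

/-- The set `S`, with equivalence of numbers that code pairs with the same first component. -/
def EqStr (S : Set ℕ) : Type := {u : ℕ // u ∈ S}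

/-- The equivalence class of an element. -/
def EqStr.cls {S : Set ℕ} (u : EqStr S) : ℕ := (Nat.unpair u.1).1

/-- Requiring all pairs of arguments to be equivalent makes sense for a symbol of any arity. This
avoids transporting the argument tuple along a proof that the arity is `2`. -/
instance (S : Set ℕ) : sigE.lang.Structure (EqStr S) where
  funMap f _ := Fin.elim0 f.1
  RelMap _ v := ∀ i j, (v i).cls = (v j).cls

/-- The number of elements of a class. -/
noncomputable def classSize (S : Set ℕ) (c : ℕ) : ℕ∞ := {u ∈ S | (Nat.unpair u).1 = c}.encard

/-- Classes of the same nonzero size `s ≤ R` coincide, and there are at least `R` larger classes. -/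
structure Rich (R : ℕ) (S : Set ℕ) : Prop where
  unique : ∀ s : ℕ, s ≤ R → s ≠ 0 → ∀ c c', classSize S c = s → classSize S c' = s → c = c'
  many : ∀ F : Finset ℕ, F.card < R → ∃ c ∉ F, (R : ℕ∞) < classSize S c

/-- Two rich structures have the same class sizes up to `R`. -/
structure Similar (R : ℕ) (S S' : Set ℕ) : Prop where
  left : Rich R S
  right : Rich R S'
  sizes : ∀ s : ℕ, s ≤ R → s ≠ 0 → ((∃ c, classSize S c = s) ↔ ∃ c, classSize S' c = s)

theorem Similar.symm {R : ℕ} {S S' : Set ℕ} (h : Similar R S S') : Similar R S' S :=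
  ⟨h.right, h.left, fun s h1 h2 => (h.sizes s h1 h2).symm⟩

/-- A position of the game with `r` remaining rounds, out of `R`. -/
structure Position {S S' : Set ℕ} (R r : ℕ) (Z : Finset (EqStr S × EqStr S')) : Prop where
  card : Z.card + r ≤ R
  inj : ∀ p ∈ Z, ∀ q ∈ Z, p.1 = q.1 ↔ p.2 = q.2
  cls : ∀ p ∈ Z, ∀ q ∈ Z, p.1.cls = q.1.cls ↔ p.2.cls = q.2.cls
  size : ∀ p ∈ Z, ∀ s : ℕ, s ≤ R → (classSize S p.1.cls = s ↔ classSize S' p.2.cls = s)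

/-! ### The back-and-forth game -/

section Game

variable {S S' : Set ℕ} {R : ℕ}

theorem Position.mono {r r' : ℕ} {Z : Finset (EqStr S × EqStr S')} (h : Position R r Z)
    (hr : r' ≤ r) : Position R r' Z :=
  ⟨by have := h.card; omega, h.inj, h.cls, h.size⟩

theorem position_empty (R : ℕ) : Position R R (∅ : Finset (EqStr S × EqStr S')) :=
  ⟨by simp, by simp, by simp, by simp⟩

open Classical in
-- The conditions on a position are symmetric in the two structures, so the back moves follow from
-- the forth moves.
theorem Position.swap {r : ℕ} {Z : Finset (EqStr S × EqStr S')} (h : Position R r Z) :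
    Position R r (Z.image Prod.swap) := by
  refine ⟨(Nat.add_le_add_right Finset.card_image_le r).trans h.card, ?_, ?_, ?_⟩ <;>
    simp only [Finset.mem_image, forall_exists_index, and_imp, forall_apply_eq_imp_iff₂,
      Prod.fst_swap, Prod.snd_swap]
  · exact fun p hp q hq => (h.inj p hp q hq).symm
  · exact fun p hp q hq => (h.cls p hp q hq).symm
  · exact fun p hp s hs => (h.size p hp s hs).symm

open Classical in
theorem Position.extend {r : ℕ} {Z : Finset (EqStr S × EqStr S')} (h : Position R (r + 1) Z)
    {x : EqStr S} {y : EqStr S'} (h1 : ∀ p ∈ Z, p.1 = x ↔ p.2 = y)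
    (h2 : ∀ p ∈ Z, p.1.cls = x.cls ↔ p.2.cls = y.cls)
    (h3 : ∀ s : ℕ, s ≤ R → (classSize S x.cls = s ↔ classSize S' y.cls = s)) :
    Position R r (insert (x, y) Z) := by
  refine ⟨?_, ?_, ?_, ?_⟩
  · have := Finset.card_insert_le (x, y) Z
    have := h.card
    omega
  · intro p hp q hq
    rcases Finset.mem_insert.1 hp with rfl | hp <;> rcases Finset.mem_insert.1 hq with rfl | hq
    · simp
    · simpa [eq_comm] using h1 q hq
    · exact h1 p hp
    · exact h.inj p hp q hq
  · intro p hp q hq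
    rcases Finset.mem_insert.1 hp with rfl | hp <;> rcases Finset.mem_insert.1 hq with rfl | hq
    · simp
    · simpa [eq_comm] using h2 q hq
    · exact h2 p hp
    · exact h.cls p hp q hq
  · intro p hp
    rcases Finset.mem_insert.1 hp with rfl | hp
    · exact h3
    · exact h.size p hp

theorem exists_of_classSize_ne_zero {c : ℕ} (h : classSize S c ≠ 0) :
    ∃ x : EqStr S, x.cls = c := by
  obtain ⟨u, hu⟩ := Set.encard_ne_zero.1 h
  exact ⟨⟨u, hu.1⟩, hu.2⟩

theorem classSize_cls_ne_zero (x : EqStr S) : classSize S x.cls ≠ 0 :=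
  Set.encard_ne_zero.2 ⟨x.1, x.2, rfl⟩

open Classical in
/-- A class with a partner in the game cannot be exhausted before the other one. -/
theorem Position.exists_fresh {r : ℕ} {Z : Finset (EqStr S × EqStr S')}
    (h : Position R (r + 1) Z) {x : EqStr S} (hx : ∀ q ∈ Z, q.1 ≠ x) {p : EqStr S × EqStr S'}
    (hp : p ∈ Z) (hpx : p.1.cls = x.cls) :
    ∃ y : EqStr S', y.cls = p.2.cls ∧ ∀ q ∈ Z, q.2 ≠ y := by
  by_contra hcon
  push Not at hcon
  -- `T` collects the moves already made in the class of `x`. If the class of `p.2` were exhausted,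
  -- it would have at most `T.card` elements.
  let T := Z.filter fun q => q.1.cls = x.cls
  have hT : ∀ q ∈ Z, q.2.cls = p.2.cls → q ∈ T := fun q hq hqp =>
    Finset.mem_filter.2 ⟨hq, ((h.cls q hq p hp).2 hqp).trans hpx⟩
  have hle : classSize S' p.2.cls ≤ T.card := by
    have hsub : {u ∈ S' | (Nat.unpair u).1 = p.2.cls} ⊆
        ((T.image fun q => q.2.1 : Finset ℕ) : Set ℕ) := by
      rintro u ⟨huS, hu⟩
      obtain ⟨q, hq, hqu⟩ := hcon ⟨u, huS⟩ hu
      have hc : q.2.cls = p.2.cls := by rw [hqu]; exact hu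
      exact Finset.mem_coe.2 (Finset.mem_image.2 ⟨q, hT q hq hc, by rw [hqu]⟩)
    refine (Set.encard_le_encard hsub).trans ?_
    rw [Set.encard_coe_eq_coe_finsetCard]
    exact_mod_cast Finset.card_image_le
  have hTZ : T.card ≤ Z.card := Finset.card_filter_le _ _
  obtain ⟨s, hs⟩ := ENat.ne_top_iff_exists.1 (ne_top_of_le_ne_top (ENat.natCast_ne_top _) hle)
  rw [← hs] at hle
  have hsT : s ≤ T.card := by exact_mod_cast hle
  have hcard := h.card
  -- The size `s` is at most `T.card`, hence at most `R`, and sizes in this range are preserved by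
  -- the position.
  have hS : classSize S x.cls = s := by
    rw [← hpx]
    exact (h.size p hp s (by omega)).2 hs.symm
  -- The class of `x` contains the first coordinates of `T` and the unplayed `x`: one element more
  -- than its size allows.
  have hge : ((insert x.1 (T.image fun q => q.1.1) : Finset ℕ).card : ℕ∞) ≤ s := by
    rw [← hS, classSize, ← Set.encard_coe_eq_coe_finsetCard]
    refine Set.encard_le_encard fun u hu => ?_
    rcases Finset.mem_insert.1 (Finset.mem_coe.1 hu) with rfl | hu
    · exact ⟨x.2, rfl⟩
    · obtain ⟨q, hq, rfl⟩ := Finset.mem_image.1 hu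
      exact ⟨q.1.2, (Finset.mem_filter.1 hq).2⟩
  rw [Finset.card_insert_of_notMem, Finset.card_image_of_injOn] at hge
  · have : T.card + 1 ≤ s := by exact_mod_cast hge
    omega
  · intro q hq q' hq' hqq
    have h1 := (Finset.mem_filter.1 (Finset.mem_coe.1 hq)).1
    have h2 := (Finset.mem_filter.1 (Finset.mem_coe.1 hq')).1
    have h3 : q.1 = q'.1 := Subtype.ext hqq
    exact Prod.ext h3 ((h.inj q h1 q' h2).1 h3)
  · intro hmem
    obtain ⟨q, hq, hqx⟩ := Finset.mem_image.1 hmem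
    exact hx q (Finset.mem_filter.1 hq).1 (Subtype.ext hqx)

open Classical in
theorem Position.forth {r : ℕ} {Z : Finset (EqStr S × EqStr S')} (hS : Similar R S S')
    (h : Position R (r + 1) Z) (x : EqStr S) : ∃ y, Position R r (insert (x, y) Z) := by
  by_cases h1 : ∃ p ∈ Z, p.1 = x
  · obtain ⟨p, hp, rfl⟩ := h1
    refine ⟨p.2, ?_⟩
    rw [Finset.insert_eq_self.2 hp]
    exact h.mono (Nat.le_succ r)
  push Not at h1
  by_cases h2 : ∃ p ∈ Z, p.1.cls = x.cls
  · obtain ⟨p, hp, hpx⟩ := h2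
    obtain ⟨y, hy, hyZ⟩ := h.exists_fresh h1 hp hpx
    refine ⟨y, h.extend (fun q hq => iff_of_false (h1 q hq) (hyZ q hq)) (fun q hq => ?_) ?_⟩
    · rw [hy, ← hpx]
      exact h.cls q hq p hp
    · rw [hy, ← hpx]
      exact h.size p hp
  push Not at h2
  have key : ∃ y : EqStr S', (∀ q ∈ Z, q.2.cls ≠ y.cls) ∧
      ∀ s : ℕ, s ≤ R → (classSize S x.cls = s ↔ classSize S' y.cls = s) := by
    by_cases hs : ∃ s : ℕ, s ≤ R ∧ classSize S x.cls = s
    · obtain ⟨s, hsR, hs⟩ := hs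
      have hs0 : s ≠ 0 := by
        rintro rfl
        exact classSize_cls_ne_zero x (by simpa using hs)
      obtain ⟨c, hc⟩ := (hS.sizes s hsR hs0).1 ⟨_, hs⟩
      obtain ⟨y, rfl⟩ := exists_of_classSize_ne_zero (S := S') (c := c)
        (by rw [hc]; exact_mod_cast hs0)
      refine ⟨y, fun q hq hqy => ?_, fun s' _ => by rw [hs, hc]⟩
      rw [← hqy] at hc
      -- If the class of `y` had been played, its partner would have size `s` as well. By uniqueness
      -- it would be the class of `x`, which has not been played.
      exact h2 q hq (hS.left.unique s hsR hs0 _ _ ((h.size q hq s hsR).2 hc) hs)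
    · push Not at hs
      -- At least one round remains, so fewer than `R` classes have been touched, and richness
      -- offers an untouched one of size above `R`. All sizes above `R` count as equal.
      obtain ⟨c, hcF, hc⟩ := hS.right.many (Z.image fun q => q.2.cls)
        (Finset.card_image_le.trans_lt (by have := h.card; omega))
      obtain ⟨y, rfl⟩ := exists_of_classSize_ne_zero (S := S') (c := c)
        (fun h0 => by rw [h0] at hc; exact absurd hc (by simp))
      refine ⟨y, fun q hq hqy => hcF (Finset.mem_image.2 ⟨q, hq, hqy⟩), fun s hsR =>
        iff_of_false (hs s hsR) fun h0 => ?_⟩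
      rw [h0] at hc
      exact absurd (by exact_mod_cast hc : R < s) (by omega)
  obtain ⟨y, hy, hys⟩ := key
  exact ⟨y, h.extend (fun q hq => iff_of_false (h1 q hq) fun h0 => hy q hq (by rw [h0]))
    (fun q hq => iff_of_false (h2 q hq) (hy q hq)) hys⟩

open Classical in
theorem Position.back {r : ℕ} {Z : Finset (EqStr S × EqStr S')} (hS : Similar R S S')
    (h : Position R (r + 1) Z) (y : EqStr S') : ∃ x, Position R r (insert (x, y) Z) := by
  obtain ⟨x, hx⟩ := h.swap.forth hS.symm y
  refine ⟨x, ?_⟩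
  have := hx.swap
  rw [Finset.image_insert, Finset.image_image] at this
  simpa using this

theorem Position.forth_fin (hS : Similar R S S') : ∀ {n r : ℕ} {Z : Finset (EqStr S × EqStr S')},
    Position R (n + r) Z → ∀ x : Fin n → EqStr S, ∃ (y : Fin n → EqStr S')
      (Z' : Finset (EqStr S × EqStr S')), Z ⊆ Z' ∧ Position R r Z' ∧ ∀ i, (x i, y i) ∈ Z' := by
  classical
  intro n
  induction n with
  | zero =>
    intro r Z h x
    exact ⟨Fin.elim0, Z, subset_rfl, by simpa using h, fun i => i.elim0⟩
  | succ n ih =>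
    intro r Z h x
    obtain ⟨y0, h0⟩ := Position.forth (r := n + r) hS (h.mono (by omega)) (x 0)
    obtain ⟨y, Z', hZ', hpos, hy⟩ := ih h0 (fun i => x i.succ)
    refine ⟨Fin.cons y0 y, Z', (Finset.subset_insert _ _).trans hZ', hpos, fun i => ?_⟩
    refine Fin.cases ?_ (fun i => ?_) i
    · exact hZ' (Finset.mem_insert_self _ _)
    · simpa using hy i

theorem Position.forth_finite (hS : Similar R S S') {β : Type} [Finite β] {r : ℕ}
    {Z : Finset (EqStr S × EqStr S')} (h : Position R (Nat.card β + r) Z) (x : β → EqStr S) :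
    ∃ (y : β → EqStr S') (Z' : Finset (EqStr S × EqStr S')),
      Z ⊆ Z' ∧ Position R r Z' ∧ ∀ i, (x i, y i) ∈ Z' := by
  let e := Finite.equivFin β
  obtain ⟨y, Z', h1, h2, h3⟩ := h.forth_fin hS (x ∘ e.symm)
  exact ⟨y ∘ e, Z', h1, h2, fun i => by simpa using h3 (e i)⟩

theorem Position.back_finite (hS : Similar R S S') {β : Type} [Finite β] {r : ℕ}
    {Z : Finset (EqStr S × EqStr S')} (h : Position R (Nat.card β + r) Z) (y : β → EqStr S') :
    ∃ (x : β → EqStr S) (Z' : Finset (EqStr S × EqStr S')),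
      Z ⊆ Z' ∧ Position R r Z' ∧ ∀ i, (x i, y i) ∈ Z' := by
  classical
  obtain ⟨x, Z', h1, h2, h3⟩ := h.swap.forth_finite hS.symm y
  refine ⟨x, Z'.image Prod.swap, fun p hp => ?_, h2.swap, fun i => ?_⟩
  · exact Finset.mem_image.2 ⟨p.swap, h1 (Finset.mem_image_of_mem _ hp), by simp⟩
  · exact Finset.mem_image.2 ⟨_, h3 i, rfl⟩

end Game

/-! ## The rank of a formula -/

/-- The formula `ψ` is invariant under the game with `r` remaining rounds. -/
def Ranked {X : Type} (r : ℕ) (ψ : sigE.lang.Formula X) : Prop :=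
  ∀ (R : ℕ) (S S' : Set ℕ), Similar R S S' → ∀ Z : Finset (EqStr S × EqStr S'),
    Position R r Z → ∀ v w, (∀ i, (v i, w i) ∈ Z) → (ψ.Realize v ↔ ψ.Realize w)

namespace Ranked

variable {X Y : Type}

theorem mono {r r' : ℕ} {ψ : sigE.lang.Formula X} (h : Ranked r ψ) (hr : r ≤ r') : Ranked r' ψ :=
  fun R S S' hS Z hZ v w hv => h R S S' hS Z (hZ.mono hr) v w hv

theorem bot {r : ℕ} : Ranked r (⊥ : sigE.lang.Formula X) :=
  fun _ _ _ _ _ _ _ _ _ => Iff.rfl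

theorem imp {r : ℕ} {φ ψ : sigE.lang.Formula X} (hφ : Ranked r φ) (hψ : Ranked r ψ) :
    Ranked r (φ.imp ψ) := fun R S S' hS Z hZ v w hv => by
  rw [Formula.realize_imp, Formula.realize_imp, hφ R S S' hS Z hZ v w hv,
    hψ R S S' hS Z hZ v w hv]

theorem inf {r : ℕ} {φ ψ : sigE.lang.Formula X} (hφ : Ranked r φ) (hψ : Ranked r ψ) :
    Ranked r (φ ⊓ ψ) := fun R S S' hS Z hZ v w hv => by
  rw [Formula.realize_inf, Formula.realize_inf, hφ R S S' hS Z hZ v w hv,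
    hψ R S S' hS Z hZ v w hv]

theorem iInf {r : ℕ} {β : Type*} [Finite β] {φ : β → sigE.lang.Formula X}
    (hφ : ∀ b, Ranked r (φ b)) : Ranked r (Formula.iInf φ) := fun R S S' hS Z hZ v w hv => by
  rw [Formula.realize_iInf, Formula.realize_iInf]
  exact forall_congr' fun b => hφ b R S S' hS Z hZ v w hv

theorem iSup {r : ℕ} {β : Type*} [Finite β] {φ : β → sigE.lang.Formula X}
    (hφ : ∀ b, Ranked r (φ b)) : Ranked r (Formula.iSup φ) := fun R S S' hS Z hZ v w hv => by
  rw [Formula.realize_iSup, Formula.realize_iSup]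
  exact exists_congr fun b => hφ b R S S' hS Z hZ v w hv

theorem relabel {r : ℕ} {φ : sigE.lang.Formula X} (hφ : Ranked r φ) (f : X → Y) :
    Ranked r (φ.relabel f) := fun R S S' hS Z hZ v w hv => by
  rw [Formula.realize_relabel, Formula.realize_relabel]
  exact hφ R S S' hS Z hZ _ _ fun i => hv (f i)

theorem equal {r : ℕ} (x y : X) :
    Ranked r (Term.equal (L := sigE.lang) (Term.var x) (Term.var y)) :=
  fun R S S' hS Z hZ v w hv => by
    rw [Formula.realize_equal, Formula.realize_equal]
    exact hZ.inj _ (hv x) _ (hv y)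

/-- A block of existential quantifiers costs one round for each variable; witnesses on either side
are answered by the forth or back moves. -/
theorem iExs {r : ℕ} (β : Type) [Finite β] {φ : sigE.lang.Formula (X ⊕ β)} (hφ : Ranked r φ) :
    Ranked (Nat.card β + r) (Formula.iExs β φ) := fun R S S' hS Z hZ v w hv => by
  rw [Formula.realize_iExs, Formula.realize_iExs]
  constructor
  · rintro ⟨x, hx⟩
    obtain ⟨y, Z', h1, h2, h3⟩ := hZ.forth_finite hS x
    refine ⟨y, (hφ R S S' hS Z' h2 _ _ ?_).1 hx⟩
    rintro (i | i)
    · exact h1 (hv i)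
    · exact h3 i
  · rintro ⟨y, hy⟩
    obtain ⟨x, Z', h1, h2, h3⟩ := hZ.back_finite hS y
    refine ⟨x, (hφ R S S' hS Z' h2 _ _ ?_).2 hy⟩
    rintro (i | i)
    · exact h1 (hv i)
    · exact h3 i

theorem iAlls {r : ℕ} (β : Type) [Finite β] {φ : sigE.lang.Formula (X ⊕ β)} (hφ : Ranked r φ) :
    Ranked (Nat.card β + r) (Formula.iAlls β φ) := fun R S S' hS Z hZ v w hv => by
  rw [Formula.realize_iAlls, Formula.realize_iAlls]
  constructor
  · intro h y
    obtain ⟨x, Z', h1, h2, h3⟩ := hZ.back_finite hS y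
    refine (hφ R S S' hS Z' h2 _ _ ?_).1 (h x)
    rintro (i | i)
    · exact h1 (hv i)
    · exact h3 i
  · intro h x
    obtain ⟨y, Z', h1, h2, h3⟩ := hZ.forth_finite hS x
    refine (hφ R S S' hS Z' h2 _ _ ?_).2 (h y)
    rintro (i | i)
    · exact h1 (hv i)
    · exact h3 i

end Ranked

theorem exists_var_eq {n : ℕ} {X : Type} (t : sigE.lang.Term (X ⊕ Fin n)) :
    ∃ x, t = Term.var x := by
  cases t with
  | var x => exact ⟨x, rfl⟩
  | func f _ => exact Fin.elim0 f.1

/-- The rank is the quantifier depth: atoms cost nothing because positions preserve identity and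
equivalence, and each quantifier uses one round. -/
theorem exists_rank_boundedFormula {X : Type} {n : ℕ} (ψ : sigE.lang.BoundedFormula X n) :
    ∃ r, ∀ (R : ℕ) (S S' : Set ℕ), Similar R S S' → ∀ Z : Finset (EqStr S × EqStr S'),
      Position R r Z → ∀ v w xs ys, (∀ i, (v i, w i) ∈ Z) → (∀ i, (xs i, ys i) ∈ Z) →
        (ψ.Realize v xs ↔ ψ.Realize w ys) := by
  classical
  have hsum : ∀ {S S' : Set ℕ} {Z : Finset (EqStr S × EqStr S')} {n : ℕ} {v : X → EqStr S}
      {w : X → EqStr S'} {xs : Fin n → EqStr S} {ys : Fin n → EqStr S'}, (∀ i, (v i, w i) ∈ Z) →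
      (∀ i, (xs i, ys i) ∈ Z) → ∀ i, (Sum.elim v xs i, Sum.elim w ys i) ∈ Z := by
    rintro S S' Z n v w xs ys h1 h2 (i | i)
    · exact h1 i
    · exact h2 i
  induction ψ with
  | falsum => exact ⟨0, fun _ _ _ _ _ _ _ _ _ _ _ _ => Iff.rfl⟩
  | equal t u =>
    obtain ⟨x, rfl⟩ := exists_var_eq t
    obtain ⟨y, rfl⟩ := exists_var_eq u
    exact ⟨0, fun R S S' hS Z hZ v w xs ys hv hx =>
      hZ.inj _ (hsum hv hx x) _ (hsum hv hx y)⟩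
  | rel _ ts =>
    choose x hx using fun i => exists_var_eq (ts i)
    obtain rfl : ts = fun i => Term.var (x i) := funext hx
    exact ⟨0, fun R S S' hS Z hZ v w xs ys hv hx => forall_congr' fun i => forall_congr' fun j =>
      hZ.cls _ (hsum hv hx (x i)) _ (hsum hv hx (x j))⟩
  | imp φ ψ h1 h2 =>
    obtain ⟨r1, h1⟩ := h1
    obtain ⟨r2, h2⟩ := h2
    refine ⟨max r1 r2, fun R S S' hS Z hZ v w xs ys hv hx => ?_⟩
    rw [BoundedFormula.realize_imp, BoundedFormula.realize_imp,
      h1 R S S' hS Z (hZ.mono (le_max_left _ _)) v w xs ys hv hx,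
      h2 R S S' hS Z (hZ.mono (le_max_right _ _)) v w xs ys hv hx]
  | all φ ih =>
    obtain ⟨r, ih⟩ := ih
    refine ⟨r + 1, fun R S S' hS Z hZ v w xs ys hv hx => ?_⟩
    have key : ∀ x y, Position R r (insert (x, y) Z) →
        (φ.Realize v (Fin.snoc xs x) ↔ φ.Realize w (Fin.snoc ys y)) := fun x y h => by
      refine ih R S S' hS _ h v w _ _ (fun i => Finset.mem_insert_of_mem (hv i)) fun i => ?_
      refine Fin.lastCases ?_ (fun i => ?_) i
      · simp
      · simp [hx i]
    rw [BoundedFormula.realize_all, BoundedFormula.realize_all]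
    constructor
    · intro h y
      obtain ⟨x, hx⟩ := hZ.back hS y
      exact (key x y hx).1 (h x)
    · intro h x
      obtain ⟨y, hy⟩ := hZ.forth hS x
      exact (key x y hy).2 (h y)

/-- Every formula has a rank. -/
theorem exists_ranked {X : Type} (ψ : sigE.lang.Formula X) : ∃ r, Ranked r ψ := by
  obtain ⟨r, h⟩ := exists_rank_boundedFormula ψ
  exact ⟨r, fun R S S' hS Z hZ v w hv => h R S S' hS Z hZ v w _ _ hv fun i => i.elim0⟩

/-- Similar structures agree on the sentences of rank at most `R`. -/
theorem Ranked.sentence_iff {r R : ℕ} {φ : sigE.lang.Sentence} (h : Ranked r φ) (hr : r ≤ R)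
    {S S' : Set ℕ} (hS : Similar R S S') : EqStr S ⊨ φ ↔ EqStr S' ⊨ φ :=
  h R S S' hS ∅ ((position_empty R).mono hr) _ _ fun i => i.elim

/-! ## The rank of a translation -/

theorem termCode_lt_encode {s : Signature} {n k : ℕ} (ts : Fin k → s.lang.Term (Empty ⊕ Fin n))
    (i : Fin k) : termCode (ts i) < Encodable.encode (List.ofFn fun i => termCode (ts i)) :=
  lt_encode_of_mem ((List.mem_ofFn' _ _).2 ⟨i, rfl⟩)

/-- Bounds for the ingredients of a translation: `d` for the number of quantifiers of a block, `r`
for the ranks of the formulas. -/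
structure Translation.Bounded {s : Signature} (τ : Translation s.lang sigE.lang) (d r : ℕ) :
    Prop where
  block : ∀ (n : ℕ), (n = 2 ∨ n ∈ s.1 ∨ n ∈ s.2) → ∀ ρ : Fin n → Fin τ.pieces,
    Nat.card (Σ m, Fin (τ.dim (ρ m))) ≤ d
  dim : ∀ i, τ.dim i ≤ d
  params : τ.params ≤ d
  paramDom : Ranked r τ.paramDom
  dom : ∀ i, Ranked r (τ.dom i)
  eq : ∀ ρ, Ranked r (τ.eq ρ)
  rel : ∀ {n : ℕ} (R : s.lang.Relations n) ρ, Ranked r (τ.rel R ρ)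
  func : ∀ {n : ℕ} (f : s.lang.Functions n) ρ j, Ranked r (τ.func f ρ j)

theorem exists_ranked_finite {ι : Type*} [Finite ι] {X : ι → Type}
    (ψ : ∀ i, sigE.lang.Formula (X i)) : ∃ r, ∀ i, Ranked r (ψ i) := by
  choose r hr using fun i => exists_ranked (ψ i)
  obtain ⟨M, hM⟩ := Finite.exists_le r
  exact ⟨M, fun i => (hr i).mono (hM i)⟩

namespace Translation

variable {s : Signature} (τ : Translation s.lang sigE.lang)

/-- A translation consists of finitely many formulas, since the signature and the number of pieces
are finite. The maximum of their ranks and of the block lengths therefore exists. -/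
theorem exists_bounded : ∃ d r, τ.Bounded d r := by
  obtain ⟨r0, h0⟩ := exists_ranked τ.paramDom
  obtain ⟨r1, h1⟩ := exists_ranked_finite τ.dom
  obtain ⟨r2, h2⟩ := exists_ranked_finite τ.eq
  obtain ⟨r3, h3⟩ := exists_ranked_finite
    fun x : Σ i : Fin s.2.length, (Fin (s.2.get i) → Fin τ.pieces) =>
      τ.rel (n := s.2.get x.1) ⟨x.1, rfl⟩ x.2
  obtain ⟨r4, h4⟩ := exists_ranked_finite
    fun x : (Σ i : Fin s.1.length, (Fin (s.1.get i) → Fin τ.pieces)) × Fin τ.pieces =>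
      τ.func (n := s.1.get x.1.1) ⟨x.1.1, rfl⟩ x.1.2 x.2
  obtain ⟨d0, hd0⟩ := Finite.exists_le τ.dim
  refine ⟨(2 + s.1.sum + s.2.sum) * d0 + d0 + τ.params, r0 + r1 + r2 + r3 + r4, ?_, ?_, ?_, ?_, ?_,
    ?_, ?_, ?_⟩
  · intro n hn ρ
    -- Every relevant arity is `2`, for identity, or is one of the listed arities, which is bounded
    -- by their sum.
    have hn' : n ≤ 2 + s.1.sum + s.2.sum := by
      rcases hn with rfl | hn | hn
      · omega
      · have := List.le_sum_of_mem hn; omega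
      · have := List.le_sum_of_mem hn; omega
    have : Nat.card (Σ m, Fin (τ.dim (ρ m))) ≤ n * d0 := by
      rw [Nat.card_eq_fintype_card, Fintype.card_sigma]
      simpa using Finset.sum_le_card_nsmul Finset.univ (fun m => τ.dim (ρ m)) d0
        fun m _ => hd0 (ρ m)
    have := Nat.mul_le_mul_right d0 hn'
    omega
  · intro i
    have := hd0 i
    omega
  · omega
  · exact h0.mono (by omega)
  · exact fun i => (h1 i).mono (by omega)
  · exact fun ρ => (h2 ρ).mono (by omega)
  · rintro n ⟨i, rfl⟩ ρ
    exact (h3 ⟨i, ρ⟩).mono (by omega)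
  · rintro n ⟨i, rfl⟩ ρ j
    exact (h4 ⟨⟨i, ρ⟩, j⟩).mono (by omega)

variable {τ} {d r : ℕ}

theorem Bounded.existsTuples (hτ : τ.Bounded d r) {X : Type} {p : Fin τ.params → X} {n : ℕ}
    (hn : n = 2 ∨ n ∈ s.1 ∨ n ∈ s.2) {r' : ℕ} (hr : r ≤ r')
    {body : ∀ ρ : Fin n → Fin τ.pieces, sigE.lang.Formula (X ⊕ Σ m, Fin (τ.dim (ρ m)))}
    (hb : ∀ ρ, Ranked r' (body ρ)) : Ranked (d + r') (τ.existsTuples p n body) := by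
  refine Ranked.iSup fun ρ => Ranked.mono (Ranked.iExs _ (Ranked.inf
    (Ranked.iInf fun m => ?_) (hb ρ))) (Nat.add_le_add_right (hτ.block n hn ρ) _)
  exact ((hτ.dom (ρ m)).mono hr).relabel _

/-- Unnesting a function application costs one block of at most `d` quantifiers. The codes of the
arguments are strictly smaller, so one more multiple of `d + r` pays for the block. -/
theorem Bounded.value (hτ : τ.Bounded d r) {n : ℕ} (t : s.lang.Term (Empty ⊕ Fin n)) :
    ∀ {X : Type} (p : Fin τ.params → X) (σ : Fin n → τ.Tuple X) (j : Fin τ.pieces)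
      (y : Fin (τ.dim j) → X), Ranked ((d + r) * (termCode t + 1)) (τ.value t p σ j y) := by
  induction t with
  | var x =>
    intro X p σ j y
    rcases x with x | x
    · exact x.elim
    · rw [Translation.value]
      split_ifs with h
      · exact Ranked.iInf fun l => Ranked.equal _ _
      · exact Ranked.bot
  | @func k f ts ih =>
    intro X p σ j y
    rw [Translation.value]
    obtain ⟨i, rfl⟩ := f
    have hcode : ∀ m, termCode (ts m) + 1 ≤ termCode (Term.func (L := s.lang) ⟨i, rfl⟩ ts) :=
      fun m => by
        have h1 := termCode_lt_encode ts m
        have h2 := Nat.right_le_pair (i : ℕ) (Encodable.encode (List.ofFn fun i => termCode (ts i)))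
        have h3 := Nat.add_le_pair 1 (Nat.pair i (Encodable.encode
          (List.ofFn fun i => termCode (ts i))))
        simp only [termCode]
        omega
    have hpos : 1 ≤ termCode (Term.func (L := s.lang) ⟨i, rfl⟩ ts) := by
      have h3 := Nat.add_le_pair 1 (Nat.pair i (Encodable.encode
          (List.ofFn fun i => termCode (ts i))))
      simp only [termCode]
      omega
    generalize hc : termCode (Term.func (L := s.lang) ⟨i, rfl⟩ ts) = c at hcode hpos
    have hrc : d + r ≤ (d + r) * c := Nat.le_mul_of_pos_right _ hpos
    refine Ranked.mono (hτ.existsTuples (r' := (d + r) * c) (Or.inr (Or.inl (List.get_mem _ _)))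
      (by omega) fun ρ => Ranked.inf (Ranked.iInf fun m => ?_) ?_) (by rw [mul_add]; omega)
    · exact (ih m _ _ _ _).mono (Nat.mul_le_mul_left _ (hcode m))
    · exact ((hτ.func _ ρ j).mono (by omega)).relabel _

theorem Bounded.atomic (hτ : τ.Bounded d r) {n k c : ℕ} {X : Type} (p : Fin τ.params → X) (σ : Fin n → τ.Tuple X)
    {P : ∀ ρ : Fin k → Fin τ.pieces, sigE.lang.Formula (Fin τ.params ⊕ Σ m, Fin (τ.dim (ρ m)))}
    (hP : ∀ ρ, Ranked r (P ρ)) {ts : Fin k → s.lang.Term (Empty ⊕ Fin n)}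
    (hk : k = 2 ∨ k ∈ s.1 ∨ k ∈ s.2) (hc : ∀ m, termCode (ts m) + 1 ≤ c) (hpos : 1 ≤ c) :
    Ranked ((d + r) * (c + 1)) (τ.atomic p σ P ts) := by
  have hrc : d + r ≤ (d + r) * c := Nat.le_mul_of_pos_right _ hpos
  refine Ranked.mono (hτ.existsTuples (r' := (d + r) * c) hk
      (by omega) fun ρ => Ranked.inf (Ranked.iInf fun m => ?_) ?_) (by rw [mul_add]; omega)
  · exact (hτ.value (ts m) _ _ _ _).mono (Nat.mul_le_mul_left _ (hc m))
  · exact ((hP ρ).mono (by omega)).relabel _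

/-- Each step of the translation adds at most one block of quantifiers while the Gödel number grows.
The exact form of the bound matters little. What counts is that it depends on the formula only
through its number and on the translation only through one constant, so that a presentation can
carry that constant as data. -/
theorem Bounded.formula (hτ : τ.Bounded d r) {n : ℕ} (φ : s.lang.BoundedFormula Empty n) :
    ∀ {X : Type} (p : Fin τ.params → X) (σ : Fin n → τ.Tuple X),
      Ranked ((d + r) * (formulaCode φ + 1)) (τ.formula φ p σ) := by
  induction φ with
  | falsum => intro X p σ; exact Ranked.bot
  | equal t u =>
    intro X p σ
    have h1 := Nat.add_le_pair 1 (Nat.pair (termCode t) (termCode u))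
    refine hτ.atomic p σ hτ.eq (Or.inl rfl) (fun m => ?_) ?_
    · have h2 := Nat.left_le_pair (termCode t) (termCode u)
      have h3 := Nat.right_le_pair (termCode t) (termCode u)
      simp only [formulaCode]
      refine Fin.cases ?_ (fun i => ?_) m
      · simp only [Matrix.cons_val_zero]
        omega
      · obtain rfl := Subsingleton.elim i 0
        simp only [Fin.succ_zero_eq_one, Matrix.cons_val_one, Matrix.cons_val_fin_one]
        omega
    · simp only [formulaCode]
      omega
  | @rel _ k R ts =>
    intro X p σ
    obtain ⟨i, rfl⟩ := R
    have h1 := Nat.add_le_pair 2 (Nat.pair i (Encodable.encode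
      (List.ofFn fun i => termCode (ts i))))
    have h2 := Nat.right_le_pair (i : ℕ) (Encodable.encode (List.ofFn fun i => termCode (ts i)))
    refine hτ.atomic p σ (hτ.rel _) (Or.inr (Or.inr (List.get_mem _ _))) (fun m => ?_) ?_
    · have h3 := termCode_lt_encode ts m
      simp only [formulaCode]
      omega
    · simp only [formulaCode]
      omega
  | imp φ ψ h1 h2 =>
    intro X p σ
    have h3 := Nat.right_le_pair 3 (Nat.pair (formulaCode φ) (formulaCode ψ))
    have h4 := Nat.left_le_pair (formulaCode φ) (formulaCode ψ)
    have h5 := Nat.right_le_pair (formulaCode φ) (formulaCode ψ)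
    refine Ranked.imp ((h1 p σ).mono (Nat.mul_le_mul_left _ ?_))
      ((h2 p σ).mono (Nat.mul_le_mul_left _ ?_))
    · simp only [formulaCode]
      omega
    · simp only [formulaCode]
      omega
  | all φ ih =>
    intro X p σ
    have h3 := Nat.add_le_pair 4 (formulaCode φ)
    have h4 : (d + r) * (formulaCode φ + 1) ≤ (d + r) * Nat.pair 4 (formulaCode φ) :=
      Nat.mul_le_mul_left _ (by omega)
    have h5 : d + r ≤ (d + r) * Nat.pair 4 (formulaCode φ) :=
      Nat.le_mul_of_pos_right _ (by omega)
    refine Ranked.iInf fun i => Ranked.mono (r := d + (d + r) * Nat.pair 4 (formulaCode φ))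
      (Ranked.mono (Ranked.iAlls (r := (d + r) * Nat.pair 4 (formulaCode φ)) _
        (Ranked.imp (((hτ.dom i).mono (by omega)).relabel _) ((ih _ _).mono h4))) ?_) ?_
    · simpa using hτ.dim i
    · simp only [formulaCode]
      rw [mul_add]
      omega

/-- The rank of the translation of a sentence is bounded linearly in its Gödel number. -/
theorem exists_rank (τ : Translation s.lang sigE.lang) :
    ∃ C, Ranked C τ.existsParams ∧
      ∀ φ : s.lang.Sentence, Ranked (C * (formulaCode φ + 1)) (τ.sentence φ) := by
  obtain ⟨d, r, hτ⟩ := τ.exists_bounded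
  -- The extra `d` pays for quantifying over the parameters.
  refine ⟨d + (d + r), ?_, fun φ => ?_⟩
  · refine Ranked.mono (Ranked.iExs _ (hτ.paramDom.relabel _)) ?_
    have := hτ.params
    simp only [Nat.card_eq_fintype_card, Fintype.card_fin]
    omega
  · have h : d + r ≤ (d + r) * (formulaCode φ + 1) := Nat.le_mul_of_pos_right _ (by omega)
    refine Ranked.mono (Ranked.iAlls (r := (d + r) * (formulaCode φ + 1)) _
      (Ranked.imp ((hτ.paramDom.mono (by omega)).relabel _) (hτ.formula φ _ _))) ?_
    have := hτ.params
    have h' : d ≤ d * (formulaCode φ + 1) := Nat.le_mul_of_pos_right _ (by omega)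
    simp only [Nat.card_eq_fintype_card, Fintype.card_fin]
    have h2 : (d + (d + r)) * (formulaCode φ + 1) =
        d * (formulaCode φ + 1) + (d + r) * (formulaCode φ + 1) := add_mul _ _ _
    omega

end Translation

/-! ## Models of `J` -/

section Realize

variable {M : Type} [sigE.lang.Structure M] {m : ℕ} {v : Empty → M}

theorem realize_conj {l : List (sigE.lang.BoundedFormula Empty m)} {xs : Fin m → M} :
    (conj l).Realize v xs ↔ ∀ φ ∈ l, φ.Realize v xs := by
  induction l with
  | nil => simp [conj]
  | cons φ l ih =>
    change (φ ⊓ conj l).Realize v xs ↔ _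
    rw [BoundedFormula.realize_inf, ih, List.forall_mem_cons]

theorem realize_exLast : ∀ {n : ℕ} {φ : sigE.lang.BoundedFormula Empty (m + n)} {xs : Fin m → M},
    (exLast n φ).Realize v xs ↔ ∃ ys : Fin n → M, φ.Realize v (Fin.append xs ys) := by
  intro n
  induction n with
  | zero =>
    intro φ xs
    simp only [exLast]
    constructor
    · intro h
      exact ⟨Fin.elim0, by simpa [Fin.append_right_nil] using h⟩
    · rintro ⟨ys, h⟩
      simpa [Fin.append_right_nil] using h
  | succ n ih =>
    intro φ xs
    simp only [exLast]
    rw [ih]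
    simp only [BoundedFormula.realize_ex]
    constructor
    · rintro ⟨ys, a, h⟩
      exact ⟨Fin.snoc ys a, by rwa [Fin.append_snoc]⟩
    · rintro ⟨ys, h⟩
      refine ⟨Fin.init ys, ys (Fin.last n), ?_⟩
      rw [← Fin.append_snoc, Fin.snoc_init_self]
      exact h

end Realize

section EqStr

variable {S : Set ℕ} {m : ℕ} {v : Empty → EqStr S} {xs : Fin m → EqStr S}

theorem realize_relE {x y : Fin m} :
    (relE x y).Realize v xs ↔ (xs x).cls = (xs y).cls := by
  rw [relE, BoundedFormula.realize_rel₂]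
  change (∀ i j : Fin 2, _) ↔ _
  simp [Fin.forall_fin_two, eq_comm]

theorem realize_eqE {x y : Fin m} : (eqE x y).Realize v xs ↔ xs x = xs y := by
  simp [eqE]

theorem realize_classGe {n : ℕ} {x : Fin m} :
    (classGe n x).Realize v xs ↔ (n : ℕ∞) ≤ classSize S (xs x).cls := by
  rw [classGe, realize_exLast]
  have h : ∀ ys : Fin n → EqStr S, (conj ((List.finRange n).map fun i =>
      relE (Fin.castAdd n x) (Fin.natAdd m i) ⊓
        conj ((List.finRange n).map fun j =>
          if i = j then ⊤ else ∼(eqE (Fin.natAdd m i) (Fin.natAdd m j))))).Realize v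
        (Fin.append xs ys) ↔
      (∀ i, (ys i).cls = (xs x).cls) ∧ Function.Injective ys := by
    intro ys
    rw [realize_conj]
    simp only [List.forall_mem_map, BoundedFormula.realize_inf, realize_conj, realize_relE,
      List.mem_finRange, true_implies, Fin.append_left, Fin.append_right, forall_and]
    refine and_congr (forall_congr' fun i => eq_comm) ?_
    refine forall_congr' fun i => forall_congr' fun j => ?_
    split_ifs with hij
    · simp [hij]
    · simp [realize_eqE, hij]
  simp only [h]
  constructor
  · rintro ⟨ys, h1, h2⟩
    have hinj : Function.Injective fun i => (ys i).1 := fun i j hij => h2 (Subtype.ext hij)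
    have hcard : ((Finset.univ.image fun i => (ys i).1 : Finset ℕ).card : ℕ∞) = n := by
      rw [Finset.card_image_of_injective _ hinj]
      simp
    rw [classSize, ← hcard, ← Set.encard_coe_eq_coe_finsetCard]
    refine Set.encard_le_encard fun u hu => ?_
    obtain ⟨i, -, rfl⟩ := Finset.mem_image.1 (Finset.mem_coe.1 hu)
    exact ⟨(ys i).2, h1 i⟩
  · intro hn
    obtain ⟨t, ht, htn⟩ := Set.exists_subset_encard_eq hn
    have hfin : t.Finite := Set.finite_of_encard_eq_coe htn
    have hcard : hfin.toFinset.card = n := by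
      rw [hfin.encard_eq_coe_toFinset_card] at htn
      exact_mod_cast htn
    have hmem : ∀ i, hfin.toFinset.orderEmbOfFin hcard i ∈ t := fun i =>
      hfin.mem_toFinset.1 (Finset.orderEmbOfFin_mem _ _ _)
    refine ⟨fun i => ⟨hfin.toFinset.orderEmbOfFin hcard i, (ht (hmem i)).1⟩,
      fun i => (ht (hmem i)).2, fun i j hij => ?_⟩
    have h0 := congrArg Subtype.val hij
    exact (hfin.toFinset.orderEmbOfFin hcard).injective h0

theorem realize_classEq {n : ℕ} {x : Fin m} :
    (classEq n x).Realize v xs ↔ classSize S (xs x).cls = n := by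
  rw [classEq, BoundedFormula.realize_inf, BoundedFormula.realize_not, realize_classGe,
    realize_classGe]
  generalize classSize S (xs x).cls = k
  cases k with
  | top => simp
  | coe k =>
    norm_cast
    omega

theorem realize_sentA {n : ℕ} :
    EqStr S ⊨ sentA n ↔ ∃ x : EqStr S, classSize S x.cls = (n + 1 : ℕ) := by
  simp only [Sentence.Realize, Formula.Realize, sentA, BoundedFormula.realize_ex, realize_classEq]
  rfl

theorem realize_atMostOneClass {n : ℕ} :
    EqStr S ⊨ atMostOneClass n ↔ ∀ x y : EqStr S, classSize S x.cls = n → classSize S y.cls = n →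
      x.cls = y.cls := by
  simp only [Sentence.Realize, Formula.Realize, atMostOneClass, BoundedFormula.realize_all,
    BoundedFormula.realize_imp, realize_classEq, realize_relE]
  rfl

theorem realize_manyLargeClasses {n : ℕ} :
    EqStr S ⊨ manyLargeClasses n ↔ ∃ ys : Fin n → EqStr S,
      (∀ i, (n : ℕ∞) ≤ classSize S (ys i).cls) ∧ Function.Injective fun i => (ys i).cls := by
  rw [manyLargeClasses, Sentence.Realize, Formula.Realize, realize_exLast]
  refine exists_congr fun ys => ?_
  rw [realize_conj]
  simp only [List.forall_mem_map, BoundedFormula.realize_inf, realize_conj, realize_classGe,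
      List.mem_finRange, true_implies, Fin.append_right, forall_and]
  refine and_congr_right fun _ => forall_congr' fun i => forall_congr' fun j => ?_
  split_ifs with hij
  · simp [hij]
  · rw [BoundedFormula.realize_not, realize_relE, Fin.append_right, Fin.append_right]
    simp [hij]

theorem realize_equivalence :
    EqStr S ⊨ reflE ∧ EqStr S ⊨ symmE ∧ EqStr S ⊨ transE := by
  simp only [Sentence.Realize, Formula.Realize, reflE, symmE, transE, BoundedFormula.realize_all,
    BoundedFormula.realize_imp, realize_relE]
  exact ⟨fun _ => trivial, fun _ _ h => h.symm, fun _ _ _ h1 h2 => h1.trans h2⟩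

end EqStr

/-! ### Canonical models and their finite approximations -/

/-- The universe of the model of `J` that has a class of size `n + 1` for `n ∈ Q`, and infinitely
many infinite classes. -/
def infSet (Q : Set ℕ) : Set ℕ :=
  {u | u.unpair.1 % 2 = 1 ∨ (u.unpair.1 / 2 ∈ Q ∧ u.unpair.2 ≤ u.unpair.1 / 2)}

/-- The universe of a finite approximation of that model. -/
def finSet (Q : Set ℕ) (R : ℕ) : Set ℕ :=
  {u | u ∈ infSet Q ∧ u.unpair.1 ≤ 2 * R + 2 ∧ u.unpair.2 ≤ R + 1}

/-- Numbers code pairs of a class and a position in it. Odd classes are infinite in `infSet`, and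
class `2 * n` has the `n + 1` positions `0, …, n` when `n ∈ Q`. -/
theorem classSize_eq (S : Set ℕ) (c : ℕ) : classSize S c = {j | Nat.pair c j ∈ S}.encard := by
  have hinj : Function.Injective (Nat.pair c) := fun i j h => (Nat.pair_eq_pair.1 h).2
  rw [classSize, ← hinj.encard_image {j | Nat.pair c j ∈ S}]
  congr 1
  ext u
  constructor
  · rintro ⟨hu, rfl⟩
    exact ⟨u.unpair.2, by simpa using hu, by simp⟩
  · rintro ⟨j, hj, rfl⟩
    exact ⟨hj, by simp⟩

theorem encard_Iic (n : ℕ) : (Set.Iic n).encard = (n + 1 : ℕ) := by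
  rw [← Finset.coe_Iic, Set.encard_coe_eq_coe_finsetCard, Nat.card_Iic]

theorem classSize_infSet_odd {Q : Set ℕ} {c : ℕ} (hc : c % 2 = 1) :
    classSize (infSet Q) c = ⊤ := by
  rw [classSize_eq]
  have : {j | Nat.pair c j ∈ infSet Q} = Set.univ := by
    ext j; simp [infSet, hc]
  rw [this]
  exact Set.encard_eq_top Set.infinite_univ

/-- Truncated at position `R + 1`, a formerly infinite class keeps size `R + 2`, which is still
beyond what a game with threshold `R` can measure. -/
theorem classSize_finSet_odd {Q : Set ℕ} {R c : ℕ} (hc : c % 2 = 1) (hcR : c ≤ 2 * R + 2) :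
    classSize (finSet Q R) c = (R + 2 : ℕ) := by
  rw [classSize_eq, ← encard_Iic]
  congr 1
  ext j; simp [infSet, finSet, hc, hcR]

theorem classSize_infSet_even {Q : Set ℕ} {c : ℕ} (hc : c % 2 = 0) (hQ : c / 2 ∈ Q) :
    classSize (infSet Q) c = (c / 2 + 1 : ℕ) := by
  rw [classSize_eq, ← encard_Iic]
  congr 1
  ext j; simp [infSet, hc, hQ]

/-- The cutoffs match: an even class `c ≤ 2 * R + 2` has positions at most `R + 1`, so it survives
untruncated. -/
theorem classSize_finSet_even {Q : Set ℕ} {R c : ℕ} (hc : c % 2 = 0) (hQ : c / 2 ∈ Q)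
    (hcR : c ≤ 2 * R + 2) : classSize (finSet Q R) c = (c / 2 + 1 : ℕ) := by
  rw [classSize_eq, ← encard_Iic]
  congr 1
  ext j
  simp only [finSet, infSet, Set.mem_ofPred_eq, Nat.unpair_pair, hc, zero_ne_one, hQ, hcR,
    Set.mem_Iic, true_and, false_or]
  omega

theorem classSize_infSet_zero {Q : Set ℕ} {c : ℕ} (hc : c % 2 = 0) (hQ : c / 2 ∉ Q) :
    classSize (infSet Q) c = 0 := by
  rw [classSize_eq, Set.encard_eq_zero]
  ext j; simp [infSet, hc, hQ]

theorem classSize_finSet_zero {Q : Set ℕ} {R c : ℕ} (hc : c % 2 = 0 ∧ c / 2 ∉ Q ∨ 2 * R + 2 < c) :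
    classSize (finSet Q R) c = 0 := by
  rw [classSize_eq, Set.encard_eq_zero]
  ext j
  simp only [finSet, infSet, Set.mem_ofPred_eq, Nat.unpair_pair, Set.mem_empty_iff_false, iff_false]
  rintro ⟨h1 | h1, h2, h3⟩
  · omega
  · rcases hc with hc | hc
    · exact hc.2 h1.1
    · omega

theorem classSize_infSet_iff {Q : Set ℕ} {c s : ℕ} (hs : s ≠ 0) :
    classSize (infSet Q) c = s ↔ c = 2 * (s - 1) ∧ s - 1 ∈ Q := by
  rcases Nat.mod_two_eq_zero_or_one c with hc | hc
  · by_cases hQ : c / 2 ∈ Q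
    · rw [classSize_infSet_even hc hQ]
      norm_cast
      constructor
      · rintro rfl
        exact ⟨by omega, hQ⟩
      · rintro ⟨rfl, -⟩
        omega
    · rw [classSize_infSet_zero hc hQ]
      constructor
      · intro h
        exact absurd (by exact_mod_cast h.symm) hs
      · rintro ⟨rfl, h⟩
        rw [Nat.mul_div_cancel_left _ two_pos] at hQ
        exact absurd h hQ
  · rw [classSize_infSet_odd hc]
    exact iff_of_false (by simp) (by omega)

/-- The restriction `s ≤ R` keeps truncated odd classes apart from the genuinely small ones; at size
`R + 2` the two kinds could coincide. -/
theorem classSize_finSet_iff {Q : Set ℕ} {R c s : ℕ} (hs : s ≠ 0) (hsR : s ≤ R) :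
    classSize (finSet Q R) c = s ↔ c = 2 * (s - 1) ∧ s - 1 ∈ Q := by
  by_cases hcR : c ≤ 2 * R + 2
  · rcases Nat.mod_two_eq_zero_or_one c with hc | hc
    · by_cases hQ : c / 2 ∈ Q
      · rw [classSize_finSet_even hc hQ hcR]
        norm_cast
        constructor
        · rintro rfl
          exact ⟨by omega, hQ⟩
        · rintro ⟨rfl, -⟩
          omega
      · rw [classSize_finSet_zero (Or.inl ⟨hc, hQ⟩)]
        constructor
        · intro h
          exact absurd (by exact_mod_cast h.symm) hs
        · rintro ⟨rfl, h⟩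
          rw [Nat.mul_div_cancel_left _ two_pos] at hQ
          exact absurd h hQ
    · rw [classSize_finSet_odd hc hcR]
      refine iff_of_false ?_ (by omega)
      norm_cast
      omega
  · rw [classSize_finSet_zero (Or.inr (by omega))]
    refine iff_of_false (fun h => ?_) (by omega)
    exact absurd (by exact_mod_cast h.symm) hs

theorem exists_odd_notMem {F : Finset ℕ} {R : ℕ} (hF : F.card < R) :
    ∃ i < R, 2 * i + 1 ∉ F := by
  have hcard : F.card < ((Finset.range R).image fun i => 2 * i + 1).card := by
    rw [Finset.card_image_of_injective _ fun i j h => by simpa using h, Finset.card_range]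
    exact hF
  obtain ⟨c, hc, hcF⟩ := Finset.exists_mem_notMem_of_card_lt_card hcard
  obtain ⟨i, hi, rfl⟩ := Finset.mem_image.1 hc
  exact ⟨i, Finset.mem_range.1 hi, hcF⟩

/-- The infinite model and its finite approximation are similar. -/
theorem similar_infSet_finSet {Q P : Set ℕ} {R : ℕ} (h : ∀ i < R, i ∈ P ↔ i ∈ Q) :
    Similar R (infSet Q) (finSet P R) := by
  refine ⟨⟨fun s _ hs0 c c' h1 h2 => ?_, fun F hF => ?_⟩,
    ⟨fun s hsR hs0 c c' h1 h2 => ?_, fun F hF => ?_⟩, fun s hsR hs0 => ?_⟩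
  · rw [classSize_infSet_iff hs0] at h1 h2
    rw [h1.1, h2.1]
  · obtain ⟨i, -, hi⟩ := exists_odd_notMem hF
    refine ⟨_, hi, ?_⟩
    rw [classSize_infSet_odd (by omega)]
    exact ENat.natCast_lt_top R
  · rw [classSize_finSet_iff hs0 hsR] at h1 h2
    rw [h1.1, h2.1]
  · obtain ⟨i, hiR, hi⟩ := exists_odd_notMem hF
    refine ⟨_, hi, ?_⟩
    rw [classSize_finSet_odd (by omega) (by omega)]
    norm_cast
    omega
  · simp only [classSize_infSet_iff hs0, classSize_finSet_iff hs0 hsR, exists_eq_left]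
    -- Size `s` is governed by the index `s - 1`, which is below `R`, where the two sets agree.
    rw [h (s - 1) (by omega)]

theorem infSet_models_sentA {Q : Set ℕ} {n : ℕ} : EqStr (infSet Q) ⊨ sentA n ↔ n ∈ Q := by
  rw [realize_sentA]
  constructor
  · rintro ⟨x, hx⟩
    simpa using ((classSize_infSet_iff (Nat.succ_ne_zero n)).1 hx).2
  · intro hn
    have h : classSize (infSet Q) (2 * n) = (n + 1 : ℕ) :=
      (classSize_infSet_iff (Nat.succ_ne_zero n)).2 ⟨by simp, by simpa using hn⟩
    obtain ⟨x, hx⟩ := exists_of_classSize_ne_zero (S := infSet Q) (c := 2 * n)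
      (by rw [h]; exact_mod_cast Nat.succ_ne_zero n)
    exact ⟨x, by rw [hx, h]⟩

theorem infSet_models_theoryJ (Q : Set ℕ) : EqStr (infSet Q) ⊨ theoryJ := by
  refine (Theory.model_iff _).2 fun φ hφ => ?_
  rcases hφ with (hφ | ⟨n, rfl⟩) | ⟨n, rfl⟩
  · have h := realize_equivalence (S := infSet Q)
    rcases hφ with rfl | rfl | rfl
    exacts [h.1, h.2.1, h.2.2]
  · refine realize_atMostOneClass.2 fun x y hx hy => ?_
    have hn : n ≠ 0 := by
      rintro rfl
      exact classSize_cls_ne_zero x (by simpa using hx)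
    rw [classSize_infSet_iff hn] at hx hy
    rw [hx.1, hy.1]
  · refine realize_manyLargeClasses.2
      ⟨fun i => ⟨Nat.pair (2 * i + 1) 0, Or.inl (by simp)⟩, fun i => ?_, fun i j hij => ?_⟩
    · rw [classSize_infSet_odd (by simp [EqStr.cls])]
      exact le_top
    · simp only [EqStr.cls, Nat.unpair_pair] at hij
      exact Fin.ext (by omega)

instance (Q : Set ℕ) : Nonempty (EqStr (infSet Q)) :=
  ⟨⟨Nat.pair 1 0, Or.inl (by simp)⟩⟩

/-! ### From consistent theories to canonical models -/

/-- Models of the same sentences `Aₙ`, `n ∈ X`, agree on boolean combinations of them. -/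
theorem IsBoolComb.realize_iff {X : Set ℕ} {φ : sigE.lang.Sentence} (h : IsBoolComb X φ)
    {M N : Type} [sigE.lang.Structure M] [sigE.lang.Structure N]
    (hMN : ∀ n ∈ X, M ⊨ EssUndec.sentA n ↔ N ⊨ EssUndec.sentA n) : M ⊨ φ ↔ N ⊨ φ := by
  induction h with
  | sentA n hn => exact hMN n hn
  | falsum => exact Iff.rfl
  | imp φ ψ _ _ h1 h2 => exact imp_congr h1 h2

/-- A consistent theory over `J` and `X` has a model whose finite classes have sizes in `X + 1`. -/
theorem IsJTheory.exists_model {X : Set ℕ} {T : sigE.lang.Theory} (hT : IsJTheory X T)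
    (hsat : T.IsSatisfiable) : ∃ Q ⊆ X, EqStr (infSet Q) ⊨ T := by
  obtain ⟨Γ, hΓ, rfl⟩ := hT
  obtain ⟨M⟩ := hsat
  -- Sizes with index outside `X` are simply dropped; the axioms added to `J` do not mention them.
  refine ⟨{n | n ∈ X ∧ M ⊨ sentA n}, fun n hn => hn.1, (Theory.model_iff _).2 fun φ hφ => ?_⟩
  rcases hφ with hφ | hφ
  · exact (Theory.model_iff _).1 (infSet_models_theoryJ _) φ hφ
  · refine ((hΓ φ hφ).realize_iff fun n hn => ?_).2
      ((Theory.model_iff _).1 M.is_model φ (Or.inr hφ))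
    rw [infSet_models_sentA]
    exact and_iff_right hn

/-! ## The semantics of a translation -/

namespace Translation

variable {L₁ L₂ : FirstOrder.Language.{0, 0}} (τ : Translation L₁ L₂)
variable {N : Type} [L₂.Structure N] (p : Fin τ.params → N)

/-- The tuple `x` belongs to the domain. -/
def Dom (x : τ.Tuple N) : Prop := (τ.dom x.1).Realize (Sum.elim p x.2)

/-- The tuples `z` satisfy the translation `P` of an atomic formula. -/
def Holds {k : ℕ}
    (P : ∀ ρ : Fin k → Fin τ.pieces, L₂.Formula (Fin τ.params ⊕ Σ m, Fin (τ.dim (ρ m))))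
    (z : Fin k → τ.Tuple N) : Prop :=
  (P fun m => (z m).1).Realize (Sum.elim p fun l => (z l.1).2 l.2)

/-- The tuple `y` is a value of the function `f` at `z`. -/
def Graph {k : ℕ} (f : L₁.Functions k) (z : Fin k → τ.Tuple N) (y : τ.Tuple N) : Prop :=
  (τ.func f (fun m => (z m).1) y.1).Realize (Sum.elim p (Sum.elim (fun l => (z l.1).2 l.2) y.2))

/-- The tuple `y` is a value of a term. -/
def Val {n : ℕ} : L₁.Term (Empty ⊕ Fin n) → (Fin n → τ.Tuple N) → τ.Tuple N → Prop
  | .var (.inl x), _, _ => x.elim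
  | .var (.inr x), σ, y => y = σ x
  | .func f ts, σ, y => ∃ z : Fin _ → τ.Tuple N, (∀ m, τ.Dom p (z m)) ∧
      (∀ m, Val (ts m) σ (z m)) ∧ τ.Graph p f z y

/-- The truth of the translation of a formula. -/
def Tr : ∀ {n : ℕ}, L₁.BoundedFormula Empty n → (Fin n → τ.Tuple N) → Prop
  | _, .falsum, _ => False
  | _, .equal t u, σ => ∃ z : Fin 2 → τ.Tuple N, (∀ m, τ.Dom p (z m)) ∧
      (∀ m, τ.Val p (![t, u] m) σ (z m)) ∧ τ.Holds p τ.eq z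
  | _, .rel R ts, σ => ∃ z : Fin _ → τ.Tuple N, (∀ m, τ.Dom p (z m)) ∧
      (∀ m, τ.Val p (ts m) σ (z m)) ∧ τ.Holds p (τ.rel R) z
  | _, .imp φ ψ, σ => Tr φ σ → Tr ψ σ
  | _, .all φ, σ => ∀ x, τ.Dom p x → Tr φ (Fin.snoc σ x)

variable {p}

/-- A choice of pieces followed by a choice of coordinates is the same as a choice of tuples. From
here on, pieces and dimensions stay hidden in `Tuple`. -/
theorem realize_existsTuples {X : Type} {q : Fin τ.params → X} {n : ℕ}
    {body : ∀ ρ : Fin n → Fin τ.pieces, L₂.Formula (X ⊕ Σ m, Fin (τ.dim (ρ m)))} {v : X → N} :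
    (τ.existsTuples q n body).Realize v ↔ ∃ z : Fin n → τ.Tuple N,
      (∀ m, τ.Dom (v ∘ q) (z m)) ∧
        (body fun m => (z m).1).Realize (Sum.elim v fun l => (z l.1).2 l.2) := by
  have key : ∀ (ρ : Fin n → Fin τ.pieces) (a : (Σ m, Fin (τ.dim (ρ m))) → N) (m : Fin n),
      Sum.elim v a ∘ Sum.elim (Sum.inl ∘ q) (fun l => Sum.inr ⟨m, l⟩) =
        Sum.elim (v ∘ q) fun l => a ⟨m, l⟩ := fun ρ a m => by
    funext i
    rcases i with i | i <;> rfl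
  simp only [existsTuples, Formula.realize_iSup, Formula.realize_iExs, Formula.realize_inf,
    Formula.realize_iInf, Formula.realize_relabel, key]
  constructor
  · rintro ⟨ρ, a, h1, h2⟩
    exact ⟨fun m => ⟨ρ m, fun l => a ⟨m, l⟩⟩, h1, h2⟩
  · rintro ⟨z, h1, h2⟩
    exact ⟨fun m => (z m).1, fun l => (z l.1).2 l.2, h1, h2⟩

theorem realize_value {n : ℕ} (t : L₁.Term (Empty ⊕ Fin n)) :
    ∀ {X : Type} (q : Fin τ.params → X) (σ : Fin n → τ.Tuple X) (j : Fin τ.pieces)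
      (y : Fin (τ.dim j) → X) (v : X → N), (τ.value t q σ j y).Realize v ↔
        τ.Val (v ∘ q) t (fun x => (σ x).map v) ⟨j, v ∘ y⟩ := by
  induction t with
  | var x =>
    intro X q σ j y v
    rcases x with x | x
    · exact x.elim
    -- Replacing `σ x` by an arbitrary tuple allows the equality of pieces to be eliminated by
    -- substitution, which disposes of the cast.
    · have key : ∀ s : τ.Tuple X, (if h : s.1 = j then
          Formula.iInf fun l : Fin (τ.dim j) =>
            Term.equal (L := L₂) (Term.var (y l)) (Term.var (s.2 (l.cast (by rw [h]))))
          else ⊥).Realize v ↔ (⟨j, v ∘ y⟩ : τ.Tuple N) = s.map v := ?_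
      · simp only [value, Val]
        exact key (σ x)
      rintro ⟨i, a⟩
      split_ifs with h
      · dsimp only at h
        subst h
        simp only [Formula.realize_iInf, Formula.realize_equal, Term.realize_var, Tuple.map,
          Sigma.mk.injEq, heq_eq_eq, true_and, funext_iff]
        rfl
      · refine iff_of_false id fun h' => h ?_
        simp only [Tuple.map, Sigma.mk.injEq] at h'
        exact h'.1.symm
  | func f ts ih =>
    intro X q σ j y v
    simp only [value, Val, realize_existsTuples, Formula.realize_inf, Formula.realize_iInf, ih,
      Formula.realize_relabel]
    refine exists_congr fun z => and_congr_right fun _ => and_congr (forall_congr' fun m => ?_) ?_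
    · rfl
    · rw [Graph]
      refine iff_of_eq (congrArg _ ?_)
      funext i
      rcases i with i | i | i <;> rfl

theorem realize_atomic {n k : ℕ} {X : Type} (q : Fin τ.params → X) (σ : Fin n → τ.Tuple X)
    (P : ∀ ρ : Fin k → Fin τ.pieces, L₂.Formula (Fin τ.params ⊕ Σ m, Fin (τ.dim (ρ m))))
    (ts : Fin k → L₁.Term (Empty ⊕ Fin n)) (v : X → N) :
    (τ.atomic q σ P ts).Realize v ↔ ∃ z : Fin k → τ.Tuple N, (∀ m, τ.Dom (v ∘ q) (z m)) ∧
      (∀ m, τ.Val (v ∘ q) (ts m) (fun x => (σ x).map v) (z m)) ∧ τ.Holds (v ∘ q) P z := by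
  simp only [atomic, realize_existsTuples, Formula.realize_inf, Formula.realize_iInf,
    realize_value, Formula.realize_relabel]
  refine exists_congr fun z => and_congr_right fun _ => and_congr (forall_congr' fun m => ?_) ?_
  · rfl
  · rw [Holds]
    refine iff_of_eq (congrArg _ ?_)
    funext i
    rcases i with i | i <;> rfl

theorem realize_formula {n : ℕ} (φ : L₁.BoundedFormula Empty n) :
    ∀ {X : Type} (q : Fin τ.params → X) (σ : Fin n → τ.Tuple X) (v : X → N),
      (τ.formula φ q σ).Realize v ↔ τ.Tr (v ∘ q) φ fun x => (σ x).map v := by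
  induction φ with
  | falsum => intro X q σ v; exact Iff.rfl
  | equal t u => intro X q σ v; exact τ.realize_atomic q σ _ _ v
  | rel R ts => intro X q σ v; exact τ.realize_atomic q σ _ _ v
  | imp φ ψ h1 h2 =>
    intro X q σ v
    simp only [formula, Tr, Formula.realize_imp, h1, h2]
  | all φ ih =>
    intro X q σ v
    simp only [formula, Tr, Formula.realize_iInf, Formula.realize_iAlls, Formula.realize_imp, ih,
      Formula.realize_relabel]
    have key : ∀ (i : Fin τ.pieces) (a : Fin (τ.dim i) → N),
        (fun x => ((Fin.snoc (α := fun _ => τ.Tuple (X ⊕ Fin (τ.dim i)))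
          (fun x => (σ x).map Sum.inl) ⟨i, Sum.inr⟩ x).map (Sum.elim v a))) =
        Fin.snoc (α := fun _ => τ.Tuple N) (fun x => (σ x).map v) ⟨i, a⟩ := fun i a => by
      funext x
      refine Fin.lastCases ?_ (fun x => ?_) x
      · simp only [Fin.snoc_last]
        rfl
      · simp only [Fin.snoc_castSucc]
        rfl
    have hdom : ∀ (i : Fin τ.pieces) (a : Fin (τ.dim i) → N),
        (fun x => Sum.elim v a x) ∘ Sum.map q id = Sum.elim (v ∘ q) a := fun i a => by
      funext x
      rcases x with x | x <;> rfl
    constructor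
    · rintro h ⟨i, a⟩ ha
      have := h i a ?_
      · rw [← key]
        exact this
      · exact (iff_of_eq (congrArg _ (hdom i a))).2 ha
    · rintro h i a ha
      have := h ⟨i, a⟩ ((iff_of_eq (congrArg _ (hdom i a))).1 ha)
      rw [← key] at this
      exact this

theorem realize_sentence {φ : L₁.Sentence} :
    N ⊨ τ.sentence φ ↔ ∀ p : Fin τ.params → N, τ.paramDom.Realize p →
      τ.Tr p φ (Fin.elim0 : Fin 0 → τ.Tuple N) := by
  simp only [Sentence.Realize, sentence, Formula.realize_iAlls, Formula.realize_imp,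
    Formula.realize_relabel, realize_formula]
  refine forall_congr' fun p => imp_congr Iff.rfl (iff_of_eq ?_)
  congr 1
  exact Subsingleton.elim _ _

theorem realize_existsParams :
    N ⊨ τ.existsParams ↔ ∃ p : Fin τ.params → N, τ.paramDom.Realize p := by
  simp only [Sentence.Realize, existsParams, Formula.realize_iExs, Formula.realize_relabel]
  rfl

variable (p)

/-- The translated identity. -/
def Eqv (x y : τ.Tuple N) : Prop := τ.Holds p τ.eq ![x, y]

variable {τ p}

/-- If a structure `A` is the image of the domain under a map `π` that respects the translations of
identity, relations and functions, then the translation expresses truth in `A`. -/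
structure Represents (A : Type) [L₁.Structure A] (π : τ.Tuple N → A) : Prop where
  surj : ∀ a, ∃ x, τ.Dom p x ∧ π x = a
  eq : ∀ x y, τ.Dom p x → τ.Dom p y → (τ.Eqv p x y ↔ π x = π y)
  rel : ∀ {k : ℕ} (R : L₁.Relations k) (z : Fin k → τ.Tuple N), (∀ m, τ.Dom p (z m)) →
    (τ.Holds p (τ.rel R) z ↔ Structure.RelMap R fun m => π (z m))
  total : ∀ {k : ℕ} (f : L₁.Functions k) (z : Fin k → τ.Tuple N), (∀ m, τ.Dom p (z m)) →
    ∃ y, τ.Dom p y ∧ τ.Graph p f z y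
  func : ∀ {k : ℕ} (f : L₁.Functions k) (z : Fin k → τ.Tuple N), (∀ m, τ.Dom p (z m)) →
    ∀ y, τ.Dom p y → τ.Graph p f z y → π y = Structure.funMap f fun m => π (z m)

namespace Represents

variable {A : Type} [L₁.Structure A] {π : τ.Tuple N → A}

/-- A term may have several values, equivalent but distinct as tuples. The induction therefore
carries both the existence of a value and the image under `π` of every value. -/
theorem val (h : Represents (p := p) A π) {n : ℕ} (t : L₁.Term (Empty ⊕ Fin n))
    {σ : Fin n → τ.Tuple N} (hσ : ∀ x, τ.Dom p (σ x)) :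
    (∃ y, τ.Dom p y ∧ τ.Val p t σ y) ∧ ∀ y, τ.Dom p y → τ.Val p t σ y →
      π y = t.realize (Sum.elim (default : Empty → A) fun x => π (σ x)) := by
  induction t with
  | var x =>
    rcases x with x | x
    · exact x.elim
    · exact ⟨⟨σ x, hσ x, rfl⟩, fun y _ hy => congrArg π hy⟩
  | func f ts ih =>
    constructor
    · choose z hz hz' using fun m => (ih m).1
      obtain ⟨y, hy, hy'⟩ := h.total f z hz
      exact ⟨y, hy, z, hz, hz', hy'⟩
    · rintro y hy ⟨z, hz, hz', hy'⟩
      rw [h.func f z hz y hy hy', Term.realize_func]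
      congr 1
      funext m
      exact (ih m).2 _ (hz m) (hz' m)

theorem holds (h : Represents (p := p) A π) {n k : ℕ} {ts : Fin k → L₁.Term (Empty ⊕ Fin n)}
    {P : (Fin k → τ.Tuple N) → Prop} {Q : (Fin k → A) → Prop}
    (hPQ : ∀ z, (∀ m, τ.Dom p (z m)) → (P z ↔ Q fun m => π (z m)))
    {σ : Fin n → τ.Tuple N} (hσ : ∀ x, τ.Dom p (σ x)) :
    (∃ z : Fin k → τ.Tuple N, (∀ m, τ.Dom p (z m)) ∧ (∀ m, τ.Val p (ts m) σ (z m)) ∧ P z) ↔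
      Q fun m => (ts m).realize (Sum.elim (default : Empty → A) fun x => π (σ x)) := by
  have key : ∀ z : Fin k → τ.Tuple N, (∀ m, τ.Dom p (z m)) → (∀ m, τ.Val p (ts m) σ (z m)) →
      (P z ↔ Q fun m => (ts m).realize (Sum.elim (default : Empty → A) fun x => π (σ x))) :=
    fun z hz hz' => by
      rw [hPQ z hz]
      refine iff_of_eq (congrArg Q ?_)
      funext m
      exact (h.val (ts m) hσ).2 _ (hz m) (hz' m)
  constructor
  · rintro ⟨z, hz, hz', hP⟩
    exact (key z hz hz').1 hP
  · intro hQ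
    choose z hz hz' using fun m => (h.val (ts m) hσ).1
    exact ⟨z, hz, hz', (key z hz hz').2 hQ⟩

/-- Atoms reduce to the clauses for identity and relations, and quantifiers transfer because `π`
maps the domain onto `A`. -/
theorem tr_iff (h : Represents (p := p) A π) {n : ℕ} (φ : L₁.BoundedFormula Empty n) :
    ∀ {σ : Fin n → τ.Tuple N}, (∀ x, τ.Dom p (σ x)) →
      (τ.Tr p φ σ ↔ φ.Realize default fun x => π (σ x)) := by
  induction φ with
  | falsum => intro σ _; exact Iff.rfl
  | equal t u =>
    intro σ hσ
    refine h.holds (ts := ![t, u]) (Q := fun a => a 0 = a 1) (fun z hz => ?_) hσ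
    rw [← h.eq _ _ (hz 0) (hz 1), Eqv]
    refine iff_of_eq (congrArg _ ?_)
    funext m
    fin_cases m <;> rfl
  | rel R ts =>
    intro σ hσ
    exact h.holds (Q := fun a => Structure.RelMap R a) (fun z hz => h.rel R z hz) hσ
  | imp φ ψ h1 h2 =>
    intro σ hσ
    rw [BoundedFormula.realize_imp, ← h1 hσ, ← h2 hσ]
    rfl
  | all φ ih =>
    intro σ hσ
    have key : ∀ x, τ.Dom p x → (τ.Tr p φ (Fin.snoc σ x : Fin _ → τ.Tuple N) ↔
        φ.Realize default (Fin.snoc (fun x => π (σ x)) (π x) : Fin _ → A)) := fun x hx => by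
      have h1 : ∀ i, τ.Dom p ((Fin.snoc σ x : Fin _ → τ.Tuple N) i) := fun i => by
        refine Fin.lastCases ?_ (fun i => ?_) i
        · simpa using hx
        · simpa using hσ i
      rw [ih h1]
      refine iff_of_eq (congrArg _ ?_)
      funext i
      refine Fin.lastCases ?_ (fun i => ?_) i <;> simp
    rw [BoundedFormula.realize_all]
    constructor
    · intro hall a
      obtain ⟨x, hx, rfl⟩ := h.surj a
      exact (key x hx).1 (hall x hx)
    · intro hall x hx
      exact (key x hx).2 (hall (π x))

end Represents

end Translation

/-! ## The logical axioms of identity and their translations -/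

section IdentityAxioms

variable {L : FirstOrder.Language.{0, 0}}

/-- The implication from a list of hypotheses. -/
def imps {n : ℕ} (l : List (L.BoundedFormula Empty n)) (ψ : L.BoundedFormula Empty n) :
    L.BoundedFormula Empty n :=
  l.foldr BoundedFormula.imp ψ

/-- The equation between two variables. -/
def varEq {n : ℕ} (x y : Fin n) : L.BoundedFormula Empty n :=
  .equal (Term.var (Sum.inr x)) (Term.var (Sum.inr y))

/-- The equation `f x⃗ = y`. -/
def funEq {n k : ℕ} (f : L.Functions k) (x : Fin k → Fin n) (y : Fin n) :
    L.BoundedFormula Empty n :=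
  .equal (Term.func f fun i => Term.var (Sum.inr (x i))) (Term.var (Sum.inr y))

/-- A relation symbol applied to variables. -/
def varRel {n k : ℕ} (R : L.Relations k) (x : Fin k → Fin n) : L.BoundedFormula Empty n :=
  .rel R fun i => Term.var (Sum.inr (x i))

/-- There is an element. -/
def existsAxiom : L.Sentence := (BoundedFormula.all (n := 0) .falsum).imp .falsum

/-- Identity is reflexive. -/
def eqReflAxiom : L.Sentence := (varEq (n := 1) 0 0).alls

/-- Identity is symmetric. -/
def eqSymmAxiom : L.Sentence := ((varEq (n := 2) 0 1).imp (varEq 1 0)).alls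

/-- Identity is transitive. -/
def eqTransAxiom : L.Sentence :=
  ((varEq (n := 3) 0 1).imp ((varEq 1 2).imp (varEq 0 2))).alls

/-- Identity is a congruence for a relation. -/
def relCongrAxiom {k : ℕ} (R : L.Relations k) : L.Sentence :=
  (imps ((List.finRange k).map fun i => varEq (n := k + k) (Fin.castAdd k i) (Fin.natAdd k i))
    ((varRel R (Fin.castAdd k)).imp (varRel R (Fin.natAdd k)))).alls

/-- A function is total. -/
def funTotalAxiom {k : ℕ} (f : L.Functions k) : L.Sentence :=
  (BoundedFormula.imp (.all ((funEq (n := k + 1) f Fin.castSucc (Fin.last k)).imp .falsum))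
    .falsum).alls

/-- Identity is a congruence for a function. -/
def funCongrAxiom {k : ℕ} (f : L.Functions k) : L.Sentence :=
  (imps ((List.finRange k).map fun i =>
      varEq (n := k + k + 2) (Fin.castAdd 2 (Fin.castAdd k i)) (Fin.castAdd 2 (Fin.natAdd k i)))
    ((funEq f (fun i => Fin.castAdd 2 (Fin.castAdd k i)) (Fin.natAdd (k + k) 0)).imp
      ((funEq f (fun i => Fin.castAdd 2 (Fin.natAdd k i)) (Fin.natAdd (k + k) 1)).imp
        (varEq (Fin.natAdd (k + k) 0) (Fin.natAdd (k + k) 1))))).alls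

variable (L) in
/-- The axioms of identity. -/
def identityAxioms : L.Theory :=
  {existsAxiom, eqReflAxiom, eqSymmAxiom, eqTransAxiom} ∪
    Set.range (fun R : Σ k, L.Relations k => relCongrAxiom R.2) ∪
    Set.range (fun f : Σ k, L.Functions k => funTotalAxiom f.2) ∪
    Set.range (fun f : Σ k, L.Functions k => funCongrAxiom f.2)

/-- Finiteness yields a single level above which all translated identity axioms pass from the
infinite model to its approximations. -/
theorem finite_identityAxioms (s : Signature) : (identityAxioms s.lang).Finite := by
  have h1 : Finite (Σ k, s.lang.Relations k) :=
    Finite.of_injective (β := Fin s.2.length) (fun R => R.2.1) <| by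
      rintro ⟨k, i, rfl⟩ ⟨l, j, rfl⟩ h
      obtain rfl : i = j := h
      rfl
  have h2 : Finite (Σ k, s.lang.Functions k) :=
    Finite.of_injective (β := Fin s.1.length) (fun R => R.2.1) <| by
      rintro ⟨k, i, rfl⟩ ⟨l, j, rfl⟩ h
      obtain rfl : i = j := h
      rfl
  refine Set.Finite.union (Set.Finite.union (Set.Finite.union ?_ (Set.finite_range _))
    (Set.finite_range _)) (Set.finite_range _)
  exact Set.toFinite _

section Realize
variable {A : Type*} [L.Structure A]

theorem realize_imps {n : ℕ} {l : List (L.BoundedFormula Empty n)} {ψ : L.BoundedFormula Empty n}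
    {v : Empty → A} {xs : Fin n → A} :
    (imps l ψ).Realize v xs ↔ ((∀ φ ∈ l, φ.Realize v xs) → ψ.Realize v xs) := by
  induction l with
  | nil => simp [imps]
  | cons a l ih =>
    have : (imps (a :: l) ψ) = a.imp (imps l ψ) := rfl
    rw [this, BoundedFormula.realize_imp, ih]
    simp

theorem realize_varEq {n : ℕ} {x y : Fin n} {v : Empty → A} {xs : Fin n → A} :
    (varEq (L := L) x y).Realize v xs ↔ xs x = xs y := Iff.rfl

theorem realize_funEq {n k : ℕ} {f : L.Functions k} {x : Fin k → Fin n} {y : Fin n}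
    {v : Empty → A} {xs : Fin n → A} :
    (funEq f x y).Realize v xs ↔ Structure.funMap f (fun i => xs (x i)) = xs y := Iff.rfl

theorem realize_varRel {n k : ℕ} {R : L.Relations k} {x : Fin k → Fin n}
    {v : Empty → A} {xs : Fin n → A} :
    (varRel R x).Realize v xs ↔ Structure.RelMap R (fun i => xs (x i)) := Iff.rfl

/-- These sentences are logically valid, hence theorems of every theory. An interpretation must
therefore validate their translations, although it is free in how it translates identity and
functions. -/
theorem realize_identityAxioms [Nonempty A] {φ : L.Sentence} (h : φ ∈ identityAxioms L) :
    A ⊨ φ := by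
  rcases h with ((h | ⟨⟨k, R⟩, rfl⟩) | ⟨⟨k, f⟩, rfl⟩) | ⟨⟨k, f⟩, rfl⟩
  · rcases h with rfl | rfl | rfl | rfl
    · intro h
      exact h (Classical.arbitrary A)
    · refine BoundedFormula.realize_alls.2 fun xs => ?_
      exact rfl
    · refine BoundedFormula.realize_alls.2 fun xs => ?_
      exact Eq.symm
    · refine BoundedFormula.realize_alls.2 fun xs => ?_
      exact Eq.trans
  · refine BoundedFormula.realize_alls.2 fun xs => ?_
    rw [realize_imps, BoundedFormula.realize_imp, realize_varRel, realize_varRel]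
    intro h h'
    rw [show (fun i => xs (Fin.natAdd k i)) = fun i => xs (Fin.castAdd k i) from
      funext fun i => (h _ (List.mem_map.2 ⟨i, List.mem_finRange i, rfl⟩)).symm]
    exact h'
  · refine BoundedFormula.realize_alls.2 fun xs => ?_
    intro h
    refine h (Structure.funMap f xs) ?_
    refine realize_funEq.2 ?_
    rw [Fin.snoc_last]
    congr 1
    funext i
    exact Fin.snoc_castSucc (α := fun _ => A) _ _ _
  · refine BoundedFormula.realize_alls.2 fun xs => ?_
    rw [realize_imps, BoundedFormula.realize_imp, BoundedFormula.realize_imp, realize_funEq,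
      realize_funEq, realize_varEq]
    intro h h1 h2
    rw [← h1, ← h2]
    congr 1
    funext i
    exact h _ (List.mem_map.2 ⟨i, List.mem_finRange i, rfl⟩)

end Realize

end IdentityAxioms

namespace Translation

variable {L₁ L₂ : FirstOrder.Language.{0, 0}} {τ : Translation L₁ L₂}
variable {N : Type} [L₂.Structure N] {p : Fin τ.params → N}

theorem tr_alls {n : ℕ} {φ : L₁.BoundedFormula Empty n} :
    τ.Tr p φ.alls (Fin.elim0 : Fin 0 → τ.Tuple N) ↔
      ∀ σ : Fin n → τ.Tuple N, (∀ x, τ.Dom p (σ x)) → τ.Tr p φ σ := by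
  induction n with
  | zero =>
    constructor
    · intro h σ _
      rw [Subsingleton.elim σ Fin.elim0]
      exact h
    · intro h
      exact h _ fun x => x.elim0
  | succ n ih =>
    rw [BoundedFormula.alls, ih]
    constructor
    · intro h σ hσ
      have := h (Fin.init σ) (fun x => hσ _) (σ (Fin.last n)) (hσ _)
      rwa [Fin.snoc_init_self] at this
    · intro h σ hσ x hx
      refine h _ fun i => ?_
      refine Fin.lastCases ?_ (fun i => ?_) i
      · simpa using hx
      · simpa using hσ i

theorem tr_imps {n : ℕ} {l : List (L₁.BoundedFormula Empty n)} {ψ : L₁.BoundedFormula Empty n}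
    {σ : Fin n → τ.Tuple N} :
    τ.Tr p (imps l ψ) σ ↔ ((∀ φ ∈ l, τ.Tr p φ σ) → τ.Tr p ψ σ) := by
  induction l with
  | nil => simp [imps]
  | cons a l ih =>
    have : τ.Tr p (imps (a :: l) ψ) σ ↔ (τ.Tr p a σ → τ.Tr p (imps l ψ) σ) := Iff.rfl
    rw [this, ih]
    simp

theorem tr_varEq {n : ℕ} {x y : Fin n} {σ : Fin n → τ.Tuple N} (hσ : ∀ x, τ.Dom p (σ x)) :
    τ.Tr p (varEq x y) σ ↔ τ.Eqv p (σ x) (σ y) := by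
  constructor
  · rintro ⟨z, -, hv, h⟩
    rw [Eqv, show ![σ x, σ y] = z from ?_]
    · exact h
    · funext m
      fin_cases m
      · exact (hv 0).symm
      · exact (hv 1).symm
  · intro h
    refine ⟨![σ x, σ y], fun m => ?_, fun m => ?_, h⟩ <;> fin_cases m
    · exact hσ x
    · exact hσ y
    · exact rfl
    · exact rfl

theorem tr_varRel {n k : ℕ} {R : L₁.Relations k} {x : Fin k → Fin n} {σ : Fin n → τ.Tuple N}
    (hσ : ∀ x, τ.Dom p (σ x)) :
    τ.Tr p (varRel R x) σ ↔ τ.Holds p (τ.rel R) fun i => σ (x i) := by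
  constructor
  · rintro ⟨z, -, hv, h⟩
    rwa [show (fun i => σ (x i)) = z from funext fun m => (hv m).symm]
  · intro h
    exact ⟨_, fun m => hσ _, fun m => rfl, h⟩

/-- The equation passes through translated identity, so the value `w` of the function need only be
equivalent to `σ y`. -/
theorem tr_funEq {n k : ℕ} {f : L₁.Functions k} {x : Fin k → Fin n} {y : Fin n}
    {σ : Fin n → τ.Tuple N} (hσ : ∀ x, τ.Dom p (σ x)) :
    τ.Tr p (funEq f x y) σ ↔
      ∃ w, τ.Dom p w ∧ τ.Graph p f (fun i => σ (x i)) w ∧ τ.Eqv p w (σ y) := by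
  constructor
  · rintro ⟨z, hz, hv, h⟩
    obtain ⟨z', -, hv', h'⟩ := hv 0
    refine ⟨z 0, hz 0, ?_, ?_⟩
    · rwa [show (fun i => σ (x i)) = z' from funext fun m => (hv' m).symm]
    · rw [Eqv, show ![z 0, σ y] = z from ?_]
      · exact h
      · funext m
        fin_cases m
        · rfl
        · exact (hv 1).symm
  · rintro ⟨w, hw, hg, h⟩
    refine ⟨![w, σ y], fun m => ?_, fun m => ?_, h⟩ <;> fin_cases m
    · exact hw
    · exact hσ y
    · exact ⟨_, fun m => hσ _, fun m => rfl, hg⟩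
    · exact rfl

variable (τ p) in
/-- The translations of the axioms of identity hold. -/
structure Sane : Prop where
  nonempty : ∃ x, τ.Dom p x
  refl : ∀ x, τ.Dom p x → τ.Eqv p x x
  symm : ∀ x y, τ.Dom p x → τ.Dom p y → τ.Eqv p x y → τ.Eqv p y x
  trans : ∀ x y z, τ.Dom p x → τ.Dom p y → τ.Dom p z → τ.Eqv p x y → τ.Eqv p y z → τ.Eqv p x z
  rel : ∀ {k : ℕ} (R : L₁.Relations k) (z z' : Fin k → τ.Tuple N), (∀ m, τ.Dom p (z m)) →
    (∀ m, τ.Dom p (z' m)) → (∀ m, τ.Eqv p (z m) (z' m)) → τ.Holds p (τ.rel R) z →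
      τ.Holds p (τ.rel R) z'
  total : ∀ {k : ℕ} (f : L₁.Functions k) (z : Fin k → τ.Tuple N), (∀ m, τ.Dom p (z m)) →
    ∃ y, τ.Dom p y ∧ τ.Graph p f z y
  func : ∀ {k : ℕ} (f : L₁.Functions k) (z z' : Fin k → τ.Tuple N) (y y' : τ.Tuple N),
    (∀ m, τ.Dom p (z m)) → (∀ m, τ.Dom p (z' m)) → τ.Dom p y → τ.Dom p y' →
    (∀ m, τ.Eqv p (z m) (z' m)) → τ.Graph p f z y → τ.Graph p f z' y' → τ.Eqv p y y'

/-- Reading the translated axioms on tuples gives the congruence and totality properties needed to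
form a quotient. -/
theorem sane_of_tr
    (h : ∀ φ ∈ identityAxioms L₁, τ.Tr p φ (Fin.elim0 : Fin 0 → τ.Tuple N)) : τ.Sane p := by
  have hrefl : ∀ x, τ.Dom p x → τ.Eqv p x x := fun x hx =>
    (tr_varEq (n := 1) (x := 0) (y := 0) (fun _ => hx)).1
      (tr_alls.1 (h eqReflAxiom (by simp [identityAxioms])) (fun _ => x) fun _ => hx)
  refine ⟨?_, hrefl, ?_, ?_, ?_, ?_, ?_⟩
  · by_contra! hx
    exact h existsAxiom (by simp [identityAxioms]) fun x hx' => hx x hx'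
  · intro x y hx hy hxy
    have hσ : ∀ i, τ.Dom p (![x, y] i) := Fin.forall_fin_two.2 ⟨hx, hy⟩
    have := tr_alls.1 (h eqSymmAxiom (by simp [identityAxioms])) ![x, y] hσ
    rw [Tr, tr_varEq hσ, tr_varEq hσ] at this
    exact this hxy
  · intro x y z hx hy hz hxy hyz
    have hσ : ∀ i, τ.Dom p (![x, y, z] i) := by
      intro i
      fin_cases i
      exacts [hx, hy, hz]
    have := tr_alls.1 (h eqTransAxiom (by simp [identityAxioms])) ![x, y, z] hσ
    rw [Tr, Tr, tr_varEq hσ, tr_varEq hσ, tr_varEq hσ] at this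
    exact this hxy hyz
  · intro k R z z' hz hz' he hR
    have hσ : ∀ i, τ.Dom p (Fin.append z z' i) := fun i =>
      Fin.addCases (fun i => by simpa using hz i) (fun i => by rw [Fin.append_right]; exact hz' i) i
    have := tr_alls.1 (h (relCongrAxiom R) (Or.inl (Or.inl (Or.inr ⟨⟨k, R⟩, rfl⟩)))) _ hσ
    rw [tr_imps, Tr, tr_varRel hσ, tr_varRel hσ] at this
    simp only [Fin.append_left, Fin.append_right] at this
    refine this (fun φ hφ => ?_) hR
    obtain ⟨i, -, rfl⟩ := List.mem_map.1 hφ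
    rw [tr_varEq hσ]
    simpa only [Fin.append_left, Fin.append_right] using he i
  · intro k f z hz
    have := tr_alls.1 (h (funTotalAxiom f) (Or.inl (Or.inr ⟨⟨k, f⟩, rfl⟩))) z hz
    by_contra! hy
    refine this fun x hx htr => ?_
    have hσ : ∀ i, τ.Dom p ((Fin.snoc z x : Fin _ → τ.Tuple N) i) := fun i => by
      refine Fin.lastCases ?_ (fun i => ?_) i
      · simpa using hx
      · simpa using hz i
    obtain ⟨w, hw, hg, -⟩ := (tr_funEq hσ).1 htr
    simp only [Fin.snoc_castSucc] at hg
    exact hy w hw hg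
  · intro k f z z' y y' hz hz' hy hy' he hg hg'
    have hσ : ∀ i, τ.Dom p (Fin.append (Fin.append z z') ![y, y'] i) := fun i => by
      refine Fin.addCases (fun i => ?_) (fun i => ?_) i
      · rw [Fin.append_left]
        exact Fin.addCases (fun i => by simpa using hz i) (fun i => by rw [Fin.append_right]; exact hz' i) i
      · rw [Fin.append_right]
        fin_cases i
        exacts [hy, hy']
    have := tr_alls.1 (h (funCongrAxiom f) (Or.inr ⟨⟨k, f⟩, rfl⟩)) _ hσ
    rw [tr_imps, Tr, Tr, tr_funEq hσ, tr_funEq hσ, tr_varEq hσ] at this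
    simp only [Fin.append_left, Fin.append_right] at this
    -- The values `y` and `y'` witness their own equations by reflexivity.
    refine this (fun φ hφ => ?_) ⟨y, hy, hg, hrefl y hy⟩ ⟨y', hy', hg', hrefl y' hy'⟩
    obtain ⟨i, -, rfl⟩ := List.mem_map.1 hφ
    rw [tr_varEq hσ]
    simpa only [Fin.append_left, Fin.append_right] using he i

end Translation

/-! ## Finite structures on representatives -/

namespace Translation

variable {s : Signature} {L : FirstOrder.Language.{0, 0}} {τ : Translation s.lang L}
variable {N : Type} [L.Structure N] {p : Fin τ.params → N}

variable (τ p) in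
/-- The finite structure `D` lives on representatives of the classes of translated identity, where
`dec` decodes tuples, and has the translated relations and functions. -/
structure Describes (dec : ℕ → τ.Tuple N) (D : FinStr) : Prop where
  dom : ∀ t ∈ D.dom, τ.Dom p (dec t)
  exists_rep : ∀ x, τ.Dom p x → ∃ t ∈ D.dom, τ.Eqv p (dec t) x
  unique : ∀ t ∈ D.dom, ∀ t' ∈ D.dom, τ.Eqv p (dec t) (dec t') → t = t'
  rel : ∀ {k : ℕ} (R : s.lang.Relations k) (a : Fin k → ℕ), (∀ i, a i ∈ D.dom) →
    (((R.1 : ℕ), List.ofFn a) ∈ D.2.2.1 ↔ τ.Holds p (τ.rel R) fun i => dec (a i))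
  func : ∀ {k : ℕ} (f : s.lang.Functions k) (a : Fin k → ℕ) (y : ℕ), (∀ i, a i ∈ D.dom) →
    y ∈ D.dom → (((f.1 : ℕ), y :: List.ofFn a) ∈ D.2.2.2 ↔
      ∃ z, τ.Dom p z ∧ τ.Graph p f (fun i => dec (a i)) z ∧ τ.Eqv p z (dec y))

theorem Describes.exists_represents {dec : ℕ → τ.Tuple N} {D : FinStr}
    (h : τ.Describes p dec D) (hτ : τ.Sane p) :
    ∃ π : τ.Tuple N → D.Carrier, Represents (p := p) D.Carrier π := by
  classical
  choose! π hπ hπ' using h.exists_rep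
  have key : ∀ x t, τ.Dom p x → t ∈ D.dom → τ.Eqv p (dec t) x → π x = t := fun x t hx ht he =>
    h.unique _ (hπ x hx) _ ht (hτ.trans _ x _ (h.dom _ (hπ x hx)) hx (h.dom t ht) (hπ' x hx)
      (hτ.symm _ _ (h.dom t ht) hx he))
  obtain ⟨x₀, hx₀⟩ := hτ.nonempty
  -- Tuples outside the domain receive an arbitrary value; nothing depends on it.
  let π' : τ.Tuple N → D.Carrier := fun x =>
    if hx : τ.Dom p x then ⟨π x, hπ x hx⟩ else ⟨π x₀, hπ x₀ hx₀⟩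
  have hπ'' : ∀ x, τ.Dom p x → (π' x).1 = π x := fun x hx =>
    congrArg Subtype.val (dif_pos hx)
  have hdom : ∀ x, τ.Dom p x → τ.Dom p (dec (π x)) := fun x hx => h.dom _ (hπ x hx)
  have hsymm : ∀ x, τ.Dom p x → τ.Eqv p x (dec (π x)) := fun x hx =>
    hτ.symm _ _ (hdom x hx) hx (hπ' x hx)
  refine ⟨π', ?_, ?_, ?_, ?_, ?_⟩
  · rintro ⟨t, ht⟩
    refine ⟨dec t, h.dom t ht, Subtype.ext ?_⟩
    rw [hπ'' _ (h.dom t ht)]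
    exact key _ _ (h.dom t ht) ht (hτ.refl _ (h.dom t ht))
  · intro x y hx hy
    refine Iff.trans ?_ Subtype.ext_iff.symm
    rw [hπ'' x hx, hπ'' y hy]
    constructor
    · intro he
      exact (key y _ hy (hπ x hx) (hτ.trans _ x _ (hdom x hx) hx hy (hπ' x hx) he)).symm
    · intro he
      refine hτ.trans _ (dec (π x)) _ hx (hdom x hx) hy (hsymm x hx) ?_
      rw [he]
      exact hπ' y hy
  · intro k R z hz
    have : Structure.RelMap R (fun m => π' (z m)) ↔
        ((R.1 : ℕ), List.ofFn fun i => π (z i)) ∈ D.2.2.1 := by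
      simp only [← fun i => hπ'' _ (hz i)]
      rfl
    rw [this, h.rel R _ fun i => hπ _ (hz i)]
    exact ⟨hτ.rel R _ _ hz (fun m => hdom _ (hz m)) fun m => hsymm _ (hz m),
      hτ.rel R _ _ (fun m => hdom _ (hz m)) hz fun m => hπ' _ (hz m)⟩
  · exact fun f z hz => hτ.total f z hz
  · intro k f z hz y hy hg
    refine Subtype.ext ?_
    rw [hπ'' y hy]
    change _ = D.fval f.1 (List.ofFn fun i => (π' (z i)).1)
    simp only [fun i => hπ'' _ (hz i)]
    -- The recorded values of the function at these representatives are all equal to `π y`, and by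
    -- `hmem` there is one. So the head of the list in `fval` is `π y`, not the default.
    have hall : ∀ y' ∈ D.dom.filter (fun y =>
        ((f.1 : ℕ), y :: List.ofFn fun i => π (z i)) ∈ D.2.2.2),
        y' = π y := by
      intro y' hy'
      rw [List.mem_filter, decide_eq_true_eq] at hy'
      obtain ⟨w, hw, hg', he⟩ := (h.func f _ y' (fun i => hπ _ (hz i)) hy'.1).1 hy'.2
      refine (key y y' hy hy'.1 ?_).symm
      exact hτ.trans _ w _ (h.dom _ hy'.1) hw hy (hτ.symm _ _ hw (h.dom _ hy'.1) he)
        (hτ.func f _ _ _ _ (fun i => hdom _ (hz i)) hz hw hy (fun i => hπ' _ (hz i)) hg' hg)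
    have hmem : π y ∈ D.dom.filter (fun y =>
        ((f.1 : ℕ), y :: List.ofFn fun i => π (z i)) ∈ D.2.2.2) := by
      rw [List.mem_filter, decide_eq_true_eq]
      refine ⟨hπ y hy, (h.func f _ _ (fun i => hπ _ (hz i)) (hπ y hy)).2 ?_⟩
      obtain ⟨w, hw, hg'⟩ := hτ.total f (fun i => dec (π (z i))) fun i => hdom _ (hz i)
      refine ⟨w, hw, hg', hτ.trans _ y _ hw hy (hdom y hy) ?_ (hsymm y hy)⟩
      exact hτ.func f _ _ _ _ (fun i => hdom _ (hz i)) hz hw hy (fun i => hπ' _ (hz i)) hg' hg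
    rw [FinStr.fval]
    generalize D.dom.filter (fun y =>
        ((f.1 : ℕ), y :: List.ofFn fun i => π (z i)) ∈ D.2.2.2) = l
      at hall hmem
    cases l with
    | nil => simp at hmem
    | cons a l => exact (hall a (by simp)).symm

theorem Describes.models_iff {dec : ℕ → τ.Tuple N} {D : FinStr} (h : τ.Describes p dec D)
    (hτ : τ.Sane p) (φ : s.lang.Sentence) :
    D.Carrier ⊨ φ ↔ τ.Tr p φ (Fin.elim0 : Fin 0 → τ.Tuple N) := by
  obtain ⟨π, hπ⟩ := h.exists_represents hτ
  rw [hπ.tr_iff φ fun x => x.elim0]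
  refine iff_of_eq ?_
  rw [Sentence.Realize, Formula.Realize]
  congr 1
  exact Subsingleton.elim _ _

end Translation

/-! ## Primitive recursive truth in finite equivalence structures -/

theorem primrecPred_forall_fin {α : Type*} [Primcodable α] : ∀ {n : ℕ} {q : Fin n → α → Prop},
    (∀ i, PrimrecPred (q i)) → PrimrecPred fun a => ∀ i, q i a
  | 0, q, _ => (Primrec.eq.comp (Primrec.const 0) (Primrec.const 0)).of_eq (p := fun _ : α => 0 = 0)
      fun a => by simp
  | n + 1, q, h => ((h 0).and (primrecPred_forall_fin fun i => h i.succ)).of_eq fun a => by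
    rw [Fin.forall_fin_succ]

theorem primrecPred_exists_finite {α ι : Type*} [Primcodable α] [Finite ι] {q : ι → α → Prop}
    (h : ∀ i, PrimrecPred (q i)) : PrimrecPred fun a => ∃ i, q i a := by
  obtain ⟨n, ⟨e⟩⟩ := Finite.exists_equiv_fin ι
  refine (primrecPred_forall_fin fun i : Fin n => (h (e.symm i)).not).not.of_eq fun a => ?_
  simp only [not_forall, not_not]
  exact ⟨fun ⟨i, hi⟩ => ⟨_, hi⟩, fun ⟨i, hi⟩ => ⟨e i, by simpa using hi⟩⟩

theorem primrecPred_forall_lt {α : Type} [Primcodable α] {f : α → ℕ} {q : α → ℕ → Prop}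
    (hf : Primrec f) (hq : PrimrecPred fun x : α × ℕ => q x.1 x.2) :
    PrimrecPred fun a => ∀ u < f a, q a u := by
  have : PrimrecRel fun (u : ℕ) (a : α) => q a u :=
    hq.comp (f := fun x : ℕ × α => (x.2, x.1)) (Primrec.snd.pair Primrec.fst)
  exact (this.forall_mem_list.comp (Primrec.list_range.comp hf) Primrec.id).of_eq fun a => by simp

theorem primrecPred_exists_lt {α : Type} [Primcodable α] {f : α → ℕ} {q : α → ℕ → Prop}
    (hf : Primrec f) (hq : PrimrecPred fun x : α × ℕ => q x.1 x.2) :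
    PrimrecPred fun a => ∃ u < f a, q a u :=
  (primrecPred_forall_lt (q := fun a u => ¬ q a u) hf hq.not).not.of_eq fun a => by simp

/-- The finite set given by a list of numbers and a bound. -/
def levelSet (x : List ℕ × ℕ) : Set ℕ := finSet {i | i ∈ x.1} x.2

theorem mem_levelSet_primrecPred : PrimrecPred fun y : (List ℕ × ℕ) × ℕ => y.2 ∈ levelSet y.1 := by
  have hu : Primrec fun y : (List ℕ × ℕ) × ℕ => y.2.unpair := Primrec.unpair.comp Primrec.snd
  have h1 := Primrec.fst.comp hu
  have h2 := Primrec.snd.comp hu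
  have hR : Primrec fun y : (List ℕ × ℕ) × ℕ => y.1.2 := Primrec.snd.comp Primrec.fst
  have hh : Primrec fun y : (List ℕ × ℕ) × ℕ => y.2.unpair.1 / 2 :=
    Primrec.nat_div.comp h1 (Primrec.const 2)
  have hm : Primrec fun y : (List ℕ × ℕ) × ℕ => y.2.unpair.1 % 2 :=
    Primrec.nat_mod.comp h1 (Primrec.const 2)
  have hP : PrimrecPred fun y : (List ℕ × ℕ) × ℕ => y.2.unpair.1 / 2 ∈ y.1.1 :=
    FinStr.mem_primrecPred hh (Primrec.fst.comp Primrec.fst)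
  exact ((Primrec.eq.comp hm (Primrec.const 1)).or (hP.and (Primrec.nat_le.comp h2 hh))).and
    ((Primrec.nat_le.comp h1 (Primrec.nat_add.comp
      (Primrec.nat_mul.comp (Primrec.const 2) hR) (Primrec.const 2))).and
      (Primrec.nat_le.comp h2 (Primrec.succ.comp hR)))

/-- A strict upper bound of a finite set. -/
def levelBound (x : List ℕ × ℕ) : ℕ := (2 * x.2 + 3) * (2 * x.2 + 3)

theorem levelBound_primrec : Primrec levelBound := by
  have : Primrec fun x : List ℕ × ℕ => 2 * x.2 + 3 :=
    Primrec.nat_add.comp (Primrec.nat_mul.comp (Primrec.const 2) Primrec.snd) (Primrec.const 3)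
  exact Primrec.nat_mul.comp this this

theorem lt_levelBound {x : List ℕ × ℕ} {u : ℕ} (h : u ∈ levelSet x) : u < levelBound x := by
  obtain ⟨-, h1, h2⟩ := h
  have := Nat.pair_lt_max_add_one_sq u.unpair.1 u.unpair.2
  rw [Nat.pair_unpair, pow_two] at this
  refine this.trans_le (Nat.mul_le_mul ?_ ?_) <;>
    exact Nat.succ_le_succ (max_le h1 (h2.trans (by omega)))

theorem pair_one_zero_mem_levelSet (x : List ℕ × ℕ) : Nat.pair 1 0 ∈ levelSet x := by
  refine ⟨Or.inl ?_, ?_, ?_⟩ <;> simp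

open Classical in
/-- The element of a finite structure that is given by a number. -/
noncomputable def elt (x : List ℕ × ℕ) (u : ℕ) : EqStr (levelSet x) :=
  ⟨if u ∈ levelSet x then u else Nat.pair 1 0, by
    split_ifs with h
    exacts [h, pair_one_zero_mem_levelSet x]⟩

theorem elt_val {x : List ℕ × ℕ} (a : EqStr (levelSet x)) : elt x a.1 = a :=
  Subtype.ext (if_pos a.2)

theorem elt_primrec : Primrec fun y : (List ℕ × ℕ) × ℕ => (elt y.1 y.2).1 := by
  classical
  exact Primrec.ite mem_levelSet_primrecPred Primrec.snd (Primrec.const (Nat.pair 1 0))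

/-- Both the structure and the assignment vary primitive recursively with `a`. This generality lets
the induction pass under a quantifier, which becomes a bounded one because the universe lies below
`levelBound`. -/
theorem realize_primrecPred {X : Type} {n : ℕ} (ψ : sigE.lang.BoundedFormula X n) :
    ∀ {α : Type} [Primcodable α] {x : α → List ℕ × ℕ} {v : X → α → ℕ} {xs : Fin n → α → ℕ},
      Primrec x → (∀ i, Primrec (v i)) → (∀ i, Primrec (xs i)) →
      PrimrecPred fun a => ψ.Realize (fun i => elt (x a) (v i a)) fun i => elt (x a) (xs i a) := by
  have hterm : ∀ {n : ℕ} (t : sigE.lang.Term (X ⊕ Fin n)) {α : Type} [Primcodable α]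
      {x : α → List ℕ × ℕ} {v : X → α → ℕ} {xs : Fin n → α → ℕ},
      Primrec x → (∀ i, Primrec (v i)) → (∀ i, Primrec (xs i)) →
      Primrec fun a => (t.realize (Sum.elim (fun i => elt (x a) (v i a))
        fun i => elt (x a) (xs i a))).1 := by
    intro n t α _ x v xs hx hv hxs
    obtain ⟨i | i, rfl⟩ := exists_var_eq t
    · exact elt_primrec.comp (g := fun a => (x a, v i a)) (hx.pair (hv i))
    · exact elt_primrec.comp (g := fun a => (x a, xs i a)) (hx.pair (hxs i))
  induction ψ with
  | falsum =>
    intro α _ x v xs _ _ _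
    exact (Primrec.eq.comp (Primrec.const 0) (Primrec.const 1)).of_eq (p := fun _ : α => 0 = 1)
      fun a => by simp [BoundedFormula.Realize]
  | equal t u =>
    intro α _ x v xs hx hv hxs
    exact (Primrec.eq.comp (hterm t hx hv hxs) (hterm u hx hv hxs)).of_eq
      fun a => Subtype.ext_iff.symm
  | rel R ts =>
    intro α _ x v xs hx hv hxs
    have hcls := fun i => Primrec.fst.comp (Primrec.unpair.comp (hterm (ts i) hx hv hxs))
    exact primrecPred_forall_fin fun i => primrecPred_forall_fin fun j =>
      Primrec.eq.comp (hcls i) (hcls j)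
  | imp φ ψ h1 h2 =>
    intro α _ x v xs hx hv hxs
    exact ((h1 hx hv hxs).not.or (h2 hx hv hxs)).of_eq fun a => by
      rw [BoundedFormula.realize_imp, imp_iff_not_or]
  | @all n φ ih =>
    intro α _ x v xs hx hv hxs
    -- The quantified element becomes a second coordinate of the parameter. Numbers outside the
    -- universe do no harm, since `elt` sends them to an element.
    have := ih (α := α × ℕ) (x := fun b => x b.1) (v := fun i b => v i b.1)
      (xs := Fin.snoc (α := fun _ => α × ℕ → ℕ) (fun i b => xs i b.1) Prod.snd)
      (hx.comp Primrec.fst) (fun i => (hv i).comp Primrec.fst)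
      (Fin.lastCases (by simpa using Primrec.snd)
        fun i => by simpa using (hxs i).comp Primrec.fst)
    refine (primrecPred_forall_lt (q := fun a u => φ.Realize (fun i => elt (x a) (v i a))
      fun i => elt (x a) (Fin.snoc (α := fun _ => α × ℕ → ℕ) (fun i b => xs i b.1) Prod.snd i (a, u)))
      (levelBound_primrec.comp hx) this).of_eq fun a => ?_
    rw [BoundedFormula.realize_all]
    have key : ∀ u, (fun i => elt (x a) (Fin.snoc (α := fun _ => α × ℕ → ℕ)
        (fun i b => xs i b.1) Prod.snd i (a, u))) =
        (Fin.snoc (fun i => elt (x a) (xs i a)) (elt (x a) u) : Fin (n + 1) → _) := fun u => by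
      funext i
      refine Fin.lastCases ?_ (fun i => ?_) i
      · simp only [Fin.snoc_last]
      · simp only [Fin.snoc_castSucc]
    constructor
    · intro h b
      have := h b.1 (lt_levelBound b.2)
      rwa [key, elt_val] at this
    · intro h u _
      rw [key]
      exact h _

/-! ## Bounded search for coded lists -/

/-- A bound for the codes of lists of length `n` of numbers at most `B`. -/
def listBound (B : ℕ) : ℕ → ℕ
  | 0 => 0
  | n + 1 => Nat.succ (Nat.pair B (listBound B n))

theorem pair_le_pair {a b a' b' : ℕ} (ha : a ≤ a') (hb : b ≤ b') : Nat.pair a b ≤ Nat.pair a' b' := by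
  have h1 : Nat.pair a b ≤ Nat.pair a' b := by
    rcases ha.lt_or_eq with h | rfl
    · exact (Nat.pair_lt_pair_left b h).le
    · exact le_rfl
  have h2 : Nat.pair a' b ≤ Nat.pair a' b' := by
    rcases hb.lt_or_eq with h | rfl
    · exact (Nat.pair_lt_pair_right a' h).le
    · exact le_rfl
  exact h1.trans h2

theorem encode_le_listBound {B n : ℕ} : ∀ {l : List ℕ}, (∀ x ∈ l, x ≤ B) → l.length ≤ n →
    Encodable.encode l ≤ listBound B n := by
  induction n with
  | zero =>
    intro l _ hl
    rw [List.eq_nil_of_length_eq_zero (Nat.le_zero.1 hl)]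
    exact le_rfl
  | succ n ih =>
    intro l h hl
    cases l with
    | nil => exact Nat.zero_le _
    | cons a l =>
      rw [Encodable.encode_list_cons]
      exact Nat.succ_le_succ (pair_le_pair (h a (by simp))
        (ih (fun x hx => h x (List.mem_cons_of_mem a hx)) (Nat.le_of_succ_le_succ hl)))

theorem listBound_primrec (n : ℕ) : Primrec fun B => listBound B n := by
  induction n with
  | zero => exact Primrec.const 0
  | succ n ih => exact Primrec.succ.comp (Primrec₂.natPair.comp Primrec.id ih)

/-- A strict bound for pairs of a number at most `K` and a list of length at most `K` of numbers
at most `B`. -/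
def codeBound (K B : ℕ) : ℕ := Nat.pair K (listBound B K) + 1

theorem pair_encode_lt_codeBound {K B i : ℕ} {l : List ℕ} (hi : i ≤ K) (hl : l.length ≤ K)
    (h : ∀ x ∈ l, x ≤ B) : Nat.pair i (Encodable.encode l) < codeBound K B :=
  Nat.lt_succ_of_le (pair_le_pair hi (encode_le_listBound h hl))

theorem codeBound_primrec (K : ℕ) : Primrec (codeBound K) :=
  Primrec.succ.comp (Primrec₂.natPair.comp (Primrec.const K) (listBound_primrec K))

open Classical in
/-- The values of `g` at the numbers below `n` with the property `q`. -/
noncomputable def select {σ : Type} (n : ℕ) (q : ℕ → Prop) (g : ℕ → σ) : List σ :=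
  (List.range n).filterMap fun u => if q u then some (g u) else none

theorem mem_select {σ : Type} {n : ℕ} {q : ℕ → Prop} {g : ℕ → σ} {b : σ} :
    b ∈ select n q g ↔ ∃ u < n, q u ∧ g u = b := by
  simp [select]

theorem select_primrec {α σ : Type} [Primcodable α] [Primcodable σ] {n : α → ℕ}
    {q : α → ℕ → Prop} {g : α → ℕ → σ} (hn : Primrec n)
    (hq : PrimrecPred fun x : α × ℕ => q x.1 x.2) (hg : Primrec₂ g) :
    Primrec fun a => select (n a) (q a) (g a) := by
  classical
  refine Primrec.listFilterMap (Primrec.list_range.comp hn) ?_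
  exact Primrec.ite hq (Primrec.option_some.comp hg) (Primrec.const none)

/-- The `l`-th entry of the list in a code. -/
def entry (q l : ℕ) : ℕ := (unlist q.unpair.2).getD l 0

theorem entry_primrec {α : Type} [Primcodable α] {q : α → ℕ} (hq : Primrec q) (l : ℕ) :
    Primrec fun a => entry (q a) l :=
  (Primrec.list_getD 0).comp (unlist_primrec.comp (Primrec.snd.comp (Primrec.unpair.comp hq)))
    (Primrec.const l)

theorem entry_pair_encode_ofFn {i k : ℕ} {a : Fin k → ℕ} (l : Fin k) :
    entry (Nat.pair i (Encodable.encode (List.ofFn a))) l = a l := by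
  simp [entry, unlist_encode]

/-! ## The presentation of an interpretation -/

namespace Translation

variable {s : Signature} (τ : Translation s.lang sigE.lang) (i₀ : Fin τ.pieces)

/-- The parameters given by a code. -/
noncomputable def par (x : List ℕ × ℕ) (w : ℕ) : Fin τ.params → EqStr (levelSet x) :=
  fun i => elt x (entry w i)

variable {τ}

/-- The piece given by a code. -/
def piece (t : ℕ) : Fin τ.pieces :=
  ⟨if t.unpair.1 < τ.pieces then t.unpair.1 else i₀, by
    split_ifs with h
    exacts [h, i₀.2]⟩

/-- The tuple given by a code. -/
noncomputable def tup (x : List ℕ × ℕ) (t : ℕ) : τ.Tuple (EqStr (levelSet x)) :=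
  ⟨piece i₀ t, fun l => elt x (entry t l)⟩

/-! ### Decidability of the translated atoms on codes -/

section Primrec

variable {α : Type} [Primcodable α] {x : α → List ℕ × ℕ} {w : α → ℕ}

theorem piece_primrecPred {t : α → ℕ} (ht : Primrec t) (j : Fin τ.pieces) :
    PrimrecPred fun a => piece i₀ (t a) = j := by
  have h1 : Primrec fun a => (t a).unpair.1 := Primrec.fst.comp (Primrec.unpair.comp ht)
  have h2 := Primrec.ite (Primrec.nat_lt.comp h1 (Primrec.const τ.pieces)) h1
    (Primrec.const (i₀ : ℕ))
  exact (Primrec.eq.comp h2 (Primrec.const (j : ℕ))).of_eq fun a =>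
    (Fin.ext_iff (a := piece i₀ (t a)) (b := j)).symm

theorem realize_formula_primrecPred {X : Type} (ψ : sigE.lang.Formula X) {v : X → α → ℕ}
    (hx : Primrec x) (hv : ∀ i, Primrec (v i)) :
    PrimrecPred fun a => ψ.Realize fun i => elt (x a) (v i a) :=
  (realize_primrecPred ψ (xs := Fin.elim0) hx hv fun i => i.elim0).of_eq fun a => by
    rw [Formula.Realize]
    refine iff_of_eq (congrArg _ ?_)
    exact Subsingleton.elim _ _

theorem paramDom_primrecPred (hx : Primrec x) (hw : Primrec w) :
    PrimrecPred fun a => τ.paramDom.Realize (τ.par (x a) (w a)) :=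
  realize_formula_primrecPred τ.paramDom (v := fun i a => entry (w a) i) hx
    fun i => entry_primrec hw i

/-- The piece, and with it the formula to be evaluated, depends on the code. Finiteness of the set
of pieces turns this into a finite disjunction over fixed formulas. -/
theorem dom_primrecPred {t : α → ℕ} (hx : Primrec x) (hw : Primrec w) (ht : Primrec t) :
    PrimrecPred fun a => τ.Dom (τ.par (x a) (w a)) (tup i₀ (x a) (t a)) := by
  refine (primrecPred_exists_finite fun j : Fin τ.pieces => (piece_primrecPred i₀ ht j).and
    (realize_formula_primrecPred (τ.dom j) (v := Sum.elim (fun i a => entry (w a) i)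
      fun l a => entry (t a) l) hx ?_)).of_eq fun a => ?_
  · rintro (i | l)
    exacts [entry_primrec hw i, entry_primrec ht l]
  · have key : ∀ j, (fun i => elt (x a) ((Sum.elim (fun i a => entry (w a) i)
        fun l a => entry (t a) l : Fin τ.params ⊕ Fin (τ.dim j) → α → ℕ) i a)) =
        Sum.elim (τ.par (x a) (w a)) fun l : Fin (τ.dim j) => elt (x a) (entry (t a) l) := fun j => by
      funext i
      rcases i with i | i <;> rfl
    simp only [key, exists_eq_left']
    rfl

theorem holds_primrecPred {k : ℕ}
    (P : ∀ ρ : Fin k → Fin τ.pieces, sigE.lang.Formula (Fin τ.params ⊕ Σ m, Fin (τ.dim (ρ m))))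
    {t : Fin k → α → ℕ} (hx : Primrec x) (hw : Primrec w) (ht : ∀ m, Primrec (t m)) :
    PrimrecPred fun a => τ.Holds (τ.par (x a) (w a)) P fun m => tup i₀ (x a) (t m a) := by
  refine (primrecPred_exists_finite fun ρ : Fin k → Fin τ.pieces =>
    (primrecPred_forall_fin fun m => piece_primrecPred i₀ (ht m) (ρ m)).and
    (realize_formula_primrecPred (P ρ) (v := Sum.elim (fun i a => entry (w a) i)
      fun l a => entry (t l.1 a) l.2) hx ?_)).of_eq fun a => ?_
  · rintro (i | l)
    exacts [entry_primrec hw i, entry_primrec (ht _) l.2]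
  · have key : ∀ ρ : Fin k → Fin τ.pieces, (fun i => elt (x a) ((Sum.elim (fun i a => entry (w a) i)
        fun l a => entry (t l.1 a) l.2 :
          (Fin τ.params ⊕ Σ m, Fin (τ.dim (ρ m))) → α → ℕ) i a)) =
        Sum.elim (τ.par (x a) (w a)) fun l => elt (x a) (entry (t l.1 a) l.2) := fun j => by
      funext i
      rcases i with i | i <;> rfl
    simp only [key, ← funext_iff (f := fun m => piece i₀ (t m a)), exists_eq_left']
    rfl

theorem eqv_primrecPred {t t' : α → ℕ} (hx : Primrec x) (hw : Primrec w) (ht : Primrec t)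
    (ht' : Primrec t') :
    PrimrecPred fun a => τ.Eqv (τ.par (x a) (w a)) (tup i₀ (x a) (t a)) (tup i₀ (x a) (t' a)) :=
  (holds_primrecPred i₀ τ.eq (t := ![t, t']) hx hw (Fin.forall_fin_two.2 ⟨ht, ht'⟩)).of_eq
    fun a => by
      rw [Eqv]
      refine iff_of_eq (congrArg _ ?_)
      funext m
      fin_cases m <;> rfl

theorem graph_primrecPred {k : ℕ} (f : s.lang.Functions k) {t : Fin k → α → ℕ} {y : α → ℕ}
    (hx : Primrec x) (hw : Primrec w) (ht : ∀ m, Primrec (t m)) (hy : Primrec y) :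
    PrimrecPred fun a => τ.Graph (τ.par (x a) (w a)) f (fun m => tup i₀ (x a) (t m a))
      (tup i₀ (x a) (y a)) := by
  refine (primrecPred_exists_finite fun ρ : Fin k → Fin τ.pieces =>
    (primrecPred_forall_fin fun m => piece_primrecPred i₀ (ht m) (ρ m)).and
    (primrecPred_exists_finite fun j : Fin τ.pieces => (piece_primrecPred i₀ hy j).and
    (realize_formula_primrecPred (τ.func f ρ j) (v := Sum.elim (fun i a => entry (w a) i)
      (Sum.elim (fun l a => entry (t l.1 a) l.2) fun l a => entry (y a) l)) hx ?_))).of_eq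
    fun a => ?_
  · rintro (i | l | l)
    exacts [entry_primrec hw i, entry_primrec (ht _) l.2, entry_primrec hy l]
  · have key : ∀ (ρ : Fin k → Fin τ.pieces) (j : Fin τ.pieces), (fun i => elt (x a) ((Sum.elim (fun i a => entry (w a) i)
        (Sum.elim (fun l a => entry (t l.1 a) l.2) fun l a => entry (y a) l) :
          (Fin τ.params ⊕ ((Σ m, Fin (τ.dim (ρ m))) ⊕ Fin (τ.dim j))) → α → ℕ) i a)) =
        Sum.elim (τ.par (x a) (w a)) (Sum.elim (fun l : Σ m, Fin (τ.dim (ρ m)) =>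
          elt (x a) (entry (t l.1 a) l.2)) fun l : Fin (τ.dim j) => elt (x a) (entry (y a) l)) := fun ρ j => by
      funext i
      rcases i with i | i | i <;> rfl
    simp only [key, ← funext_iff (f := fun m => piece i₀ (t m a)), exists_eq_left']
    rfl

end Primrec

variable (τ) in
theorem exists_size : ∃ K, τ.params ≤ K ∧ τ.pieces ≤ K ∧ (∀ i, τ.dim i ≤ K) ∧
    s.1.length ≤ K ∧ s.2.length ≤ K ∧ (∀ i, s.1.get i + 1 ≤ K) ∧ ∀ i, s.2.get i ≤ K := by
  refine ⟨τ.params + τ.pieces + (∑ i, τ.dim i) + s.1.length + s.2.length +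
    (∑ i, (s.1.get i + 1)) + ∑ i, s.2.get i, ?_, ?_, fun i => ?_, ?_, ?_, fun i => ?_, fun i => ?_⟩
  · omega
  · omega
  · have := Finset.single_le_sum (f := τ.dim) (fun _ _ => Nat.zero_le _) (Finset.mem_univ i)
    omega
  · omega
  · omega
  · have := Finset.single_le_sum (f := fun i => s.1.get i + 1) (fun _ _ => Nat.zero_le _)
      (Finset.mem_univ i)
    omega
  · have := Finset.single_le_sum (f := s.2.get) (fun _ _ => Nat.zero_le _) (Finset.mem_univ i)
    omega

variable (τ) in
/-- A bound for all arities and dimensions. -/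
noncomputable def size : ℕ := τ.exists_size.choose

variable (τ) in
/-- A strict bound for the codes of tuples and parameters. -/
noncomputable def tupBound (x : List ℕ × ℕ) : ℕ := codeBound τ.size (levelBound x)

variable (τ) in
/-- A strict bound for the codes of facts about codes of tuples. -/
noncomputable def factBound (x : List ℕ × ℕ) : ℕ := codeBound τ.size (τ.tupBound x)

theorem tupBound_primrec : Primrec τ.tupBound := (codeBound_primrec _).comp levelBound_primrec

theorem factBound_primrec : Primrec τ.factBound := (codeBound_primrec _).comp tupBound_primrec

theorem exists_par {x : List ℕ × ℕ} (p : Fin τ.params → EqStr (levelSet x)) :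
    ∃ w < τ.tupBound x, τ.par x w = p := by
  refine ⟨Nat.pair 0 (Encodable.encode (List.ofFn fun i => (p i).1)),
    pair_encode_lt_codeBound (Nat.zero_le _) ?_ ?_, ?_⟩
  · rw [List.length_ofFn]
    exact τ.exists_size.choose_spec.1
  · simp only [List.mem_ofFn, forall_exists_index, forall_apply_eq_imp_iff]
    exact fun i => (lt_levelBound (p i).2).le
  · funext i
    rw [par, entry_pair_encode_ofFn]
    exact elt_val _

theorem exists_tup {x : List ℕ × ℕ} (y : τ.Tuple (EqStr (levelSet x))) :
    ∃ t < τ.tupBound x, tup i₀ x t = y := by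
  obtain ⟨i, a⟩ := y
  refine ⟨Nat.pair i (Encodable.encode (List.ofFn fun l => (a l).1)),
    pair_encode_lt_codeBound ?_ ?_ ?_, ?_⟩
  · exact i.2.le.trans τ.exists_size.choose_spec.2.1
  · rw [List.length_ofFn]
    exact τ.exists_size.choose_spec.2.2.1 i
  · simp only [List.mem_ofFn, forall_exists_index, forall_apply_eq_imp_iff]
    exact fun l => (lt_levelBound (a l).2).le
  -- The piece is generalised so that its equality with `i` can be eliminated before the dependent
  -- coordinates are compared.
  · have key : ∀ j (q : ℕ), j = i → (∀ l : Fin (τ.dim i), elt x (entry q l) = a l) →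
        (⟨j, fun l => elt x (entry q l)⟩ : τ.Tuple (EqStr (levelSet x))) = ⟨i, a⟩ := by
      rintro _ q rfl h
      rw [funext h]
    refine key _ _ (Fin.ext ?_) fun l => ?_
    · simp [piece]
    · rw [entry_pair_encode_ofFn]
      exact elt_val _

/-! ### The finite structures of representatives -/

/-- The least representatives of the classes of translated identity. -/
noncomputable def reps (x : List ℕ × ℕ) (w : ℕ) : List ℕ :=
  select (τ.tupBound x) (fun t => τ.Dom (τ.par x w) (tup i₀ x t) ∧
    ∀ t' < t, ¬ (τ.Dom (τ.par x w) (tup i₀ x t') ∧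
      τ.Eqv (τ.par x w) (tup i₀ x t') (tup i₀ x t))) id

/-- The translated relations. -/
noncomputable def relFacts (x : List ℕ × ℕ) (w : ℕ) : List (ℕ × List ℕ) :=
  select (τ.factBound x) (fun q => ∃ i : Fin s.2.length, q.unpair.1 = i ∧
    (unlist q.unpair.2).length = s.2.get i ∧
    τ.Holds (τ.par x w) (τ.rel ⟨i, rfl⟩) fun m : Fin (s.2.get i) => tup i₀ x (entry q m))
    fun q => (q.unpair.1, unlist q.unpair.2)

/-- The translated functions. -/
noncomputable def funFacts (x : List ℕ × ℕ) (w : ℕ) : List (ℕ × List ℕ) :=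
  select (τ.factBound x) (fun q => ∃ i : Fin s.1.length, q.unpair.1 = i ∧
    (unlist q.unpair.2).length = s.1.get i + 1 ∧ ∃ z < τ.tupBound x,
      τ.Dom (τ.par x w) (tup i₀ x z) ∧
      τ.Graph (τ.par x w) ⟨i, rfl⟩ (fun m : Fin (s.1.get i) => tup i₀ x (entry q (m + 1)))
        (tup i₀ x z) ∧
      τ.Eqv (τ.par x w) (tup i₀ x z) (tup i₀ x (entry q 0)))
    fun q => (q.unpair.1, unlist q.unpair.2)

/-- The finite structure of least representatives. -/
noncomputable def interior (x : List ℕ × ℕ) (w : ℕ) : FinStr :=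
  ((reps i₀ x w).headI, (reps i₀ x w).tail, relFacts i₀ x w, funFacts i₀ x w)

/-- The finite structures for all parameters. -/
noncomputable def interiors (x : List ℕ × ℕ) : List FinStr :=
  select (τ.tupBound x) (fun w => τ.paramDom.Realize (τ.par x w)) (interior i₀ x)

section Primrec
open Primrec

theorem reps_primrec : Primrec fun y : (List ℕ × ℕ) × ℕ => reps i₀ y.1 y.2 := by
  refine select_primrec (tupBound_primrec.comp fst) ?_ snd
  refine (dom_primrecPred i₀ (fst.comp fst) (snd.comp fst) snd).and ?_
  exact primrecPred_forall_lt snd ((dom_primrecPred i₀ (fst.comp (fst.comp fst))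
    (snd.comp (fst.comp fst)) snd).and (eqv_primrecPred i₀ (fst.comp (fst.comp fst))
      (snd.comp (fst.comp fst)) snd (snd.comp fst))).not

theorem fact_primrec : Primrec fun q : ℕ => (q.unpair.1, unlist q.unpair.2) :=
  (fst.comp unpair).pair (unlist_primrec.comp (snd.comp unpair))

theorem relFacts_primrec : Primrec fun y : (List ℕ × ℕ) × ℕ => relFacts i₀ y.1 y.2 := by
  refine select_primrec (factBound_primrec.comp fst) ?_ (fact_primrec.comp snd)
  refine primrecPred_exists_finite fun i => (Primrec.eq.comp (fst.comp (fact_primrec.comp snd))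
    (const _)).and ((Primrec.eq.comp (list_length.comp (snd.comp (fact_primrec.comp snd)))
    (const _)).and ?_)
  exact holds_primrecPred i₀ _ (fst.comp fst) (snd.comp fst) fun m => entry_primrec snd _

theorem funFacts_primrec : Primrec fun y : (List ℕ × ℕ) × ℕ => funFacts i₀ y.1 y.2 := by
  refine select_primrec (factBound_primrec.comp fst) ?_ (fact_primrec.comp snd)
  refine primrecPred_exists_finite fun i => (Primrec.eq.comp (fst.comp (fact_primrec.comp snd))
    (const _)).and ((Primrec.eq.comp (list_length.comp (snd.comp (fact_primrec.comp snd)))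
    (const _)).and ?_)
  refine primrecPred_exists_lt (tupBound_primrec.comp (fst.comp fst)) ?_
  have hx : Primrec fun y : (((List ℕ × ℕ) × ℕ) × ℕ) × ℕ => y.1.1.1 := fst.comp (fst.comp fst)
  have hw : Primrec fun y : (((List ℕ × ℕ) × ℕ) × ℕ) × ℕ => y.1.1.2 := snd.comp (fst.comp fst)
  exact (dom_primrecPred i₀ hx hw snd).and ((graph_primrecPred i₀ _ hx hw
    (fun m => entry_primrec (snd.comp fst) _) snd).and
      (eqv_primrecPred i₀ hx hw snd (entry_primrec (snd.comp fst) 0)))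

theorem interior_primrec : Primrec₂ (interior i₀) := by
  have h := reps_primrec i₀
  have h1 : Primrec fun y : (List ℕ × ℕ) × ℕ => (reps i₀ y.1 y.2).headI := list_headI.comp h
  have h2 : Primrec fun y : (List ℕ × ℕ) × ℕ => (reps i₀ y.1 y.2).tail := list_tail.comp h
  exact h1.pair (h2.pair ((relFacts_primrec i₀).pair (funFacts_primrec i₀)))

theorem interiors_primrec : Primrec (interiors i₀) :=
  select_primrec tupBound_primrec (paramDom_primrecPred fst snd) (interior_primrec i₀)

end Primrec

end Translation

/-! ### Correctness of the presentation -/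

namespace Translation

variable {s : Signature} {τ : Translation s.lang sigE.lang} {i₀ : Fin τ.pieces}
variable {x : List ℕ × ℕ} {w : ℕ}

theorem mem_reps {t : ℕ} : t ∈ reps i₀ x w ↔ t < τ.tupBound x ∧
    τ.Dom (τ.par x w) (tup i₀ x t) ∧ ∀ t' < t, ¬ (τ.Dom (τ.par x w) (tup i₀ x t') ∧
      τ.Eqv (τ.par x w) (tup i₀ x t') (tup i₀ x t)) := by
  rw [reps, mem_select]
  simp

theorem exists_mem_reps (hτ : τ.Sane (τ.par x w)) {y : τ.Tuple (EqStr (levelSet x))}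
    (hy : τ.Dom (τ.par x w) y) : ∃ t ∈ reps i₀ x w, τ.Eqv (τ.par x w) (tup i₀ x t) y := by
  classical
  -- The least code equivalent to `y` is a representative: by transitivity, a smaller code
  -- equivalent to it would be equivalent to `y`.
  have hex : ∃ t, τ.Dom (τ.par x w) (tup i₀ x t) ∧ τ.Eqv (τ.par x w) (tup i₀ x t) y := by
    obtain ⟨t, -, rfl⟩ := exists_tup i₀ y
    exact ⟨t, hy, hτ.refl _ hy⟩
  obtain ⟨h1, h2⟩ := Nat.find_spec hex
  refine ⟨Nat.find hex, mem_reps.2 ⟨?_, h1, fun t' ht' h => Nat.find_min hex ht' ⟨h.1, ?_⟩⟩, h2⟩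
  · obtain ⟨t, ht, rfl⟩ := exists_tup i₀ y
    exact (Nat.find_min' hex ⟨hy, hτ.refl _ hy⟩).trans_lt ht
  · exact hτ.trans _ _ _ h.1 h1 hy h.2 h2

theorem reps_ne_nil (hτ : τ.Sane (τ.par x w)) : reps i₀ x w ≠ [] := by
  obtain ⟨y, hy⟩ := hτ.nonempty
  obtain ⟨t, ht, -⟩ := exists_mem_reps (i₀ := i₀) hτ hy
  exact List.ne_nil_of_mem ht

theorem dom_interior (hτ : τ.Sane (τ.par x w)) : (interior i₀ x w).dom = reps i₀ x w := by
  have := reps_ne_nil (i₀ := i₀) hτ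
  rw [FinStr.dom, interior]
  dsimp only
  cases h : reps i₀ x w with
  | nil => exact absurd h this
  | cons a l => rfl

/-- Representatives have codes below `tupBound`, and arities and symbols are at most `size`. Hence
every fact about representatives has a code below `factBound` and the bounded search misses none. -/
theorem interior_describes (hτ : τ.Sane (τ.par x w)) :
    τ.Describes (τ.par x w) (tup i₀ x) (interior i₀ x w) := by
  have hbound : ∀ {k i : ℕ} {a : Fin k → ℕ}, i ≤ τ.size → k ≤ τ.size →
      (∀ m, a m ∈ (interior i₀ x w).dom) →
      Nat.pair i (Encodable.encode (List.ofFn a)) < τ.factBound x := by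
    intro k i a hi hk ha
    refine pair_encode_lt_codeBound hi (by rwa [List.length_ofFn]) ?_
    simp only [List.mem_ofFn, forall_exists_index, forall_apply_eq_imp_iff]
    intro m
    have := ha m
    rw [dom_interior hτ, mem_reps] at this
    exact this.1.le
  obtain ⟨-, -, -, hs1, hs2, hs3, hs4⟩ := τ.exists_size.choose_spec
  refine ⟨?_, ?_, ?_, ?_, ?_⟩
  · rw [dom_interior hτ]
    exact fun t ht => (mem_reps.1 ht).2.1
  · rw [dom_interior hτ]
    exact fun y hy => exists_mem_reps hτ hy
  · rw [dom_interior hτ]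
    intro t ht t' ht' he
    rw [mem_reps] at ht ht'
    rcases lt_trichotomy t t' with h | h | h
    · exact absurd ⟨ht.2.1, he⟩ (ht'.2.2 t h)
    · exact h
    · exact absurd ⟨ht'.2.1, hτ.symm _ _ ht.2.1 ht'.2.1 he⟩ (ht.2.2 t' h)
  · rintro k ⟨i, rfl⟩ a ha
    change _ ∈ relFacts i₀ x w ↔ _
    rw [relFacts, mem_select]
    constructor
    · rintro ⟨q, -, ⟨j, hj, -, hq⟩, he⟩
      simp only [Prod.mk.injEq] at he
      obtain rfl : i = j := Fin.ext (he.1.symm.trans hj)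
      convert hq using 3 with m
      rw [entry, he.2]
      simp
    · intro h
      refine ⟨Nat.pair i (Encodable.encode (List.ofFn a)),
        hbound (i.2.le.trans hs2) (hs4 i) ha, ⟨i, by simp, by simp [unlist_encode], ?_⟩,
        by simp [unlist_encode]⟩
      simp only [entry_pair_encode_ofFn]
      exact h
  · rintro k ⟨i, rfl⟩ a y ha hy
    change _ ∈ funFacts i₀ x w ↔ _
    rw [funFacts, mem_select]
    constructor
    · rintro ⟨q, -, ⟨j, hj, -, z, -, hz, hg, hq⟩, he⟩
      simp only [Prod.mk.injEq] at he
      obtain rfl : i = j := Fin.ext (he.1.symm.trans hj)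
      refine ⟨_, hz, ?_, ?_⟩
      · convert hg using 3 with m
        rw [entry, he.2]
        simp
      · convert hq using 2
        rw [entry, he.2]
        simp
    · rintro ⟨z, hz, hg, he⟩
      obtain ⟨z, hz', rfl⟩ := exists_tup i₀ z
      have hq : unlist (Nat.pair i (Encodable.encode (y :: List.ofFn a))).unpair.2 =
          y :: List.ofFn a := by rw [Nat.unpair_pair, unlist_encode]
      have hc : y :: List.ofFn a = List.ofFn (Fin.cons y a : Fin _ → ℕ) := by simp
      refine ⟨Nat.pair i (Encodable.encode (y :: List.ofFn a)), ?_,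
        ⟨i, by rw [Nat.unpair_pair], by rw [hq]; simp, z, hz', hz, ?_, ?_⟩, by rw [hq, Nat.unpair_pair]⟩
      · rw [hc]
        refine hbound (i.2.le.trans hs1) (hs3 i) fun m => ?_
        refine Fin.cases ?_ (fun m => ?_) m
        · simpa using hy
        · simpa using ha m
      · have : ∀ m : Fin (s.1.get i), entry (Nat.pair i (Encodable.encode (y :: List.ofFn a)))
            (m + 1) = a m := fun m => by
          rw [entry, hq]
          simp
        simp only [this]
        exact hg
      · have : entry (Nat.pair i (Encodable.encode (y :: List.ofFn a))) 0 = y := by rw [entry, hq]; rfl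
        rw [this]
        exact he

theorem interiors_eq_nil : interiors i₀ x = [] ↔ ¬ EqStr (levelSet x) ⊨ τ.existsParams := by
  rw [List.eq_nil_iff_forall_not_mem, realize_existsParams]
  simp only [interiors, mem_select]
  constructor
  · rintro h ⟨p, hp⟩
    obtain ⟨w, hw, rfl⟩ := exists_par p
    exact h _ ⟨w, hw, hp, rfl⟩
  · rintro h D ⟨w, -, hp, -⟩
    exact h ⟨_, hp⟩

/-- The translated sentence quantifies universally over admissible parameters, which matches truth
in every listed structure. The translated identity axioms are needed to make each of these
structures faithful. -/
theorem interiors_models (hid : ∀ χ ∈ identityAxioms s.lang, EqStr (levelSet x) ⊨ τ.sentence χ)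
    (φ : s.lang.Sentence) :
    (∀ D ∈ interiors i₀ x, D.Carrier ⊨ φ) ↔ EqStr (levelSet x) ⊨ τ.sentence φ := by
  have hsane : ∀ p, τ.paramDom.Realize p → τ.Sane (N := EqStr (levelSet x)) p := fun p hp =>
    sane_of_tr fun χ hχ => τ.realize_sentence.1 (hid χ hχ) p hp
  have key : ∀ w, τ.paramDom.Realize (τ.par x w) → ((interior i₀ x w).Carrier ⊨ φ ↔
      τ.Tr (τ.par x w) φ (Fin.elim0 : Fin 0 → τ.Tuple _)) := fun w hw =>
    (interior_describes (hsane _ hw)).models_iff (hsane _ hw) φ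
  rw [realize_sentence]
  simp only [interiors, mem_select]
  constructor
  · intro h p hp
    obtain ⟨w, hw, rfl⟩ := exists_par p
    exact (key w hp).1 (h _ ⟨w, hw, hp, rfl⟩)
  · rintro h D ⟨w, -, hp, rfl⟩
    exact (key w hp).2 (h _ hp)

variable (i₀) in
theorem exists_presentation : ∃ c : Code, ∀ P R, presented c P R = interiors i₀ (P, R) := by
  have h : Primrec fun n : ℕ => Encodable.encode
      ((Encodable.decode n : Option (List ℕ × ℕ)).map (interiors i₀)) :=
    Primrec.encode.comp (Primrec.option_map Primrec.decode
      ((interiors_primrec i₀).comp Primrec.snd))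
  -- The code of `some y` is the successor of the code of `y`, so the predecessor strips the option.
  have h' : Primrec fun n : ℕ => (Encodable.encode
      ((Encodable.decode n : Option (List ℕ × ℕ)).map (interiors i₀))).pred :=
    Primrec.pred.comp h
  obtain ⟨c, hc⟩ := exists_evalP (Primrec.nat_iff.1 h')
  refine ⟨c, fun P R => ?_⟩
  rw [presented, hc]
  simp

/-- An interpretation in an infinite structure gives rise to a presentation that is not refuted at
any pattern that agrees with the structure. -/
theorem exists_not_isRefutation {U : s.lang.Theory} {e : Code} (he : IsTheoryIndex e U)
    {Q : Set ℕ} (τ : Translation s.lang sigE.lang) (hp : EqStr (infSet Q) ⊨ τ.existsParams)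
    (hU : ∀ φ, U ⊨ᵇ φ → EqStr (infSet Q) ⊨ τ.sentence φ) :
    ∃ q : Code × ℕ, ∀ P t m R R', (∀ i, i < R ∨ i < R' → (i ∈ P ↔ i ∈ Q)) →
      ¬ IsRefutation s e q P t m R R' := by
  obtain ⟨C, hC, hC'⟩ := τ.exists_rank
  have hid : ∀ χ ∈ identityAxioms s.lang, EqStr (infSet Q) ⊨ τ.sentence χ := fun χ hχ =>
    hU χ (Theory.models_sentence_iff.2 fun M => realize_identityAxioms hχ)
  have hi₀ : ∃ i : Fin τ.pieces, True := by
    obtain ⟨p, hp⟩ := τ.realize_existsParams.1 hp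
    -- The translated domain is not empty, so there is a piece to serve as the default in decoding.
    obtain ⟨x, -⟩ := (sane_of_tr fun χ hχ => τ.realize_sentence.1 (hid χ hχ) p hp).nonempty
    exact ⟨x.1, trivial⟩
  obtain ⟨i₀, -⟩ := hi₀
  obtain ⟨c, hc⟩ := exists_presentation i₀
  -- `B` bounds the ranks of all translated identity axioms.
  obtain ⟨B, hB⟩ := ((finite_identityAxioms s).image fun χ => C * (formulaCode χ + 1)).bddAbove
  have hrank : ∀ {P : List ℕ} {R r : ℕ} {ψ : sigE.lang.Sentence}, Ranked r ψ → r ≤ R →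
      (∀ i < R, i ∈ P ↔ i ∈ Q) → (EqStr (levelSet (P, R)) ⊨ ψ ↔ EqStr (infSet Q) ⊨ ψ) :=
    fun {P} _ _ _ hψ hr hPQ => (hψ.sentence_iff hr (similar_infSet_finSet (P := {i | i ∈ P}) hPQ)).symm
  have hid' : ∀ {P : List ℕ} {R : ℕ}, B ≤ R → (∀ i < R, i ∈ P ↔ i ∈ Q) →
      ∀ χ ∈ identityAxioms s.lang, EqStr (levelSet (P, R)) ⊨ τ.sentence χ :=
    fun hR hPQ χ hχ => (hrank (hC' χ) ((hB ⟨χ, hχ, rfl⟩).trans hR) hPQ).2 (hid χ hχ)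
  have hholds : ∀ {P : List ℕ} {R : ℕ} (φ : s.lang.Sentence),
      (max B C) * (formulaCode φ + 1) ≤ R → (∀ i < R, i ∈ P ↔ i ∈ Q) →
      (HoldsAt c P R (formulaCode φ) ↔ EqStr (infSet Q) ⊨ τ.sentence φ) := by
    intro P R φ hR hPQ
    have h1 : B ≤ R := (le_max_left B C).trans ((Nat.le_mul_of_pos_right _ (by omega)).trans hR)
    have h2 : C * (formulaCode φ + 1) ≤ R :=
      (Nat.mul_le_mul_right _ (le_max_right B C)).trans hR
    rw [holdsAt_formulaCode, hc, interiors_models (hid' h1 hPQ), hrank (hC' φ) h2 hPQ]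
  -- With `max B C` as the constant, a threshold `(max B C) * (m + 1)` covers both the identity
  -- axioms and the sentence with number `m`.
  refine ⟨(c, max B C), fun P t m R R' hPQ href => ?_⟩
  have hR : ∀ i < R, i ∈ P ↔ i ∈ Q := fun i hi => hPQ i (Or.inl hi)
  have hR' : ∀ i < R', i ∈ P ↔ i ∈ Q := fun i hi => hPQ i (Or.inr hi)
  rcases href with ⟨h1, h2⟩ | ⟨hm, ⟨h1, h2⟩, h3, h4⟩ | ⟨hm, h1, h2⟩
  · rw [hc, interiors_eq_nil] at h2
    exact h2 ((hrank hC ((le_max_right B C).trans h1) hR).2 hp)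
  · obtain ⟨φ, rfl⟩ := wfFormula_iff.1 hm
    exact h4 ((hholds φ h2 hR').2 ((hholds φ h1 hR).1 h3))
  · obtain ⟨y, hy⟩ := Option.isSome_iff_exists.1 hm
    obtain ⟨φ, hφ, rfl⟩ := (he m).1 (Part.dom_iff_mem.2 ⟨y, Code.evaln_sound hy⟩)
    exact h2 ((hholds φ h1 hR).2 (hU φ (Theory.models_sentence_of_mem hφ)))

end Translation

/-- No consistent extension of `J` by boolean combinations of the sparse sentences interprets an
essentially undecidable theory. -/
theorem not_interprets_of_sparse {s : Signature} {U : s.lang.Theory} {e : Code}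
    (he : IsTheoryIndex e U) (hU : EssentiallyUndecidable U) {T : sigE.lang.Theory}
    (hT : IsJTheory (sparse (s, e)) T) (hsat : T.IsSatisfiable) : ¬ Interprets T U := by
  rintro ⟨τ, hp, hτ⟩
  obtain ⟨Q, hQ, hmod⟩ := hT.exists_model hsat
  obtain ⟨q, hq⟩ := Translation.exists_not_isRefutation he τ 
    (Theory.models_sentence_iff.1 hp (.of T (EqStr (infSet Q))))
    fun φ hφ => Theory.models_sentence_iff.1 (hτ φ hφ) (.of T (EqStr (infSet Q)))
  obtain ⟨P, t, m, R, R', h1, h2⟩ := exists_isRefutation_of_subset_sparse he hU hQ q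
  exact hq P t m R R' h2 h1

/-! ## Gödel numbers of the axioms -/

/-- The Gödel number of an implication. -/
def codeImp (a b : ℕ) : ℕ := Nat.pair 3 (Nat.pair a b)

/-- The Gödel number of a negation. -/
def codeNot (a : ℕ) : ℕ := codeImp a (Nat.pair 0 0)

/-- The Gödel number of a conjunction. -/
def codeAnd (a b : ℕ) : ℕ := codeNot (codeImp a (codeNot b))

/-- The Gödel number of an existential quantification. -/
def codeEx (a : ℕ) : ℕ := codeNot (Nat.pair 4 (codeNot a))

/-- The Gödel number of `x E y`. -/
def codeRel (x y : ℕ) : ℕ :=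
  Nat.pair 2 (Nat.pair 0 (Encodable.encode [Nat.pair 0 x, Nat.pair 0 y]))

/-- The Gödel number of `x = y`. -/
def codeEq (x y : ℕ) : ℕ := Nat.pair 1 (Nat.pair (Nat.pair 0 x) (Nat.pair 0 y))

/-- The Gödel number of the conjunction of the formulas with numbers `f 0, …, f (n - 1)`. -/
def codeConj (n : ℕ) (f : ℕ → ℕ) : ℕ :=
  ((List.range n).map f).foldr codeAnd (codeNot (Nat.pair 0 0))

/-- The conjunction over all `i < n` of `f i` and of `g i j` for all `j ≠ i`. -/
def codeDistinct (n : ℕ) (f : ℕ → ℕ) (g : ℕ → ℕ → ℕ) : ℕ :=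
  codeConj n fun i => codeAnd (f i) (codeConj n fun j =>
    if i = j then codeNot (Nat.pair 0 0) else codeNot (g i j))

/-- The Gödel number of `classGe`. -/
def codeClassGe (m n x : ℕ) : ℕ :=
  codeEx^[n] (codeDistinct n (fun i => codeRel x (m + i)) fun i j => codeEq (m + i) (m + j))

/-- The Gödel number of `classEq`. -/
def codeClassEq (m n x : ℕ) : ℕ := codeAnd (codeClassGe m n x) (codeNot (codeClassGe m (n + 1) x))

/-! ### Agreement of the arithmetical codes with the formulas -/

section Correct

variable {m : ℕ}

theorem formulaCode_and (φ ψ : sigE.lang.BoundedFormula Empty m) :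
    formulaCode (φ ⊓ ψ) = codeAnd (formulaCode φ) (formulaCode ψ) := rfl

theorem formulaCode_not (φ : sigE.lang.BoundedFormula Empty m) :
    formulaCode (∼φ) = codeNot (formulaCode φ) := rfl

theorem formulaCode_top :
    formulaCode (⊤ : sigE.lang.BoundedFormula Empty m) = codeNot (Nat.pair 0 0) := rfl

theorem formulaCode_relE (x y : Fin m) : formulaCode (relE x y) = codeRel x y := by
  simp [relE, Relations.boundedFormula₂, Relations.boundedFormula, formulaCode, termCode, codeRel,
    symE, List.ofFn_succ]

theorem formulaCode_eqE (x y : Fin m) : formulaCode (eqE x y) = codeEq x y := rfl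

theorem formulaCode_conj {n : ℕ} {F : Fin n → sigE.lang.BoundedFormula Empty m} {f : ℕ → ℕ}
    (h : ∀ i : Fin n, formulaCode (F i) = f i) :
    formulaCode (conj ((List.finRange n).map F)) = codeConj n f := by
  have h1 : ∀ l : List (sigE.lang.BoundedFormula Empty m),
      formulaCode (conj l) = (l.map formulaCode).foldr codeAnd (codeNot (Nat.pair 0 0)) := by
    intro l
    induction l with
    | nil => rfl
    | cons a l ih =>
      rw [List.map_cons, List.foldr_cons, ← ih]
      rfl
  rw [h1, codeConj, List.map_map]
  congr 1
  rw [show formulaCode ∘ F = fun i : Fin n => f i from funext h, ← List.map_coe_finRange_eq_range,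
    List.map_map]
  rfl

theorem formulaCode_distinct {n : ℕ} {F : Fin n → sigE.lang.BoundedFormula Empty m}
    {G : Fin n → Fin n → sigE.lang.BoundedFormula Empty m} {f : ℕ → ℕ} {g : ℕ → ℕ → ℕ}
    (hf : ∀ i : Fin n, formulaCode (F i) = f i) (hg : ∀ i j : Fin n, formulaCode (G i j) = g i j) :
    formulaCode (conj ((List.finRange n).map fun i =>
      F i ⊓ conj ((List.finRange n).map fun j => if i = j then ⊤ else ∼(G i j)))) =
      codeDistinct n f g := by
  refine formulaCode_conj fun i => ?_
  rw [formulaCode_and, hf]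
  congr 1
  refine formulaCode_conj fun j => ?_
  rw [← hg, apply_ite formulaCode, formulaCode_top, formulaCode_not]
  simp only [Fin.ext_iff]

theorem formulaCode_exLast : ∀ {n : ℕ} (φ : sigE.lang.BoundedFormula Empty (m + n)),
    formulaCode (exLast n φ) = codeEx^[n] (formulaCode φ)
  | 0, _ => rfl
  | n + 1, φ => by
    rw [exLast, formulaCode_exLast (n := n), Function.iterate_succ_apply]
    rfl

theorem formulaCode_classGe (n : ℕ) (x : Fin m) :
    formulaCode (classGe n x) = codeClassGe m n x := by
  rw [classGe, formulaCode_exLast, codeClassGe]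
  congr 1
  exact formulaCode_distinct (fun i => formulaCode_relE _ _) fun i j => formulaCode_eqE _ _

theorem formulaCode_classEq (n : ℕ) (x : Fin m) :
    formulaCode (classEq n x) = codeClassEq m n x := by
  rw [classEq, formulaCode_and, formulaCode_not, formulaCode_classGe, formulaCode_classGe]
  rfl

theorem formulaCode_atMostOneClass (n : ℕ) : formulaCode (atMostOneClass n) =
    Nat.pair 4 (Nat.pair 4 (codeImp (codeClassEq 2 n 0)
      (codeImp (codeClassEq 2 n 1) (codeRel 0 1)))) := by
  simp only [atMostOneClass, formulaCode, formulaCode_classEq, formulaCode_relE]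
  rfl

theorem formulaCode_sentA (n : ℕ) :
    formulaCode (sentA n) = codeEx (codeClassEq 1 (n + 1) 0) := by
  have := formulaCode_classEq (n + 1) (0 : Fin 1)
  change codeEx (formulaCode (classEq (n + 1) (0 : Fin 1))) = _
  rw [this]
  rfl

theorem formulaCode_manyLargeClasses (n : ℕ) : formulaCode (manyLargeClasses n) =
    codeEx^[n] (codeDistinct n (fun i => codeClassGe (0 + n) n (0 + i))
      fun i j => codeRel (0 + i) (0 + j)) := by
  rw [manyLargeClasses, formulaCode_exLast]
  congr 1
  exact formulaCode_distinct (fun i => formulaCode_classGe _ _) fun i j => formulaCode_relE _ _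

end Correct

/-! ### Primitive recursiveness of the arithmetical codes -/

section Primrec
open Primrec

theorem codeImp_primrec : Primrec₂ codeImp :=
  Primrec₂.natPair.comp (const 3) (Primrec₂.natPair.comp fst snd)

theorem codeNot_primrec : Primrec codeNot := codeImp_primrec.comp Primrec.id (const _)

theorem codeAnd_primrec : Primrec₂ codeAnd :=
  codeNot_primrec.comp (codeImp_primrec.comp fst (codeNot_primrec.comp snd))

theorem codeEx_primrec : Primrec codeEx :=
  codeNot_primrec.comp (Primrec₂.natPair.comp (const 4) codeNot_primrec)

theorem codeRel_primrec : Primrec₂ codeRel := by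
  have h : ∀ {f : ℕ × ℕ → ℕ}, Primrec f → Primrec fun x => Nat.pair 0 (f x) :=
    fun hf => Primrec₂.natPair.comp (const 0) hf
  have hl : Primrec fun x : ℕ × ℕ => [Nat.pair 0 x.1, Nat.pair 0 x.2] :=
    list_cons.comp (h fst) (list_cons.comp (h snd) (const []))
  exact Primrec₂.natPair.comp (const 2) (Primrec₂.natPair.comp (const 0) (Primrec.encode.comp hl))

theorem codeEq_primrec : Primrec₂ codeEq :=
  Primrec₂.natPair.comp (const 1) (Primrec₂.natPair.comp
    (Primrec₂.natPair.comp (const 0) fst) (Primrec₂.natPair.comp (const 0) snd))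

variable {α : Type} [Primcodable α]

theorem codeConj_primrec {n : α → ℕ} {f : α → ℕ → ℕ} (hn : Primrec n) (hf : Primrec₂ f) :
    Primrec fun a => codeConj (n a) (f a) := by
  have hl : Primrec fun a => (List.range (n a)).map (f a) := list_map (list_range.comp hn) hf
  have hh : Primrec₂ fun (_ : α) (x : ℕ × ℕ) => codeAnd x.1 x.2 :=
    Primrec₂.comp (f := codeAnd) (g := fun y : α × ℕ × ℕ => y.2.1) (h := fun y => y.2.2)
      codeAnd_primrec (fst.comp snd) (snd.comp snd)
  exact (list_foldr hl (const (codeNot (Nat.pair 0 0))) hh).of_eq fun a => rfl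

theorem codeDistinct_primrec {n : α → ℕ} {f : α → ℕ → ℕ} {g : α → ℕ → ℕ → ℕ} (hn : Primrec n)
    (hf : Primrec₂ f) (hg : Primrec fun x : (α × ℕ) × ℕ => g x.1.1 x.1.2 x.2) :
    Primrec fun a => codeDistinct (n a) (f a) (g a) := by
  refine codeConj_primrec hn (codeAnd_primrec.comp hf ?_)
  refine codeConj_primrec (α := α × ℕ) (hn.comp fst) ?_
  exact ite (Primrec.eq.comp (snd.comp fst) snd) (const _) (codeNot_primrec.comp hg)

theorem codeEx_iterate_primrec {n f : α → ℕ} (hn : Primrec n) (hf : Primrec f) :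
    Primrec fun a => codeEx^[n a] (f a) :=
  nat_iterate hn hf (codeEx_primrec.comp snd)

theorem codeClassGe_primrec {m n x : α → ℕ} (hm : Primrec m) (hn : Primrec n) (hx : Primrec x) :
    Primrec fun a => codeClassGe (m a) (n a) (x a) := by
  refine codeEx_iterate_primrec hn (codeDistinct_primrec hn ?_ ?_)
  · exact codeRel_primrec.comp (hx.comp fst) (nat_add.comp (hm.comp fst) snd)
  · have hm' : Primrec fun y : (α × ℕ) × ℕ => m y.1.1 := hm.comp (fst.comp fst)
    exact codeEq_primrec.comp (nat_add.comp hm' (snd.comp fst)) (nat_add.comp hm' snd)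

theorem codeClassEq_primrec {m n x : α → ℕ} (hm : Primrec m) (hn : Primrec n) (hx : Primrec x) :
    Primrec fun a => codeClassEq (m a) (n a) (x a) :=
  codeAnd_primrec.comp (codeClassGe_primrec hm hn hx)
    (codeNot_primrec.comp (codeClassGe_primrec hm (succ.comp hn) hx))

theorem formulaCode_sentA_primrec : Primrec fun n => formulaCode (sentA n) :=
  (codeEx_primrec.comp (codeClassEq_primrec (const 1) succ (const 0))).of_eq
    fun n => (formulaCode_sentA n).symm

theorem formulaCode_not_sentA_primrec : Primrec fun n => formulaCode (sentA n).not :=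
  codeNot_primrec.comp formulaCode_sentA_primrec

theorem formulaCode_atMostOneClass_primrec : Primrec fun n => formulaCode (atMostOneClass n) := by
  have h : Primrec (Nat.pair 4) := Primrec₂.natPair.comp (const 4) Primrec.id
  refine (h.comp (h.comp (codeImp_primrec.comp
    (codeClassEq_primrec (const 2) Primrec.id (const 0)) (codeImp_primrec.comp
    (codeClassEq_primrec (const 2) Primrec.id (const 1)) (const (codeRel 0 1)))))).of_eq fun n => ?_
  exact (formulaCode_atMostOneClass n).symm

theorem formulaCode_manyLargeClasses_primrec :
    Primrec fun n => formulaCode (manyLargeClasses n) := by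
  refine (codeEx_iterate_primrec (n := fun n => n)
    (f := fun n => codeDistinct n (fun i => codeClassGe (0 + n) n (0 + i))
      fun i j => codeRel (0 + i) (0 + j)) Primrec.id (codeDistinct_primrec Primrec.id ?_ ?_)).of_eq
    fun n => (formulaCode_manyLargeClasses n).symm
  · exact codeClassGe_primrec (nat_add.comp (const 0) fst) fst (nat_add.comp (const 0) snd)
  · exact codeRel_primrec.comp (nat_add.comp (const 0) (snd.comp fst))
      (nat_add.comp (const 0) snd)

end Primrec

/-! ## The theory `W` -/

/-- The axioms of `W`. -/
def theoryW (Y Z : Set ℕ) : sigE.lang.Theory :=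
  theoryJ ∪ sentA '' Y ∪ (fun n => (sentA n).not) '' Z

theorem isJTheory_theoryW {X Y Z : Set ℕ} (hY : Y ⊆ X) (hZ : Z ⊆ X) :
    IsJTheory X (theoryW Y Z) := by
  refine ⟨sentA '' Y ∪ (fun n => (sentA n).not) '' Z, ?_, Set.union_assoc _ _ _⟩
  rintro _ (⟨n, hn, rfl⟩ | ⟨n, hn, rfl⟩)
  · exact .sentA n (hY hn)
  · exact .imp _ _ (.sentA n (hZ hn)) .falsum

theorem theoryW_isSatisfiable {Y Z : Set ℕ} (h : Disjoint Y Z) : (theoryW Y Z).IsSatisfiable := by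
  have : EqStr (infSet Y) ⊨ theoryW Y Z := by
    refine (Theory.model_iff _).2 fun φ hφ => ?_
    rcases hφ with (hφ | ⟨n, hn, rfl⟩) | ⟨n, hn, rfl⟩
    · exact (Theory.model_iff _).1 (infSet_models_theoryJ Y) φ hφ
    · exact infSet_models_sentA.2 hn
    · rw [Sentence.realize_not, infSet_models_sentA]
      exact fun hn' => Set.disjoint_left.1 h hn' hn
  exact Theory.Model.isSatisfiable (EqStr (infSet Y))

/-- For a consistent decidable extension `V`, the set of `n` such that `V` proves `sentA n` would be
a recursive separator of `Y` and `Z`. -/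
theorem essentiallyUndecidable_theoryW {Y Z : Set ℕ} (h : RecursivelyInseparable Y Z) :
    EssentiallyUndecidable (theoryW Y Z) := by
  intro V hV hsat hdec
  have hD := computablePred_comp
    (p := fun m => ∃ φ : sigE.lang.Sentence, V ⊨ᵇ φ ∧ formulaCode φ = m)
    (f := fun n => formulaCode (sentA n)) hdec formulaCode_sentA_primrec.to_comp
  refine h.2 ⟨{n | ∃ φ : sigE.lang.Sentence, V ⊨ᵇ φ ∧ formulaCode φ = formulaCode (sentA n)},
    hD.of_eq fun n => Iff.rfl, ?_, ?_⟩
  · intro n hn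
    exact ⟨_, hV _ (Theory.models_sentence_of_mem (Or.inl (Or.inr ⟨n, hn, rfl⟩))), rfl⟩
  · refine Set.disjoint_left.2 ?_
    rintro n ⟨φ, hφ, he⟩ hn
    -- The separator is phrased through Gödel numbers; injectivity shows that the provable sentence
    -- is `sentA n` itself.
    obtain rfl := formulaCode_injective he
    have hnot := hV _ (Theory.models_sentence_of_mem (Or.inr ⟨n, hn, rfl⟩))
    obtain ⟨M⟩ := hsat
    exact (Sentence.realize_not M).1 (Theory.models_sentence_iff.1 hnot M)
      (Theory.models_sentence_iff.1 hφ M)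

/-! ## Inseparable sets of sparse numbers -/

/-- The numbers `m` of the sparse set that start the stage of a program that returns `v` when it is
applied to itself. -/
def sparseValue (v : ℕ) (a : Signature × Code) : Set ℕ :=
  {m | m ∈ sparse a ∧ (stage a m).1 ∈ selfValue v}

/-- `t` witnesses that `m` belongs to `sparseValue v a`. -/
def IsWitness (v : ℕ) (a : Signature × Code) (m t : ℕ) : Prop :=
  (stage a m).2 = m ∧
    Code.evaln t (Denumerable.ofNat Code (stage a m).1) (stage a m).1 = some v

theorem mem_sparseValue {v : ℕ} {a : Signature × Code} {m : ℕ} :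
    m ∈ sparseValue v a ↔ ∃ t, IsWitness v a m t := by
  refine (and_congr_right fun _ => Code.evaln_complete).trans ?_
  exact exists_and_left.symm

theorem isWitness_computablePred (v : ℕ) {β : Type} [Primcodable β] {a : β → Signature × Code}
    {m t : β → ℕ} (ha : Computable a) (hm : Computable m) (ht : Computable t) :
    ComputablePred fun b => IsWitness v (a b) (m b) (t b) := by
  have h : Computable fun b => stage (a b) (m b) :=
    stage_computable.comp (g := fun b => (a b, m b)) (ha.pair hm)
  have h1 := Computable.fst.comp h
  exact computablePred_and (computablePred_eq (Computable.snd.comp h) hm)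
    (computablePred_eq (Nat.Partrec.Code.primrec_evaln.to_comp.comp
      (g := fun b => ((t b, Denumerable.ofNat Code (stage (a b) (m b)).1), (stage (a b) (m b)).1))
      ((ht.pair ((Computable.ofNat Code).comp h1)).pair h1)) (Computable.const (some v)))

theorem sparseValue_subset (v : ℕ) (a : Signature × Code) : sparseValue v a ⊆ sparse a :=
  fun _ h => h.1

/-- The function that sends `n` to an element of the sparse set with stage number `n` is computable,
and it maps `selfValue v` into `sparseValue v`. A separator of the images pulls back to a separator
of the original pair. -/
theorem recursivelyInseparable_sparseValue {s : Signature} {U : s.lang.Theory} {e : Code}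
    (he : IsTheoryIndex e U) (hU : EssentiallyUndecidable U) :
    RecursivelyInseparable (sparseValue 0 (s, e)) (sparseValue 1 (s, e)) := by
  refine ⟨Set.disjoint_left.2 fun m h0 h1 =>
    Set.disjoint_left.1 recursivelyInseparable_selfValue.1 h0.2 h1.2, ?_⟩
  rintro ⟨D, hD, h0, h1⟩
  have hst : ComputablePred fun x : ℕ × ℕ => stage (s, e) x.2 = (x.1, x.2) :=
    computablePred_eq (stage_computable.comp (g := fun x : ℕ × ℕ => ((s, e), x.2))
      ((Computable.const (s, e)).pair Computable.snd)) Computable.id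
  obtain ⟨g, hg, hg'⟩ := ComputablePred.computable_iff.1 hst
  have hgs : ∀ n k, stage (s, e) k = (n, k) ↔ g (n, k) = true := fun n k => by
    simpa using congrFun hg' (n, k)
  -- Unbounded search for the element with stage number `n`. It halts because, for an essentially
  -- undecidable theory, every stage is reached.
  have hrec : Partrec fun n : ℕ => Nat.rfind fun k => Part.some (g (n, k)) :=
    Partrec.rfind (p := fun n k => Part.some (g (n, k))) hg.partrec
  have hdom : ∀ n, (Nat.rfind fun k => Part.some (g (n, k))).Dom := fun n => by
    obtain ⟨k, hk⟩ := exists_stage he hU n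
    exact Nat.rfind_dom'.2 ⟨k, by simp [(hgs n k).1 hk], fun _ => trivial⟩
  choose f hf using fun n => Part.dom_iff_mem.1 (hdom n)
  have hfc : Computable f := hrec.of_eq fun n => Part.eq_some_iff.2 (hf n)
  have hfs : ∀ n, stage (s, e) (f n) = (n, f n) := fun n =>
    (hgs n (f n)).2 (by simpa using Nat.rfind_spec (hf n))
  have hmem : ∀ v n, n ∈ selfValue v → f n ∈ sparseValue v (s, e) := fun v n hn => by
    refine ⟨?_, ?_⟩
    · change (stage (s, e) (f n)).2 = f n
      rw [hfs]
    · rwa [hfs]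
  exact recursivelyInseparable_selfValue.2 ⟨{n | f n ∈ D}, computablePred_comp (p := fun m => m ∈ D) hD hfc,
    fun n hn => h0 (hmem 0 n hn),
    Set.disjoint_left.2 fun n hn hn' => Set.disjoint_left.1 h1 hn (hmem 1 n hn')⟩

/-! ## Enumeration of the axioms of `W` -/

/-- `t` witnesses that `m` is the Gödel number of an axiom of `W`. -/
def IsAxiomWitness (a : Signature × Code) (m t : ℕ) : Prop :=
  (m = formulaCode reflE ∨ m = formulaCode symmE ∨ m = formulaCode transE) ∨
  (formulaCode (atMostOneClass t) = m ∨ formulaCode (manyLargeClasses t) = m) ∨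
  (formulaCode (sentA t.unpair.1) = m ∧ IsWitness 0 a t.unpair.1 t.unpair.2) ∨
  (formulaCode (sentA t.unpair.1).not = m ∧ IsWitness 1 a t.unpair.1 t.unpair.2)

theorem isAxiomWitness_computablePred : ComputablePred
    fun x : ((Signature × Code) × ℕ) × ℕ => IsAxiomWitness x.1.1 x.1.2 x.2 := by
  have hm : Computable fun x : ((Signature × Code) × ℕ) × ℕ => x.1.2 :=
    Computable.snd.comp Computable.fst
  have ha : Computable fun x : ((Signature × Code) × ℕ) × ℕ => x.1.1 :=
    Computable.fst.comp Computable.fst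
  have hu : Computable fun x : ((Signature × Code) × ℕ) × ℕ => x.2.unpair :=
    Computable.unpair.comp Computable.snd
  have h1 := Computable.fst.comp hu
  have h2 := Computable.snd.comp hu
  have hc : ∀ k : ℕ, ComputablePred fun x : ((Signature × Code) × ℕ) × ℕ => x.1.2 = k :=
    fun k => computablePred_eq hm (Computable.const k)
  exact computablePred_or (computablePred_or (hc _) (computablePred_or (hc _) (hc _)))
    (computablePred_or (computablePred_or
      (computablePred_eq (formulaCode_atMostOneClass_primrec.to_comp.comp Computable.snd) hm)
      (computablePred_eq (formulaCode_manyLargeClasses_primrec.to_comp.comp Computable.snd) hm))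
    (computablePred_or
      (computablePred_and (computablePred_eq (formulaCode_sentA_primrec.to_comp.comp h1) hm)
        (isWitness_computablePred 0 ha h1 h2))
      (computablePred_and (computablePred_eq (formulaCode_not_sentA_primrec.to_comp.comp h1) hm)
        (isWitness_computablePred 1 ha h1 h2))))

theorem exists_isAxiomWitness_iff {a : Signature × Code} {m : ℕ} :
    (∃ t, IsAxiomWitness a m t) ↔ ∃ φ : sigE.lang.Sentence,
      φ ∈ theoryW (sparseValue 0 a) (sparseValue 1 a) ∧ formulaCode φ = m := by
  constructor
  · rintro ⟨t, (rfl | rfl | rfl) | (rfl | rfl) | ⟨rfl, h⟩ | ⟨rfl, h⟩⟩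
    · exact ⟨_, Or.inl (Or.inl (Or.inl (Or.inl (by simp)))), rfl⟩
    · exact ⟨_, Or.inl (Or.inl (Or.inl (Or.inl (by simp)))), rfl⟩
    · exact ⟨_, Or.inl (Or.inl (Or.inl (Or.inl (by simp)))), rfl⟩
    · exact ⟨_, Or.inl (Or.inl (Or.inl (Or.inr ⟨t, rfl⟩))), rfl⟩
    · exact ⟨_, Or.inl (Or.inl (Or.inr ⟨t, rfl⟩)), rfl⟩
    · exact ⟨_, Or.inl (Or.inr ⟨_, mem_sparseValue.2 ⟨_, h⟩, rfl⟩), rfl⟩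
    · exact ⟨_, Or.inr ⟨_, mem_sparseValue.2 ⟨_, h⟩, rfl⟩, rfl⟩
  · rintro ⟨φ, (((hφ | ⟨n, rfl⟩) | ⟨n, rfl⟩) | ⟨n, hn, rfl⟩) | ⟨n, hn, rfl⟩, rfl⟩
    · refine ⟨0, Or.inl ?_⟩
      rcases hφ with rfl | rfl | rfl <;> simp
    · exact ⟨n, Or.inr (Or.inl (Or.inl rfl))⟩
    · exact ⟨n, Or.inr (Or.inl (Or.inr rfl))⟩
    · obtain ⟨t, ht⟩ := mem_sparseValue.1 hn
      exact ⟨Nat.pair n t, Or.inr (Or.inr (Or.inl (by simpa using ht)))⟩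
    · obtain ⟨t, ht⟩ := mem_sparseValue.1 hn
      exact ⟨Nat.pair n t, Or.inr (Or.inr (Or.inr (by simpa using ht)))⟩

theorem exists_sparseValue_index (v : ℕ) : ∃ y : Signature × Code → Code, Computable y ∧
    ∀ a, IsREIndex (y a) (sparseValue v a) := by
  obtain ⟨y, hy, h⟩ := exists_re_index (p := IsWitness v)
    (isWitness_computablePred v (Computable.fst.comp Computable.fst)
      (Computable.snd.comp Computable.fst) Computable.snd)
  exact ⟨y, hy, fun a m => (h a m).trans mem_sparseValue.symm⟩

/-- `stage` is total for every signature and code, even if the code does not index an essentially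
undecidable theory. So the index function needs no promise about its input. -/
theorem exists_sparse_index : ∃ x : Signature × Code → Code, Computable x ∧
    ∀ a, IsDecisionIndex (x a) (sparse a) :=
  exists_decision_index (p := fun a m => (stage a m).2 = m)
    (computablePred_eq (Computable.snd.comp stage_computable) Computable.snd)

theorem exists_theoryW_index : ∃ w : Signature × Code → Code, Computable w ∧
    ∀ a, IsTheoryIndex (w a) (theoryW (sparseValue 0 a) (sparseValue 1 a)) := by
  obtain ⟨w, hw, h⟩ := exists_re_index (p := IsAxiomWitness) isAxiomWitness_computablePred
  exact ⟨w, hw, fun a m => (h a m).trans exists_isAxiomWitness_iff⟩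

end EssUndec

theorem mainTheorem4 :
    ∃ x y z w : EssUndec.Signature × Nat.Partrec.Code → Nat.Partrec.Code,
      Computable x ∧ Computable y ∧ Computable z ∧ Computable w ∧
      ∀ (s : EssUndec.Signature) (U : s.lang.Theory) (e : Nat.Partrec.Code),
        EssUndec.IsTheoryIndex e U → EssUndec.EssentiallyUndecidable U →
        ∃ (X Y Z : Set ℕ) (W : EssUndec.sigE.lang.Theory),
          EssUndec.IsDecisionIndex (x (s, e)) X ∧
          (∀ T : EssUndec.sigE.lang.Theory, EssUndec.IsJTheory X T → T.IsSatisfiable →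
            ¬ EssUndec.Interprets T U) ∧
          EssUndec.IsREIndex (y (s, e)) Y ∧ Y ⊆ X ∧
          EssUndec.IsREIndex (z (s, e)) Z ∧ Z ⊆ X ∧
          EssUndec.RecursivelyInseparable Y Z ∧
          W = EssUndec.theoryJ ∪ EssUndec.sentA '' Y ∪ (fun n => (EssUndec.sentA n).not) '' Z ∧
          EssUndec.IsTheoryIndex (w (s, e)) W ∧
          W.IsSatisfiable ∧
          EssUndec.EssentiallyUndecidable W ∧
          ¬ EssUndec.Interprets W U := by
  obtain ⟨x, hx, hx'⟩ := EssUndec.exists_sparse_index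
  obtain ⟨y, hy, hy'⟩ := EssUndec.exists_sparseValue_index 0
  obtain ⟨z, hz, hz'⟩ := EssUndec.exists_sparseValue_index 1
  obtain ⟨w, hw, hw'⟩ := EssUndec.exists_theoryW_index
  refine ⟨x, y, z, w, hx, hy, hz, hw, fun s U e he hU => ?_⟩
  have hY := EssUndec.sparseValue_subset 0 (s, e)
  have hZ := EssUndec.sparseValue_subset 1 (s, e)
  have hins := EssUndec.recursivelyInseparable_sparseValue he hU
  have hsat := EssUndec.theoryW_isSatisfiable hins.1
  exact ⟨EssUndec.sparse (s, e), _, _, _, hx' _,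
    fun T hT hT' => EssUndec.not_interprets_of_sparse he hU hT hT', hy' _, hY, hz' _, hZ, hins,
    rfl, hw' _, hsat, EssUndec.essentiallyUndecidable_theoryW hins,
    EssUndec.not_interprets_of_sparse he hU (EssUndec.isJTheory_theoryW hY hZ) hsat⟩
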